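/- Let $X$ be a random vector in $[0,\infty)^d$ with standard Pareto margins, $P(X_j>x)=1/x$ for $x\ge 1$. Assume that $X$ is multivariate regularly varying: there is a probability measure $\nu$ on $\{x\in[0,\infty)^d:\|x\|_\infty>1\}$ with $$\lim_{u\to\infty}P(X/u\in B\mid \|X\|_\infty>u)=\nu(B)$$ for every Borel set $B\subset\{x\in[0,\infty)^d:\|x\|_\infty>1\}$ with $\nu(\partial B)=0$. Extend $\nu$ to sets $B\subset[0,\infty)^d$ bounded away from the origin by $\nu(B)=\nu(B/m_B)/m_B$, where $m_B=\inf_{x\in B}\|x\|_\infty>0$ and $\nu(\emptyset)=0$ (boundaries are taken in $[0,\infty)^d$). Assume the second-order condition: there is a function $a$ with $a(u)\to0$ as $u\to\infty$ such that, for every Borel set $B\subset[0,\infty)^d$ bounded away from the origin with $\nu(\partial B)=0$, $$\frac{P(X\in uB)}{P(\|X\|_\infty>u)}-\nu(B)=O(a(u)),\qquad u\to\infty .$$ Let $r:[0,\infty)^d\to[0,\infty)$ be measurable with $r(tx)=t\,r(x)$ for all $t>0$, such that $\Omega_r=\{x:r(x)>1\}$ is bounded away from the origin and $\nu(\Omega_r)>0$.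 Let $A_1,\dots,A_K$ be a partition of $\Omega_r$ with $\nu(\partial A_j)=0$ for all $j$, where each $A_j$ is obtained by finitely many unions, intersections and complementations from Borel sets $B\subset\Omega_r$ satisfying $tB\subset B$ for all $t>1$. Let $U(t)=\inf\{u\ge0:P(\|X\|_\infty>u)\le 1/t\}$ and let $(k_n)$ be a sequence of natural numbers with $k_n\to\infty$, $k_n/n\to0$ and $\sqrt{k_n}\,a(U(n/k_n))\to0$. Let $X_1,X_2,\dots$ be i.i.d. copies of $X$, let $R_{1,n}\le\dots\le R_{n,n}$ be the order statistics of $r(X_1),\dots,r(X_n)$, and put $$\hat p_j=\frac1{k_n}\sum_{i=1}^n \mathbf 1\{X_i\in R_{n-k_n,n}A_j\},\qquad j=1,\dots,K.$$ Then the limits $p_j=\lim_{u\to\infty}P(X\in uA_j\mid r(X)>u)$, $j=1,\dots,K$, exist and, as $n\to\infty$, $$\Big(\sqrt{k_n}\,(\hat p_j-p_j)\Big)_{j=1}^K\ \xrightarrow{\ d\ }\ \Big(N_j-p_j\sum_{i=1}^K N_i\Big)_{j=1}^K,$$ where $N_1,\dots,N_K$ are independent and $N_j$ is normal with mean $0$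 and variance $p_j$. -/

import Mathlib

open MeasureTheory ProbabilityTheory Filter Topology Asymptotics
open scoped NNReal Pointwise

noncomputable section

namespace KLExtremes

/-- The closed orthant `[0, ∞)^d`, with its own (relative) topology and Borel sets. -/
abbrev Orthant (d : ℕ) : Type := Fin d → ℝ≥0

/-- The maximum norm on `[0, ∞)^d`. -/
def supNorm {d : ℕ} (x : Orthant d) : ℝ≥0 := Finset.univ.sup x

/-- A set is bounded away from the origin. -/
def AwayFromZero {d : ℕ} (B : Set (Orthant d)) : Prop :=
  ∃ ε : ℝ≥0, 0 < ε ∧ ∀ x ∈ B, ε ≤ supNorm x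

/-- All margins of the law `μ` on `[0, ∞)^d` are standard Pareto: `P(X_j > x) = 1 / x`, `x ≥ 1`. -/
def HasParetoMargins {d : ℕ} (μ : Measure (Orthant d)) : Prop :=
  ∀ j : Fin d, ∀ x : ℝ≥0, 1 ≤ x → μ.real {y | x < y j} = 1 / (x : ℝ)

/-- Multivariate regular variation of the law `μ` with exceedance distribution `ν`: `ν` is a
probability measure carried by `{‖x‖_∞ > 1}` and `P(X / u ∈ B | ‖X‖_∞ > u) → ν(B)` for all Borel
`B ⊆ {‖x‖_∞ > 1}` with `ν(∂B) = 0`. -/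
structure IsExceedanceDistribution {d : ℕ} (μ ν : Measure (Orthant d)) : Prop where
  prob : IsProbabilityMeasure ν
  carrier : ν {x | supNorm x ≤ 1} = 0
  tendsto : ∀ B : Set (Orthant d), MeasurableSet B → B ⊆ {x | 1 < supNorm x} →
    ν (frontier B) = 0 →
    Tendsto (fun u : ℝ≥0 => (μ[|{x | u < supNorm x}]).real (u • B)) atTop (𝓝 (ν.real B))

/-- The exponent measure: the extension of the exceedance distribution `ν` to sets `B` bounded
away from the origin, `B ↦ ν(B / m) / m` with `m = inf {‖x‖_∞ : x ∈ B}` (and `∅ ↦ 0`). -/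
def exponentMeasure {d : ℕ} (ν : Measure (Orthant d)) (B : Set (Orthant d)) : ℝ :=
  ν.real ((sInf (supNorm '' B))⁻¹ • B) / (sInf (supNorm '' B) : ℝ≥0)

/-- Second-order condition with scale function `a`: `a(u) → 0` and
`P(X ∈ u B) / P(‖X‖_∞ > u) - ν(B) = O(a(u))` as `u → ∞`, for every Borel set `B` bounded away from
the origin with `ν(∂B) = 0`, where `ν` here stands for the exponent measure. -/
structure SecondOrderCondition {d : ℕ} (μ ν : Measure (Orthant d)) (a : ℝ≥0 → ℝ) : Prop where
  scale : Tendsto a atTop (𝓝 0)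
  rate : ∀ B : Set (Orthant d), MeasurableSet B → AwayFromZero B →
    exponentMeasure ν (frontier B) = 0 →
    (fun u : ℝ≥0 => μ.real (u • B) / μ.real {x | u < supNorm x} - exponentMeasure ν B)
      =O[atTop] a

/-- `Ω_r = {r > 1}`. -/
def exceedanceSet {d : ℕ} (r : Orthant d → ℝ≥0) : Set (Orthant d) := {x | 1 < r x}

/-- A measurable, 1-homogeneous risk functional with `Ω_r` bounded away from the origin. -/
structure IsRiskFunctional {d : ℕ} (r : Orthant d → ℝ≥0) : Prop where
  measurable : Measurable r
  homogeneous : ∀ t : ℝ≥0, 0 < t → ∀ x, r (t • x) = t * r x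
  away : AwayFromZero (exceedanceSet r)

/-- The class of Borel subsets `B` of `Ω_r` with `t B ⊆ B` for all `t > 1`. -/
def stableSets {d : ℕ} (r : Orthant d → ℝ≥0) : Set (Set (Orthant d)) :=
  {B | MeasurableSet B ∧ B ⊆ exceedanceSet r ∧ ∀ t : ℝ≥0, 1 < t → t • B ⊆ B}

/-- `A_1, …, A_K` is a partition of `Ω_r`, each set of which is obtained from sets in
`stableSets r` by finitely many unions, intersections and complementations. -/
structure IsAdmissiblePartition {d K : ℕ} (r : Orthant d → ℝ≥0)
    (A : Fin K → Set (Orthant d)) : Prop where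
  disjoint : Pairwise fun i j => Disjoint (A i) (A j)
  cover : ⋃ j, A j = exceedanceSet r
  algebra : ∀ j, A j ∈ generateSetAlgebra (stableSets r)

/-- `U(t) = inf {u : P(‖X‖_∞ > u) ≤ 1 / t}`. -/
def tailQuantile {d : ℕ} (μ : Measure (Orthant d)) (t : ℝ) : ℝ≥0 :=
  sInf {u : ℝ≥0 | μ.real {x | u < supNorm x} ≤ 1 / t}

/-- `P(X ∈ u A | r(X) > u)`. -/
def condProb {d : ℕ} (μ : Measure (Orthant d)) (r : Orthant d → ℝ≥0) (A : Set (Orthant d))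
    (u : ℝ≥0) : ℝ :=
  (μ[|{x | u < r x}]).real (u • A)

/-- `p = lim_{u → ∞} P(X ∈ u A | r(X) > u)`. -/
def limitProb {d : ℕ} (μ : Measure (Orthant d)) (r : Orthant d → ℝ≥0)
    (A : Set (Orthant d)) : ℝ :=
  limUnder atTop (condProb μ r A)

/-- The `m`-th smallest of the values `v_1, …, v_n`, for `1 ≤ m ≤ n` (and `0` otherwise). -/
def orderStat {n : ℕ} (v : Fin n → ℝ≥0) (m : ℕ) : ℝ≥0 :=
  if h : 1 ≤ m ∧ m ≤ n then v (Tuple.sort v ⟨m - 1, by omega⟩) else 0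

open Classical in
/-- `p̂ = (1 / k) ∑_{i ≤ n} 1{x_i ∈ R_{n-k,n} A}`, where `R_{1,n} ≤ … ≤ R_{n,n}` are the order
statistics of `r(x_1), …, r(x_n)`. -/
def empiricalProb {d n : ℕ} (r : Orthant d → ℝ≥0) (A : Set (Orthant d)) (k : ℕ)
    (x : Fin n → Orthant d) : ℝ :=
  (1 / (k : ℝ)) * ∑ i : Fin n, if x i ∈ orderStat (fun l => r (x l)) (n - k) • A then 1 else 0

end KLExtremes

end

namespace KLExtremes

/-! ### Uniform convergence near a closed null set. -/

section ContinuitySets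

variable {E : Type*} [MeasurableSpace E]

/-! Let `b` be the exponent mass of `Ω_r` and `v_n = U(n/k_n) b`, a deterministic level above which
about `k_n` values of `r` are expected, and write the random level as `R_{n-k,n} = v_n T_n`. The
core is an expansion (`uniform_expansion`): for `A = Ω_r` and `A = A_j`, with `p_A = lim P(X ∈ uA |
r(X) > u)`, `√k (#{X_i ∈ v_n t A} / k - p_A / t) = y_A + o(1)` uniformly in `t` near `1`, where
`y_A` is the centred count in `v_n A` divided by `√k`. For `A = Ω_r`, where `p_A = 1`, the defining
property of the order statistic forces `√k (1 - 1/T_n) ≈ y_Ω = ∑ y_i`. Inserting this into the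
expansion for `A_j` gives `√k (p̂_j - p_j) ≈ y_j - p_j ∑ y_i` (`abs_offset_at_threshold_le`). The
`y_j` count points in disjoint sets of probability of order `k/n → 0`, so they converge jointly to
independent normals with variances `p_j` and no covariance correction
(`tendstoInDistribution_centredCount`).

Uniformity in `t` has a deterministic and a random half; both work near `∂A`, since `tA` and `A`
differ only there (`exists_gauge`).

Bias: the second-order condition controls one set at a time, with no uniformity. A gliding-hump
argument (`uniform_deviation_near_null`) supplies it: if continuity sets ever closer to the boundary
violated the rate, pieces of them could be glued into a single continuity set violating it.

Fluctuation: on `Ω_r` the indicator of `A` is a combination of indicators of sets `B` with `tB ⊆ B`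
for `t > 1`. The dilations of such a `B` form a chain, and the suitably normalised empirical process
along a chain is a martingale. Doob's inequality on a neighbourhood of `∂A` of small mass yields
`equicontinuous`.

Two further facts are needed. The extension of `ν` is only a formula; comparing the limits asserted
by regular variation and by the second-order condition shows that it is homogeneous and, away from
the origin, a measure (`measure_smul_of_subset`, `exponentMeasure_eq_tailMeasure`). The Pareto
margins make the tail of `‖X‖_∞` continuous, so `P(‖X‖_∞ > U(n/k)) = k/n` holds exactly once `n/k >
1` and costs no further rate. -/

lemma exists_null_level (Λ : Measure E) [IsFiniteMeasure Λ] {g : E → ℝ} (hg : Measurable g)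
    {a b : ℝ} (hab : a < b) : ∃ δ, a < δ ∧ δ < b ∧ Λ {x | g x = δ} = 0 := by
  by_contra! h
  have hc := Measure.countable_meas_level_set_pos (μ := Λ) hg
  exact Cardinal.Real.Ioo_countable_iff.not.2 hab.not_ge
    (hc.mono fun δ hδ => pos_iff_ne_zero.2 (h δ hδ.1 hδ.2))

/-- The punctured sublevel sets `{0 < g ≤ 1/(n+1)}` decrease to the empty set, and all but countably
many levels are null for `Λ`. -/
lemma exists_small_null_level (κ Λ : Measure E) [IsFiniteMeasure κ] [IsFiniteMeasure Λ]
    {g : E → ℝ} (hg : Measurable g) {δ ε : ℝ} (hδ : 0 < δ) (hε : 0 < ε) :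
    ∃ δ', 0 < δ' ∧ δ' < δ ∧ κ.real {x | 0 < g x ∧ g x ≤ δ'} < ε ∧ Λ {x | g x = δ'} = 0 := by
  set S : ℕ → Set E := fun n => {x | 0 < g x ∧ g x ≤ 1 / ((n : ℝ) + 1)}
  have hS : Tendsto (fun n => κ.real (S n)) atTop (𝓝 0) := by
    have h1 : Tendsto (κ ∘ S) atTop (𝓝 (κ (⋂ n, S n))) := by
      refine tendsto_measure_iInter_atTop (fun n => ?_) ?_ ⟨0, measure_ne_top _ _⟩
      · exact ((measurableSet_lt measurable_const hg).inter
          (measurableSet_le hg measurable_const)).nullMeasurableSet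
      · intro m n hmn x hx
        exact ⟨hx.1, hx.2.trans (by gcongr)⟩
    have h2 : (⋂ n, S n) = ∅ := by
      ext x
      simp only [Set.mem_iInter, Set.mem_empty_iff_false, iff_false]
      intro h
      obtain ⟨n, hn⟩ := exists_nat_one_div_lt (h 0).1
      exact absurd (h n).2 (not_le.2 hn)
    rw [h2, measure_empty] at h1
    exact (ENNReal.tendsto_toReal ENNReal.zero_ne_top).comp h1
  obtain ⟨n, hn⟩ := (hS.eventually_lt_const hε).exists
  obtain ⟨δ', h0, h1, h2⟩ := exists_null_level Λ hg
    (lt_min hδ (by positivity : (0 : ℝ) < 1 / ((n : ℝ) + 1)))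
  refine ⟨δ', h0, h1.trans_le (min_le_left _ _), lt_of_le_of_lt (measureReal_mono ?_) hn, h2⟩
  exact fun x hx => ⟨hx.1, hx.2.trans (h1.le.trans (min_le_right _ _))⟩

lemma mem_frontier_of_inter_eq {E : Type*} [TopologicalSpace E] {S B U : Set E} (hU : IsOpen U) (h : B ∩ U = S ∩ U) {x : E}
    (hx : x ∈ U) (hB : x ∈ frontier B) : x ∈ frontier S := by
  have : x ∈ frontier (B ∩ U) ∩ U := by
    rw [frontier_inter_open_inter hU]; exact ⟨hB, hx⟩
  rw [h, frontier_inter_open_inter hU] at this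
  exact this.1

variable [TopologicalSpace E]

lemma measure_frontier_union_null {Λ : Measure E} {A B : Set E} (hA : Λ (frontier A) = 0)
    (hB : Λ (frontier B) = 0) : Λ (frontier (A ∪ B)) = 0 :=
  measure_mono_null ((frontier_union_subset A B).trans
    (Set.union_subset_union Set.inter_subset_left Set.inter_subset_right))
    (measure_union_null hA hB)

lemma measure_frontier_inter_null {Λ : Measure E} {A B : Set E} (hA : Λ (frontier A) = 0)
    (hB : Λ (frontier B) = 0) : Λ (frontier (A ∩ B)) = 0 :=
  measure_mono_null ((frontier_inter_subset A B).trans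
    (Set.union_subset_union Set.inter_subset_left Set.inter_subset_right))
    (measure_union_null hA hB)

lemma measure_frontier_diff_null {Λ : Measure E} {A B : Set E} (hA : Λ (frontier A) = 0)
    (hB : Λ (frontier B) = 0) : Λ (frontier (A \ B)) = 0 := by
  rw [Set.sdiff_eq]
  exact measure_frontier_inter_null hA (by rwa [frontier_compl])

variable [BorelSpace E]

/-- Scaled deviations of finite measures that vanish in the limit on every continuity set do so
uniformly over the continuity sets contained in small neighbourhoods of a closed null set. -/
theorem uniform_deviation_near_null (μ : ℕ → Measure E) [∀ n, IsFiniteMeasure (μ n)]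
    (Λ : Measure E) [IsFiniteMeasure Λ] (b : ℕ → ℝ) (hb : ∀ n, 0 ≤ b n) (W : Set E)
    (hQ : ∀ B, MeasurableSet B → B ⊆ W → Λ (frontier B) = 0 →
      Tendsto (fun n => b n * ((μ n).real B - Λ.real B)) atTop (𝓝 0))
    {g : E → ℝ} (hg : Continuous g) (hg0 : ∀ x, 0 ≤ g x) {δ₀ : ℝ} (hδ₀ : 0 < δ₀)
    (hW : {x | g x ≤ δ₀} ⊆ W) (hΛ : Λ {x | g x = 0} = 0) {η : ℝ} (hη : 0 < η) :
    ∃ δ > 0, ∀ᶠ n in atTop, ∀ B, MeasurableSet B → B ⊆ {x | g x ≤ δ} → Λ (frontier B) = 0 →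
      |b n * ((μ n).real B - Λ.real B)| ≤ η := by
  have hgm := hg.measurable
  set Q : ℕ → Set E → ℝ := fun n B => b n * ((μ n).real B - Λ.real B) with hQdef
  set Z : Set E := {x | g x = 0} with hZdef
  have hZm : MeasurableSet Z := hgm (measurableSet_singleton 0)
  have hZc : IsClosed Z := isClosed_singleton.preimage hg
  have hZQ : Tendsto (fun n => Q n Z) atTop (𝓝 0) :=
    hQ Z hZm (fun x hx => hW (by simp only [hZdef, Set.mem_ofPred_eq] at hx ⊢; linarith))
      (measure_mono_null hZc.frontier_subset hΛ)
  have hlev : ∀ δ, Λ {x | g x = δ} = 0 → Λ (frontier {x | g x ≤ δ}) = 0 := fun δ h =>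
    measure_mono_null (frontier_le_subset_eq hg continuous_const) h
  have hQu : ∀ n (A B : Set E), MeasurableSet B → Disjoint A B → Q n (A ∪ B) = Q n A + Q n B := by
    intro n A B hB hAB
    simp only [hQdef]
    rw [measureReal_union hAB hB, measureReal_union hAB hB]; ring
  by_contra! hcon
  -- a state is a continuity set off `{g ≤ δ}`, together with `δ` and an index
  let Inv : Set E × ℝ × ℕ → Prop := fun s =>
    MeasurableSet s.1 ∧ Λ (frontier s.1) = 0 ∧ s.1 ⊆ W ∧ (∀ x ∈ s.1, s.2.1 < g x) ∧
      0 < s.2.1 ∧ s.2.1 ≤ δ₀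
  -- The last clause is the hump: whatever is added later inside `{0 < g ≤ δ'}`, the deviation at
  -- the index of `s'` stays at least `η / 2`.
  let R : {s // Inv s} → {s // Inv s} → Prop := fun s s' =>
    s.1.2.2 < s'.1.2.2 ∧ s'.1.2.1 ≤ s.1.2.1 / 2 ∧ s.1.1 ⊆ s'.1.1 ∧
    (∀ x ∈ s'.1.1, s.1.2.1 < g x → x ∈ s.1.1) ∧
    (∀ B, MeasurableSet B → s'.1.1 ⊆ B → (∀ x ∈ B, s'.1.2.1 < g x → x ∈ s'.1.1) →
      (∀ x ∈ B, 0 < g x) → η / 2 ≤ |Q s'.1.2.2 B|)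
  -- At a late index `N` the old set and `Z` have negligible deviation, while some `B ⊆ {g ≤ δ}`
  -- deviates by more than `η`. The part of `B` outside a much smaller neighbourhood of `Z` is glued
  -- on; four errors of `η / 8` are lost.
  have step : ∀ s, ∃ s', R s s' := by
    rintro ⟨⟨S, δ, n⟩, hSm, hSf, hSW, hSg, hδ, hδδ⟩
    simp only at hSm hSf hSW hSg hδ hδδ
    have hη8 : (0 : ℝ) < η / 8 := by positivity
    have hη8' : |(0 : ℝ)| < η / 8 := by rwa [abs_zero]
    have e1 := (hQ S hSm hSW hSf).abs.eventually_lt_const hη8'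
    have e2 := hZQ.abs.eventually_lt_const hη8'
    obtain ⟨N, ⟨⟨B, hBm, hBg, hBf, hBQ⟩, e1, e2⟩, hN⟩ :=
      (((hcon δ hδ).and_eventually (e1.and e2)).and_eventually (eventually_gt_atTop n)).exists
    -- With `N` fixed, `δ'` is so small that nothing inside `{0 < g ≤ δ'}` matters at index `N`; `b
    -- N + 1` avoids dividing by zero.
    obtain ⟨δ', h0', h1', h2', h3'⟩ := exists_small_null_level (μ N + Λ) Λ hgm
      (half_pos hδ) (show 0 < η / 8 / (b N + 1) from div_pos hη8 (by linarith [hb N]))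
    have small : ∀ A, A ⊆ {x | 0 < g x ∧ g x ≤ δ'} → |Q N A| ≤ η / 8 := by
      intro A hA
      have hle : (μ N).real A + Λ.real A ≤ η / 8 / (b N + 1) := by
        have := (measureReal_mono (μ := μ N + Λ) hA).trans h2'.le
        rwa [measureReal_add_apply] at this
      have h1 : |(μ N).real A - Λ.real A| ≤ η / 8 / (b N + 1) := by
        rw [abs_le]
        have i1 := measureReal_nonneg (μ := μ N) (s := A)
        have i2 := measureReal_nonneg (μ := Λ) (s := A)
        constructor <;> linarith
      rw [hQdef]; simp only
      rw [abs_mul, abs_of_nonneg (hb N)]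
      calc b N * |(μ N).real A - Λ.real A| ≤ b N * (η / 8 / (b N + 1)) := by
            gcongr; exact hb N
        _ ≤ (b N + 1) * (η / 8 / (b N + 1)) :=
            mul_le_mul_of_nonneg_right (by linarith)
              (div_nonneg hη8.le (by linarith [hb N]))
        _ = η / 8 := by field_simp [(by linarith [hb N] : b N + 1 ≠ 0)]
    set V : Set E := {x | g x ≤ δ'} with hVdef
    have hVm : MeasurableSet V := measurableSet_le hgm measurable_const
    have hdisj : ∀ x ∈ S, x ∉ B := fun x hx hxB => absurd (hBg hxB) (not_le.2 (hSg x hx))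
    refine ⟨⟨(S ∪ B \ V, δ', N), hSm.union (hBm.diff hVm),
      measure_frontier_union_null hSf (measure_frontier_diff_null hBf (hlev _ h3')), ?_, ?_, h0',
      by simp only; linarith⟩, hN, h1'.le, Set.subset_union_left, ?_, ?_⟩
    · rintro x (hx | hx)
      · exact hSW hx
      · exact hW ((hBg hx.1).trans hδδ)
    · rintro x (hx | hx)
      · exact (by linarith : δ' < δ).trans (hSg x hx)
      · exact not_le.1 hx.2
    · rintro x (hx | hx) hgx
      · exact hx
      · exact absurd (hBg hx.1) (not_le.2 hgx)
    · intro C hCm hC1 hC2 hC3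
      simp only at hC1 hC2 ⊢
      have hCeq : C = (S ∪ B \ V) ∪ C ∩ V := by
        ext x
        constructor
        · intro hx
          by_cases hxV : x ∈ V
          · exact Or.inr ⟨hx, hxV⟩
          · exact Or.inl (hC2 x hx (not_le.1 hxV))
        · rintro (hx | hx)
          · exact hC1 hx
          · exact hx.1
      have hd1 : Disjoint (S ∪ B \ V) (C ∩ V) := by
        rw [Set.disjoint_left]
        rintro x (hx | hx) hx'
        · exact absurd (show g x ≤ δ' from hx'.2)
            (not_le.2 (by linarith [hSg x hx]))
        · exact hx.2 hx'.2
      have hd2 : Disjoint S (B \ V) := Set.disjoint_left.2 fun x hx hx' => hdisj x hx hx'.1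
      have hBeq : B = (B \ V) ∪ ((B ∩ V ∩ Z) ∪ (B ∩ V) \ Z) := by
        rw [Set.inter_union_sdiff, Set.union_comm, Set.inter_union_sdiff]
      have q1 : Q N C = Q N S + Q N (B \ V) + Q N (C ∩ V) := by
        conv_lhs => rw [hCeq]
        rw [hQu _ _ _ (hCm.inter hVm) hd1, hQu _ _ _ (hBm.diff hVm) hd2]
      have q2 : Q N B = Q N (B \ V) + (Q N (B ∩ V ∩ Z) + Q N ((B ∩ V) \ Z)) := by
        conv_lhs => rw [hBeq]
        rw [hQu, hQu]
        · exact (hBm.inter hVm).diff hZm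
        · exact Set.disjoint_left.2 fun x hx hx' => hx'.2 hx.2
        · exact ((hBm.inter hVm).inter hZm).union ((hBm.inter hVm).diff hZm)
        · rw [Set.inter_union_sdiff]
          exact Set.disjoint_left.2 fun x hx hx' => hx.2 hx'.2
      have s1 : |Q N (C ∩ V)| ≤ η / 8 := small _ fun x hx => ⟨hC3 x hx.1, hx.2⟩
      have s2 : |Q N ((B ∩ V) \ Z)| ≤ η / 8 := small _ fun x hx =>
        ⟨lt_of_le_of_ne (hg0 x) (Ne.symm hx.2), hx.1.2⟩
      -- On subsets of the null set `Z` the deviation is `b N * μ N`, hence nonnegative and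
      -- monotone.
      have s3 : |Q N (B ∩ V ∩ Z)| ≤ |Q N Z| := by
        have hz1 : Λ.real (B ∩ V ∩ Z) = 0 := by
          rw [measureReal_def, measure_mono_null Set.inter_subset_right hΛ]; simp
        have hz2 : Λ.real Z = 0 := by rw [measureReal_def, hΛ]; simp
        simp only [hQdef, hz1, hz2, sub_zero]
        rw [abs_of_nonneg (mul_nonneg (hb N) measureReal_nonneg),
          abs_of_nonneg (mul_nonneg (hb N) measureReal_nonneg)]
        exact mul_le_mul_of_nonneg_left (measureReal_mono Set.inter_subset_right) (hb N)
      have s4 : η < |Q N B| := hBQ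
      rw [abs_le] at s1 s2
      have e1 : |Q N S| < η / 8 := e1
      have e2 : |Q N Z| < η / 8 := e2
      rw [abs_lt] at e1
      have s3' := abs_le.1 (s3.trans e2.le)
      rcases lt_abs.1 s4 with h | h
      · refine le_abs.2 (Or.inl ?_); linarith
      · refine le_abs.2 (Or.inr ?_); linarith
  choose next hnext using step
  have hδ0' : Inv (∅, δ₀, 0) := by
    refine ⟨MeasurableSet.empty, by simp, Set.empty_subset _, by simp, hδ₀, le_rfl⟩
  let f : ℕ → {s // Inv s} := fun i => Nat.rec ⟨_, hδ0'⟩ (fun _ s => next s) i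
  have hf : ∀ i, R (f i) (f (i + 1)) := fun i => hnext (f i)
  have hmonoS : Monotone fun i => (f i).1.1 := monotone_nat_of_le_succ fun i => (hf i).2.2.1
  have hδle : ∀ i, (f i).1.2.1 ≤ δ₀ * (1 / 2) ^ i := by
    intro i
    induction i with
    | zero => simp [f]
    | succ i ih =>
      have := (hf i).2.1
      rw [pow_succ]; linarith
  have hanti : Antitone fun i => (f i).1.2.1 := antitone_nat_of_succ_le fun i =>
    (hf i).2.1.trans (by linarith [(f i).2.2.2.2.2.1])
  have hnmono : StrictMono fun i => (f i).1.2.2 := strictMono_nat_of_lt_succ fun i => (hf i).1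
  have hback : ∀ i j x, x ∈ (f j).1.1 → (f i).1.2.1 < g x → x ∈ (f i).1.1 := by
    intro i j x hx hgx
    rcases le_total j i with h | h
    · exact hmonoS h hx
    · induction j, h using Nat.le_induction with
      | base => exact hx
      | succ j hij ih => exact ih ((hf j).2.2.2.1 x hx ((hanti hij).trans_lt hgx))
  set B : Set E := ⋃ i, (f i).1.1 with hBdef
  have hBm : MeasurableSet B := MeasurableSet.iUnion fun i => (f i).2.1
  have hBback : ∀ i, ∀ x ∈ B, (f i).1.2.1 < g x → x ∈ (f i).1.1 := by
    intro i x hx hgx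
    obtain ⟨j, hj⟩ := Set.mem_iUnion.1 hx
    exact hback i j x hj hgx
  have hBW : B ⊆ W := Set.iUnion_subset fun i => (f i).2.2.2.1
  have hBpos : ∀ x ∈ B, 0 < g x := by
    intro x hx
    obtain ⟨j, hj⟩ := Set.mem_iUnion.1 hx
    exact (f j).2.2.2.2.2.1.trans ((f j).2.2.2.2.1 x hj)
  -- On each open set `{g > δ_i}` the union coincides with its `i`-th stage, so off `Z` every
  -- boundary point is one of some stage.
  have hBf : Λ (frontier B) = 0 := by
    have hsub : frontier B ⊆ Z ∪ ⋃ i, frontier (f i).1.1 := by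
      intro x hx
      rcases (hg0 x).eq_or_lt with h | h
      · exact Or.inl h.symm
      · have htend : Tendsto (fun i : ℕ => δ₀ * (1 / 2 : ℝ) ^ i) atTop (𝓝 (δ₀ * 0)) :=
          (tendsto_pow_atTop_nhds_zero_of_lt_one (by norm_num) (by norm_num)).const_mul _
        obtain ⟨i, hi⟩ := (htend.eventually_lt_const (by simpa using h)).exists
        have hi' := (hδle i).trans_lt hi
        refine Or.inr (Set.mem_iUnion.2 ⟨i, mem_frontier_of_inter_eq
          (isOpen_lt continuous_const hg : IsOpen {x | (f i).1.2.1 < g x}) ?_ hi' hx⟩)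
        ext y
        constructor
        · exact fun hy => ⟨hBback i y hy.1 hy.2, hy.2⟩
        · exact fun hy => ⟨Set.mem_iUnion.2 ⟨i, hy.1⟩, hy.2⟩
    exact measure_mono_null hsub (measure_union_null hΛ
      (measure_iUnion_null fun i => (f i).2.2.1))
  have hlim := ((hQ B hBm hBW hBf).comp
    (hnmono.tendsto_atTop.comp (tendsto_add_atTop_nat 1))).abs
  have hev := hlim.eventually_lt_const (show |(0 : ℝ)| < η / 2 by simpa using half_pos hη)
  obtain ⟨i, hi⟩ := hev.exists
  have := (hf i).2.2.2.2 B hBm (Set.subset_iUnion (fun i => (f i).1.1) (i + 1))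
    (hBback (i + 1)) hBpos
  exact absurd hi (not_lt.2 this)

end ContinuitySets

end KLExtremes

/-! ### Scaling on the orthant, and homogeneity of the exceedance distribution on closed sets. -/

namespace KLExtremes

variable {d : ℕ}

lemma supNorm_eq_nndist (x : Orthant d) : supNorm x = nndist x 0 := by
  rw [nndist_pi_def]
  simp [supNorm, NNReal.nndist_zero_eq_val']

lemma continuous_supNorm : Continuous (supNorm : Orthant d → ℝ≥0) := by
  simp_rw [funext supNorm_eq_nndist]
  fun_prop

lemma measurable_supNorm : Measurable (supNorm : Orthant d → ℝ≥0) :=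
  continuous_supNorm.measurable

lemma supNorm_smul (t : ℝ≥0) (x : Orthant d) : supNorm (t • x) = t * supNorm x := by
  simp only [supNorm]
  rw [NNReal.mul_finset_sup]
  rfl

lemma le_supNorm (x : Orthant d) (j : Fin d) : x j ≤ supNorm x :=
  Finset.le_sup (f := x) (Finset.mem_univ j)

lemma supNorm_le_add_dist (x y : Orthant d) : (supNorm x : ℝ) ≤ supNorm y + dist x y := by
  simp only [supNorm_eq_nndist, coe_nndist]
  linarith [dist_triangle x y 0]

lemma dist_smul_left (s t : ℝ≥0) (x : Orthant d) :
    dist (s • x) (t • x) ≤ dist s t * supNorm x := by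
  refine (dist_pi_le_iff (by positivity)).2 fun j => ?_
  have h : dist ((s • x) j) ((t • x) j) = dist s t * x j := by
    simp only [Pi.smul_apply, smul_eq_mul, NNReal.dist_eq, NNReal.coe_mul]
    rw [← sub_mul, abs_mul, NNReal.abs_eq]
  rw [h]
  exact mul_le_mul_of_nonneg_left (by exact_mod_cast le_supNorm x j) dist_nonneg

lemma frontier_smul_set {t : ℝ≥0} (ht : t ≠ 0) (B : Set (Orthant d)) :
    frontier (t • B) = t • frontier B :=
  ((Homeomorph.smulOfNeZero t ht).image_frontier B).symm

lemma mem_smul_set_iff {t : ℝ≥0} (ht : t ≠ 0) {B : Set (Orthant d)} {x : Orthant d} :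
    x ∈ t • B ↔ t⁻¹ • x ∈ B := Set.mem_smul_set_iff_inv_smul_mem₀ ht B x

lemma measurableSet_smul {B : Set (Orthant d)} (hB : MeasurableSet B) {t : ℝ≥0} (ht : t ≠ 0) :
    MeasurableSet (t • B) := hB.const_smul_of_ne_zero ht

lemma smul_setOf_lt_supNorm {t : ℝ≥0} (ht : t ≠ 0) (s : ℝ≥0) :
    t • {x : Orthant d | s < supNorm x} = {x | t * s < supNorm x} := by
  ext x
  rw [mem_smul_set_iff ht, Set.mem_ofPred_eq, supNorm_smul, Set.mem_ofPred_eq,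
    ← mul_lt_mul_iff_right₀ (pos_iff_ne_zero.2 ht), mul_inv_cancel_left₀ ht]

lemma smul_setOf_supNorm_eq {t : ℝ≥0} (ht : t ≠ 0) (s : ℝ≥0) :
    t • {x : Orthant d | supNorm x = s} = {x | supNorm x = t * s} := by
  ext x
  rw [mem_smul_set_iff ht, Set.mem_ofPred_eq, supNorm_smul, Set.mem_ofPred_eq, inv_mul_eq_iff_eq_mul₀ ht]

lemma cond_supNorm_real_smul (μ : Measure (Orthant d)) {B : Set (Orthant d)}
    (hB : B ⊆ {x | 1 < supNorm x}) {u : ℝ≥0} (hu : u ≠ 0) :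
    (μ[|{x | u < supNorm x}]).real (u • B) = μ.real (u • B) / μ.real {x | u < supNorm x} := by
  have hm : MeasurableSet {x : Orthant d | u < supNorm x} :=
    measurableSet_lt measurable_const measurable_supNorm
  have hsub : u • B ⊆ {x | u < supNorm x} := by
    have := Set.smul_set_mono (a := u) hB
    rwa [smul_setOf_lt_supNorm hu, mul_one] at this
  rw [measureReal_def, cond_apply hm, Set.inter_eq_self_of_subset_right hsub, ENNReal.toReal_mul,
    ENNReal.toReal_inv, div_eq_inv_mul]
  rfl

lemma exponentMeasure_of_isLeast {ν : Measure (Orthant d)} {B : Set (Orthant d)} {m : ℝ≥0}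
    (hm : IsLeast (supNorm '' B) m) : exponentMeasure ν B = ν.real (m⁻¹ • B) / m := by
  rw [exponentMeasure, hm.csInf_eq]

lemma isLeast_smul {B : Set (Orthant d)} {m t : ℝ≥0}
    (hm : IsLeast (supNorm '' B) m) : IsLeast (supNorm '' (t • B)) (t * m) := by
  obtain ⟨⟨x, hx, hxm⟩, hle⟩ := hm
  refine ⟨⟨t • x, Set.smul_mem_smul_set hx, by rw [supNorm_smul, hxm]⟩, ?_⟩
  rintro _ ⟨_, ⟨y, hy, rfl⟩, rfl⟩
  simp only [supNorm_smul]
  gcongr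
  exact hle ⟨y, hy, rfl⟩

lemma exponentMeasure_smul_of_isLeast {ν : Measure (Orthant d)} {B : Set (Orthant d)} {m t : ℝ≥0}
    (ht : t ≠ 0) (hm : IsLeast (supNorm '' B) m) :
    exponentMeasure ν (t • B) = exponentMeasure ν B / t := by
  rw [exponentMeasure_of_isLeast hm, exponentMeasure_of_isLeast (isLeast_smul hm), mul_inv, mul_comm,
    mul_smul, smul_smul t⁻¹, inv_mul_cancel₀ ht, one_smul, NNReal.coe_mul, mul_comm, div_div]

lemma SecondOrderCondition.tendsto_ratio {μ ν : Measure (Orthant d)} {a : ℝ≥0 → ℝ}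
    (h : SecondOrderCondition μ ν a) {B : Set (Orthant d)} (hB : MeasurableSet B)
    (hB0 : AwayFromZero B) (hBf : exponentMeasure ν (frontier B) = 0) :
    Tendsto (fun u : ℝ≥0 => μ.real (u • B) / μ.real {x | u < supNorm x}) atTop
      (𝓝 (exponentMeasure ν B)) := by
  have := (h.rate B hB hB0 hBf).trans_tendsto h.scale
  simpa using this.add_const (exponentMeasure ν B)

lemma IsExceedanceDistribution.tendsto_ratio {μ ν : Measure (Orthant d)}
    (h : IsExceedanceDistribution μ ν) {B : Set (Orthant d)} (hB : MeasurableSet B)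
    (hB1 : B ⊆ {x | 1 < supNorm x}) (hBf : ν (frontier B) = 0) :
    Tendsto (fun u : ℝ≥0 => μ.real (u • B) / μ.real {x | u < supNorm x}) atTop
      (𝓝 (ν.real B)) := by
  refine (h.tendsto B hB hB1 hBf).congr' ?_
  filter_upwards [eventually_gt_atTop 0] with u hu
  exact cond_supNorm_real_smul μ hB1 hu.ne'

/-- As `ν` charges `{‖x‖_∞ > 1}`, there is a nonzero vector to rescale; this is what rules out `d =
0`. -/
lemma IsExceedanceDistribution.exists_supNorm_eq {μ ν : Measure (Orthant d)}
    (h : IsExceedanceDistribution μ ν) (s : ℝ≥0) : ∃ x : Orthant d, supNorm x = s := by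
  have := h.prob
  have h1 : ν {x | 1 < supNorm x} ≠ 0 := by
    intro h2
    have : ν Set.univ = 0 := measure_mono_null (fun x _ => (le_or_gt (supNorm x) 1))
      (measure_union_null h.carrier h2)
    simp at this
  obtain ⟨x, hx⟩ := nonempty_of_measure_ne_zero h1
  have hx0 : supNorm x ≠ 0 := (zero_lt_one.trans hx).ne'
  exact ⟨(s / supNorm x) • x, by rw [supNorm_smul, div_mul_cancel₀ _ hx0]⟩

lemma measure_null_union {E : Type*} [MeasurableSpace E] {κ : Measure E} {S C : Set E}
    (hS : κ S = 0) : κ (S ∪ C) = κ C :=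
  le_antisymm ((measure_union_le S C).trans (by rw [hS, zero_add]))
    (measure_mono Set.subset_union_right)

/-- For closed sets at a positive distance from the unit ball, dilation by `t > 1` divides the mass
by `t`. -/
lemma real_smul_of_isClosed {μ ν : Measure (Orthant d)} {a : ℝ≥0 → ℝ}
    (hmrv : IsExceedanceDistribution μ ν) (hsec : SecondOrderCondition μ ν a) {t s : ℝ≥0}
    (ht : 1 < t) (hs : 1 < s) {F : Set (Orthant d)} (hF : IsClosed F)
    (hFs : F ⊆ {x | s ≤ supNorm x}) : ν.real (t • F) = ν.real F / t := by
  have := hmrv.prob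
  have ht0 : t ≠ 0 := (zero_lt_one.trans ht).ne'
  rcases F.eq_empty_or_nonempty with rfl | hFne
  · simp
  have hinv : ∀ c : ℝ≥0, Measurable fun x : Orthant d => c • x := fun c => measurable_const_smul c
  have hmap : ∀ c : ℝ≥0, c ≠ 0 → ∀ B : Set (Orthant d), MeasurableSet B →
      (ν.map fun x => c⁻¹ • x) B = ν (c • B) := by
    intro c hc B hB
    rw [Measure.map_apply (hinv _) hB]
    congr 1
    ext x
    exact (mem_smul_set_iff hc).symm
  have hsn : Measurable fun x : Orthant d => (supNorm x : ℝ) :=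
    measurable_supNorm.coe_nnreal_real
  -- A radius strictly between the unit ball and `F` whose sphere, and its dilation by `t`, are
  -- `ν`-null.
  obtain ⟨η', h1, h2, h3⟩ := exists_null_level (ν + ν.map fun x => t⁻¹ • x) hsn
    (show ((1 : ℝ≥0) : ℝ) < s by exact_mod_cast hs)
  lift η' to ℝ≥0 using (by have := NNReal.coe_nonneg 1; linarith)
  rename ℝ≥0 => η
  have hη1 : 1 < η := by exact_mod_cast h1
  have hηs : η < s := by exact_mod_cast h2
  have hη0 : η ≠ 0 := (zero_lt_one.trans hη1).ne'
  set S : Set (Orthant d) := {x | supNorm x = η} with hSdef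
  have hSc : IsClosed S := isClosed_singleton.preimage continuous_supNorm
  have h3' : (ν + ν.map fun x => t⁻¹ • x) S = 0 := by
    convert h3 using 2; ext x; simp [hSdef]
  rw [Measure.add_apply, hmap t ht0 _ hSc.measurableSet, add_eq_zero] at h3'
  obtain ⟨hS1, hS2⟩ := h3'
  have hS3 : ν (η⁻¹ • S) = 0 := by
    rw [hSdef, smul_setOf_supNorm_eq (inv_ne_zero hη0), inv_mul_cancel₀ hη0]
    exact measure_mono_null (fun x hx => le_of_eq hx) hmrv.carrier
  set g : Orthant d → ℝ := fun x => Metric.infDist x F with hgdef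
  have hgc : Continuous g := Metric.continuous_infDist_pt F
  have hgS : ∀ x, (s : ℝ) ≤ supNorm x + g x := by
    intro x
    have : (s : ℝ) - supNorm x ≤ g x := by
      refine (Metric.le_infDist hFne).2 fun y hy => ?_
      have h4 := supNorm_le_add_dist y x
      have h5 : (s : ℝ) ≤ supNorm y := by exact_mod_cast hFs hy
      rw [dist_comm] at h4
      linarith
    linarith
  -- the identity for generic neighbourhoods of `F`
  have key : ∀ δ : ℝ, 0 < δ → δ < s - η →
      (ν + ν.map (fun x => t⁻¹ • x) + ν.map (fun x => (η⁻¹)⁻¹ • x)) {x | g x = δ} = 0 →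
      ν.real (t • {x | g x ≤ δ}) = ν.real {x | g x ≤ δ} / t := by
    intro δ hδ0 hδ hδn
    have hTm : MeasurableSet {x | g x = δ} := hgc.measurable (measurableSet_singleton δ)
    rw [Measure.add_apply, Measure.add_apply, hmap t ht0 _ hTm, hmap _ (inv_ne_zero hη0) _ hTm,
      add_eq_zero, add_eq_zero] at hδn
    obtain ⟨⟨hT1, hT2⟩, hT3⟩ := hδn
    set C : Set (Orthant d) := {x | g x ≤ δ} with hCdef
    have hCc : IsClosed C := isClosed_le hgc continuous_const
    have hCη : ∀ x ∈ C, η < supNorm x := by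
      intro x hx
      have h1 : g x ≤ δ := hx
      have := hgS x
      have : (η : ℝ) < supNorm x := by linarith
      exact_mod_cast this
    -- The null sphere pins the least norm of both `B` and `∂B` at `η`. The exponent mass of `∂B` is
    -- then normalised by a known radius and can be checked to vanish before any homogeneity is
    -- available.
    set B : Set (Orthant d) := S ∪ C with hBdef
    have hBc : IsClosed B := hSc.union hCc
    have hBη : ∀ x ∈ B, η ≤ supNorm x := by
      rintro x (hx | hx)
      · exact (show supNorm x = η from hx).ge
      · exact (hCη x hx).le
    have hfr : frontier B ⊆ S ∪ {x | g x = δ} :=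
      (frontier_union_subset S C).trans (Set.union_subset_union
        (Set.inter_subset_left.trans hSc.frontier_subset)
        (Set.inter_subset_right.trans (frontier_le_subset_eq hgc continuous_const)))
    obtain ⟨x₀, hx₀⟩ := hmrv.exists_supNorm_eq η
    have hx₀B : x₀ ∈ frontier B := by
      rw [hBc.frontier_eq]
      -- A sphere point is not interior: shrinking it slightly gives norm below `η`, outside `B`.
      refine ⟨Or.inl hx₀, fun hint => ?_⟩
      have hc : Tendsto (fun n : ℕ => (1 - 1 / ((n : ℝ≥0) + 1)) • x₀) atTop (𝓝 x₀) := by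
        have h1 : Tendsto (fun n : ℕ => 1 - 1 / ((n : ℝ≥0) + 1)) atTop (𝓝 (1 - 0)) :=
          (tendsto_const_nhds (x := (1 : ℝ≥0))).sub tendsto_one_div_add_atTop_nhds_zero_nat
        simpa using h1.smul_const x₀
      obtain ⟨n, hn⟩ := (hc.eventually (mem_interior_iff_mem_nhds.1 hint)).exists
      have h6 := hBη _ hn
      rw [supNorm_smul, hx₀] at h6
      have h7 : 1 - 1 / ((n : ℝ≥0) + 1) < 1 := tsub_lt_self one_pos (by positivity)
      exact absurd h6 (not_le.2 (mul_lt_of_lt_one_left (pos_iff_ne_zero.2 hη0) h7))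
    have hleast : IsLeast (supNorm '' B) η :=
      ⟨⟨x₀, Or.inl hx₀, hx₀⟩, by rintro _ ⟨y, hy, rfl⟩; exact hBη y hy⟩
    have hleast' : IsLeast (supNorm '' frontier B) η :=
      ⟨⟨x₀, hx₀B, hx₀⟩, by rintro _ ⟨y, hy, rfl⟩; exact hBη y (hBc.frontier_subset hy)⟩
    have hBf : exponentMeasure ν (frontier B) = 0 := by
      rw [exponentMeasure_of_isLeast hleast', measureReal_def,
        measure_mono_null (Set.smul_set_mono hfr)]
      · simp
      · rw [Set.smul_set_union]
        exact measure_union_null hS3 hT3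
    have hBf' : exponentMeasure ν (frontier (t • B)) = 0 := by
      rw [frontier_smul_set ht0, exponentMeasure_smul_of_isLeast ht0 hleast', hBf, zero_div]
    have hνf : ν (frontier B) = 0 := measure_mono_null hfr (measure_union_null hS1 hT1)
    have hνf' : ν (frontier (t • B)) = 0 := by
      rw [frontier_smul_set ht0]
      refine measure_mono_null (Set.smul_set_mono hfr) ?_
      rw [Set.smul_set_union]
      exact measure_union_null hS2 hT2
    have hB1 : B ⊆ {x | 1 < supNorm x} := fun x hx => hη1.trans_le (hBη x hx)
    have htBη : ∀ x ∈ t • B, t * η ≤ supNorm x := by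
      rintro _ ⟨y, hy, rfl⟩
      simp only [supNorm_smul]
      gcongr
      exact hBη y hy
    have htB1 : t • B ⊆ {x | 1 < supNorm x} := fun x hx =>
      (one_lt_mul ht.le hη1).trans_le (htBη x hx)
    have hBm := hBc.measurableSet
    have htBm := measurableSet_smul hBm ht0
    -- The same ratio has limit `ν B` by regular variation and the exponent mass by the second-order
    -- condition, for `B` and for `t • B`; the exponent mass scales by its very formula.
    have l1 := tendsto_nhds_unique (hmrv.tendsto_ratio hBm hB1 hνf)
      (hsec.tendsto_ratio hBm ⟨η, pos_iff_ne_zero.2 hη0, hBη⟩ hBf)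
    have l2 := tendsto_nhds_unique (hmrv.tendsto_ratio htBm htB1 hνf')
      (hsec.tendsto_ratio htBm ⟨t * η, by positivity, htBη⟩ hBf')
    have l3 : ν.real (t • B) = ν.real B / t := by
      rw [l2, exponentMeasure_smul_of_isLeast ht0 hleast, ← l1]
    have e1 : ν.real B = ν.real C := by
      rw [measureReal_def, measureReal_def, hBdef, measure_null_union hS1]
    have e2 : ν.real (t • B) = ν.real (t • C) := by
      rw [measureReal_def, measureReal_def, hBdef, Set.smul_set_union, measure_null_union hS2]
    rw [← e1, ← e2, l3]
  -- let the neighbourhoods shrink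
  have hsη : (0 : ℝ) < s - η := by have : (η : ℝ) < s := h2; linarith
  have hex : ∀ n : ℕ, ∃ δ : ℝ, 0 < δ ∧ δ < (s - η) / (n + 1) ∧
      (ν + ν.map (fun x => t⁻¹ • x) + ν.map (fun x => (η⁻¹)⁻¹ • x)) {x | g x = δ} = 0 :=
    fun n => exists_null_level _ hgc.measurable (by positivity)
  choose δ hδ0 hδ1 hδn using hex
  have hδlim : Tendsto δ atTop (𝓝 0) := by
    refine squeeze_zero (fun n => (hδ0 n).le) (fun n => (hδ1 n).le) ?_
    have := (tendsto_one_div_add_atTop_nhds_zero_nat (𝕜 := ℝ)).const_mul ((s : ℝ) - η)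
    simpa [div_eq_mul_inv] using this
  have hkey : ∀ n, ν.real (t • {x | g x ≤ δ n}) = ν.real {x | g x ≤ δ n} / t := by
    intro n
    refine key (δ n) (hδ0 n) ((hδ1 n).trans_le ?_) (hδn n)
    exact div_le_self hsη.le (by have : (0 : ℝ) ≤ n := n.cast_nonneg; linarith)
  have hlim : ∀ κ : Measure (Orthant d), IsFiniteMeasure κ →
      Tendsto (fun n => κ.real {x | g x ≤ δ n}) atTop (𝓝 (κ.real F)) := by
    intro κ hκ
    have := (tendsto_measure_cthickening_of_isClosed (μ := κ)
      ⟨1, one_pos, measure_ne_top _ _⟩ hF).comp hδlim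
    have h2 := (ENNReal.tendsto_toReal (measure_ne_top κ F)).comp this
    refine h2.congr fun n => ?_
    simp only [Function.comp_apply, measureReal_def]
    congr 2
    ext x
    rw [Metric.mem_cthickening_iff,
      ENNReal.le_ofReal_iff_toReal_le (Metric.infEDist_ne_top hFne) (hδ0 n).le]
    rfl
  have L1 := (hlim ν inferInstance).div_const (t : ℝ)
  have L2 := hlim (ν.map fun x => t⁻¹ • x) inferInstance
  have hr : ∀ B, MeasurableSet B → (ν.map fun x => t⁻¹ • x).real B = ν.real (t • B) := by
    intro B hB
    rw [measureReal_def, hmap t ht0 B hB, measureReal_def]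
  rw [hr F hF.measurableSet] at L2
  refine tendsto_nhds_unique L2 (L1.congr fun n => ?_)
  rw [hr _ (measurableSet_le hgc.measurable measurable_const), hkey]

end KLExtremes

/-! ### Homogeneity on Borel sets; the exponent measure as a measure. -/

noncomputable section
namespace KLExtremes

variable {d : ℕ}

lemma map_inv_smul_apply (ν : Measure (Orthant d)) {c : ℝ≥0} (hc : c ≠ 0) {B : Set (Orthant d)}
    (hB : MeasurableSet B) : (ν.map fun x => c⁻¹ • x) B = ν (c • B) := by
  rw [Measure.map_apply (measurable_const_smul _) hB]
  congr 1
  ext x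
  exact (mem_smul_set_iff hc).symm

section Homogeneity

variable {μ ν : Measure (Orthant d)} {a : ℝ≥0 → ℝ}

/-- Both sides are finite measures on `{‖x‖_∞ > 1}`, so agreement on the π-system of closed sets
suffices. The trace of a closed set is exhausted by closed sets at positive distance from the unit
ball, where `real_smul_of_isClosed` applies. -/
lemma measure_smul_of_subset (hmrv : IsExceedanceDistribution μ ν)
    (hsec : SecondOrderCondition μ ν a) {t : ℝ≥0} (ht : 1 < t) {B : Set (Orthant d)}
    (hB : MeasurableSet B) (hB1 : B ⊆ {x | 1 < supNorm x}) : ν (t • B) = (t : ENNReal)⁻¹ * ν B := by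
  have := hmrv.prob
  have ht0 : t ≠ 0 := (zero_lt_one.trans ht).ne'
  set W : Set (Orthant d) := {x | 1 < supNorm x} with hW
  have hWm : MeasurableSet W := measurableSet_lt measurable_const measurable_supNorm
  set κ₁ : Measure (Orthant d) := (ν.map fun x => t⁻¹ • x).restrict W with hκ₁
  set κ₂ : Measure (Orthant d) := t⁻¹ • ν.restrict W with hκ₂
  have h1 : ∀ A, MeasurableSet A → κ₁ A = ν (t • (A ∩ W)) := fun A hA => by
    rw [hκ₁, Measure.restrict_apply hA, map_inv_smul_apply ν ht0 (hA.inter hWm)]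
  have h2 : ∀ A, MeasurableSet A → κ₂ A = (t : ENNReal)⁻¹ * ν (A ∩ W) := fun A hA => by
    rw [hκ₂, Measure.smul_apply, Measure.restrict_apply hA, ENNReal.smul_def, smul_eq_mul,
      ENNReal.coe_inv ht0]
  have hcl : ∀ F, IsClosed F → κ₁ F = κ₂ F := by
    intro F hF
    rw [h1 F hF.measurableSet, h2 F hF.measurableSet]
    set G : ℕ → Set (Orthant d) := fun n => F ∩ {x | 1 + 1 / ((n : ℝ≥0) + 1) ≤ supNorm x}
    have hGc : ∀ n, IsClosed (G n) := fun n =>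
      hF.inter (isClosed_le continuous_const continuous_supNorm)
    have hGm : Monotone G := by
      intro m n hmn x hx
      have h3 : 1 + 1 / ((n : ℝ≥0) + 1) ≤ 1 + 1 / ((m : ℝ≥0) + 1) := by gcongr
      exact ⟨hx.1, h3.trans hx.2⟩
    have hGU : ⋃ n, G n = F ∩ W := by
      ext x
      simp only [Set.mem_iUnion]
      constructor
      · rintro ⟨n, hx⟩
        have h3 : (1 : ℝ≥0) < 1 + 1 / ((n : ℝ≥0) + 1) := lt_add_of_pos_right 1 (by positivity)
        exact ⟨hx.1, h3.trans_le hx.2⟩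
      · rintro ⟨hxF, hx⟩
        obtain ⟨n, hn⟩ := exists_nat_one_div_lt (K := ℝ≥0) (tsub_pos_of_lt (show 1 < supNorm x from hx))
        refine ⟨n, hxF, ?_⟩
        have := add_le_add_right hn.le 1
        rwa [add_tsub_cancel_of_le (le_of_lt hx)] at this
    have hlim1 := tendsto_measure_iUnion_atTop (μ := ν) hGm
    have hlim2 := tendsto_measure_iUnion_atTop (μ := ν) (s := fun n => t • G n)
      fun m n hmn => Set.smul_set_mono (hGm hmn)
    rw [← Set.smul_set_iUnion, hGU] at hlim2
    rw [hGU] at hlim1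
    refine tendsto_nhds_unique hlim2 ((ENNReal.Tendsto.const_mul hlim1
      (Or.inr (by simp [ht0]))).congr fun n => ?_)
    have := real_smul_of_isClosed hmrv hsec ht (s := 1 + 1 / ((n : ℝ≥0) + 1))
      (lt_add_of_pos_right 1 (by positivity)) (hGc n) (fun x hx => hx.2)
    simp only [Function.comp_apply]
    rw [← ENNReal.toReal_eq_toReal_iff' (by finiteness) (by finiteness), ENNReal.toReal_mul]
    simp only [measureReal_def] at this
    rw [this]
    simp [div_eq_inv_mul]
  have heq : κ₁ = κ₂ := by
    refine ext_of_generate_finite _ ?_ isPiSystem_isClosed (fun F hF => hcl F hF)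
      (hcl _ isClosed_univ)
    rw [← borel_eq_generateFrom_isClosed]
    exact BorelSpace.measurable_eq
  have := congrArg (fun κ : Measure (Orthant d) => κ B) heq
  rwa [h1 B hB, h2 B hB, Set.inter_eq_self_of_subset_left hB1] at this

lemma real_setOf_lt_supNorm (hmrv : IsExceedanceDistribution μ ν)
    (hsec : SecondOrderCondition μ ν a) {t : ℝ≥0} (ht : 1 < t) :
    ν.real {x | t < supNorm x} = (t : ℝ)⁻¹ := by
  have := hmrv.prob
  have h := measure_smul_of_subset hmrv hsec ht
    (measurableSet_lt measurable_const measurable_supNorm) subset_rfl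
  rw [smul_setOf_lt_supNorm (zero_lt_one.trans ht).ne', mul_one] at h
  have h1 : ν {x | 1 < supNorm x} = 1 := by
    have h2 := prob_compl_eq_one_iff (μ := ν)
      (measurableSet_le (measurable_supNorm (d := d)) measurable_const) |>.2 hmrv.carrier
    convert h2 using 2
    ext x; simp
  rw [measureReal_def, h, h1]
  simp

/-- For `t > 1` the sphere lies in every shell `s < ‖x‖_∞ ≤ t` with `1 < s < t`, of mass `1/s -
1/t`. -/
lemma measure_setOf_supNorm_eq (hmrv : IsExceedanceDistribution μ ν)
    (hsec : SecondOrderCondition μ ν a) (t : ℝ≥0) : ν {x | supNorm x = t} = 0 := by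
  have := hmrv.prob
  rcases le_or_gt t 1 with ht | ht
  · exact measure_mono_null (fun x hx => (le_of_eq hx).trans ht) hmrv.carrier
  rw [← measureReal_eq_zero_iff]
  refine le_antisymm ?_ measureReal_nonneg
  have hle : ∀ s : ℝ≥0, 1 < s → s < t →
      ν.real {x | supNorm x = t} ≤ (s : ℝ)⁻¹ - (t : ℝ)⁻¹ := by
    intro s hs hst
    rw [← real_setOf_lt_supNorm hmrv hsec hs, ← real_setOf_lt_supNorm hmrv hsec ht,
      le_sub_iff_add_le, ← measureReal_union]
    · refine measureReal_mono ?_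
      rintro x (hx | hx)
      · exact hst.trans_eq (Eq.symm hx)
      · exact hst.trans hx
    · exact Set.disjoint_left.2 fun x hx hx' => (ne_of_gt hx') hx
    · exact measurableSet_lt measurable_const measurable_supNorm
  have hlim : Tendsto (fun s : ℝ≥0 => (s : ℝ)⁻¹ - (t : ℝ)⁻¹) (𝓝[<] t) (𝓝 0) := by
    have h0 : (t : ℝ) ≠ 0 := by have := zero_lt_one.trans ht; positivity
    have : Tendsto (fun s : ℝ≥0 => (s : ℝ)⁻¹ - (t : ℝ)⁻¹) (𝓝 t) (𝓝 ((t : ℝ)⁻¹ - (t : ℝ)⁻¹)) :=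
      ((NNReal.continuous_coe.tendsto t).inv₀ h0).sub_const _
    rw [sub_self] at this
    exact this.mono_left nhdsWithin_le_nhds
  have : (𝓝[<] t).NeBot := nhdsLT_neBot_of_exists_lt ⟨1, ht⟩
  refine ge_of_tendsto hlim ?_
  filter_upwards [Ioo_mem_nhdsLT ht] with s hs using hle s hs.1 hs.2

lemma real_smul_of_one_le (hmrv : IsExceedanceDistribution μ ν)
    (hsec : SecondOrderCondition μ ν a) {t : ℝ≥0} (ht : 1 ≤ t) {B : Set (Orthant d)}
    (hB : MeasurableSet B) (hB1 : B ⊆ {x | 1 ≤ supNorm x}) : ν.real (t • B) = ν.real B / t := by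
  rcases ht.eq_or_lt with rfl | ht
  · simp
  have ht0 : t ≠ 0 := (zero_lt_one.trans ht).ne'
  set S : Set (Orthant d) := {x | supNorm x = 1}
  set W : Set (Orthant d) := {x | 1 < supNorm x}
  have hWm : MeasurableSet W := measurableSet_lt measurable_const measurable_supNorm
  have hsplit : B = (B ∩ S) ∪ (B ∩ W) := by
    rw [← Set.inter_union_distrib_left, eq_comm, Set.inter_eq_left]
    intro x hx
    exact (hB1 hx).eq_or_lt.imp Eq.symm id
  have h1 : ν (B ∩ S) = 0 :=
    measure_mono_null Set.inter_subset_right (measure_setOf_supNorm_eq hmrv hsec 1)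
  have h2 : ν (t • (B ∩ S)) = 0 := by
    refine measure_mono_null (Set.smul_set_mono Set.inter_subset_right) ?_
    rw [smul_setOf_supNorm_eq ht0]
    exact measure_setOf_supNorm_eq hmrv hsec _
  have h3 := measure_smul_of_subset hmrv hsec ht (hB.inter hWm) Set.inter_subset_right
  rw [measureReal_def, measureReal_def, hsplit, Set.smul_set_union, measure_null_union h1,
    measure_null_union h2, h3, ENNReal.toReal_mul]
  simp [div_eq_inv_mul]

end Homogeneity

/-- The restriction of the exponent measure to `{c < ‖x‖_∞}`, as a finite measure. -/
def tailMeasure (ν : Measure (Orthant d)) (c : ℝ≥0) : Measure (Orthant d) :=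
  c⁻¹ • ν.map fun x => c • x

lemma tailMeasure_real_apply (ν : Measure (Orthant d)) {c : ℝ≥0} (hc : c ≠ 0)
    {B : Set (Orthant d)} (hB : MeasurableSet B) :
    (tailMeasure ν c).real B = ν.real (c⁻¹ • B) / c := by
  have := map_inv_smul_apply ν (inv_ne_zero hc) hB
  rw [inv_inv] at this
  rw [measureReal_def, tailMeasure, Measure.smul_apply, this, ENNReal.smul_def, smul_eq_mul,
    ENNReal.toReal_mul, ENNReal.coe_toReal, NNReal.coe_inv, ← measureReal_def, div_eq_inv_mul]

instance (ν : Measure (Orthant d)) [IsFiniteMeasure ν] (c : ℝ≥0) :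
    IsFiniteMeasure (tailMeasure ν c) := by
  unfold tailMeasure; infer_instance

lemma exponentMeasure_empty (ν : Measure (Orthant d)) :
    exponentMeasure ν (∅ : Set (Orthant d)) = 0 := by
  simp [exponentMeasure]

/-- Purely formal: the infimum `m` scales with `B`, so `B / m` is unchanged and only the factor `1 /
m` moves. -/
lemma exponentMeasure_smul (ν : Measure (Orthant d)) {t : ℝ≥0} (ht : t ≠ 0)
    (B : Set (Orthant d)) : exponentMeasure ν (t • B) = exponentMeasure ν B / t := by
  rcases B.eq_empty_or_nonempty with rfl | hB
  · simp [exponentMeasure_empty]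
  have h1 : supNorm '' (t • B) = (OrderIso.mulLeft₀ t (pos_iff_ne_zero.2 ht)) '' (supNorm '' B) := by
    ext y
    simp [Set.mem_smul_set, supNorm_smul]
  have h2 : sInf (supNorm '' (t • B)) = t * sInf (supNorm '' B) := by
    rw [h1, ← OrderIso.map_csInf' _ (hB.image _) (OrderBot.bddBelow _)]
    rfl
  rw [exponentMeasure, exponentMeasure, h2, mul_inv, mul_comm t⁻¹, mul_smul, smul_smul t⁻¹,
    inv_mul_cancel₀ ht, one_smul, NNReal.coe_mul, mul_comm, div_div]

section Homogeneity

variable {μ ν : Measure (Orthant d)} {a : ℝ≥0 → ℝ}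

/-- Homogeneity lets the set-dependent radius `m ≥ c` be replaced by the fixed `c`. The set function
thereby becomes additive, which its defining formula does not show. -/
lemma exponentMeasure_eq_tailMeasure (hmrv : IsExceedanceDistribution μ ν)
    (hsec : SecondOrderCondition μ ν a) {c : ℝ≥0} (hc : 0 < c) {B : Set (Orthant d)}
    (hB : MeasurableSet B) (hBc : B ⊆ {x | c ≤ supNorm x}) :
    exponentMeasure ν B = (tailMeasure ν c).real B := by
  rcases B.eq_empty_or_nonempty with rfl | hne
  · simp [exponentMeasure_empty]
  set m := sInf (supNorm '' B) with hm
  have hcm : c ≤ m := le_csInf (hne.image _) (by rintro _ ⟨x, hx, rfl⟩; exact hBc hx)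
  have hm0 : m ≠ 0 := (hc.trans_le hcm).ne'
  have hle : ∀ x ∈ B, m ≤ supNorm x := fun x hx => csInf_le (OrderBot.bddBelow _) ⟨x, hx, rfl⟩
  have h1 : m⁻¹ • B ⊆ {x | 1 ≤ supNorm x} := by
    rintro _ ⟨x, hx, rfl⟩
    simp only [Set.mem_ofPred_eq, supNorm_smul]
    rw [le_inv_mul_iff₀ (pos_iff_ne_zero.2 hm0), mul_one]
    exact hle x hx
  have h2 := real_smul_of_one_le hmrv hsec (t := c⁻¹ * m)
    (by rwa [le_inv_mul_iff₀ hc, mul_one]) (measurableSet_smul hB (inv_ne_zero hm0)) h1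
  rw [smul_smul, mul_assoc, mul_inv_cancel₀ hm0, mul_one] at h2
  rw [exponentMeasure, ← hm, tailMeasure_real_apply ν hc.ne' hB, h2]
  have : (c : ℝ) ≠ 0 := by positivity
  have : (m : ℝ) ≠ 0 := by positivity
  push_cast
  field_simp

lemma tailMeasure_real_smul (hmrv : IsExceedanceDistribution μ ν)
    (hsec : SecondOrderCondition μ ν a) {c t : ℝ≥0} (hc : 0 < c) (ht : t ≠ 0)
    {B : Set (Orthant d)} (hB : MeasurableSet B) (hBc : B ⊆ {x | c ≤ supNorm x})
    (htBc : t • B ⊆ {x | c ≤ supNorm x}) :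
    (tailMeasure ν c).real (t • B) = (tailMeasure ν c).real B / t := by
  rw [← exponentMeasure_eq_tailMeasure hmrv hsec hc (measurableSet_smul hB ht) htBc,
    ← exponentMeasure_eq_tailMeasure hmrv hsec hc hB hBc, exponentMeasure_smul ν ht]

end Homogeneity

end KLExtremes
end

/-! ### Maximal inequality along an increasing sequence of sets. -/

noncomputable section
namespace KLExtremes

section PiSystem

variable {Ω E : Type*} [MeasurableSpace Ω] {σ : MeasurableSpace E} [mE : MeasurableSpace E]
  {P : Measure Ω} {X : ℕ → Ω → E} {μ : Measure E}

/-- The events are generated by finite intersections of `{X_l ∈ H_l}` with `H_l` in `σ`. The factors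
with `l ≠ i` are independent of `X_i`, so the integral factors through `∫_{H_i} ψ dμ = 0`. This
passes a one-point martingale identity to the whole sample. -/
lemma setIntegral_comp_eq_zero (hX : ∀ i, Measurable (X i)) (hlaw : ∀ i, P.map (X i) = μ)
    (hind : iIndepFun X P) (hσ : σ ≤ mE) {ψ : E → ℝ}
    (hψm : Measurable ψ) (hψi : Integrable ψ μ)
    (hψ : ∀ H, MeasurableSet[σ] H → ∫ x in H, ψ x ∂μ = 0) (i : ℕ) {G : Set Ω}
    (hG : MeasurableSet[⨆ l, σ.comap (X l)] G) : ∫ ω in G, ψ (X i ω) ∂P = 0 := by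
  have hle : (⨆ l, σ.comap (X l)) ≤ (inferInstance : MeasurableSpace Ω) :=
    iSup_le fun l => (MeasurableSpace.comap_mono hσ).trans (hX l).comap_le
  have hψX : Integrable (fun ω => ψ (X i ω)) P := by
    rw [← hlaw i] at hψi
    exact hψi.comp_measurable (hX i)
  have htot : ∫ ω, ψ (X i ω) ∂P = 0 := by
    rw [← integral_map (hX i).aemeasurable hψm.aestronglyMeasurable, hlaw i, ← setIntegral_univ]
    exact hψ _ MeasurableSet.univ
  have heq : (⨆ l, σ.comap (X l)) = MeasurableSpace.generateFrom
      (piiUnionInter (fun l => {s | MeasurableSet[σ.comap (X l)] s}) Set.univ) := by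
    rw [generateFrom_piiUnionInter_measurableSet (fun l => σ.comap (X l))]; simp
  induction G, hG using MeasurableSpace.induction_on_inter heq
    (isPiSystem_piiUnionInter _
      (fun l => @MeasurableSpace.isPiSystem_measurableSet _ (σ.comap (X l))) _) with
  | empty => simp
  | basic G hG =>
    obtain ⟨T, -, f, hf, rfl⟩ := hG
    have hchoose : ∃ H, MeasurableSet[σ] H ∧
        ⋂ l ∈ T, f l = (⋂ l ∈ T.erase i, f l) ∩ X i ⁻¹' H := by
      by_cases hi : i ∈ T
      · obtain ⟨H, hH, hHf⟩ := hf i hi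
        refine ⟨H, hH, ?_⟩
        rw [hHf]
        conv_lhs => rw [← Finset.insert_erase hi, Finset.set_biInter_insert, Set.inter_comm]
      · exact ⟨Set.univ, MeasurableSet.univ, by simp [Finset.erase_eq_of_notMem hi]⟩
    obtain ⟨H, hH, hEq⟩ := hchoose
    set G' := ⋂ l ∈ T.erase i, f l with hG'
    have hG'm : MeasurableSet[⨆ l ∈ ({i}ᶜ : Set ℕ), mE.comap (X l)] G' := by
      refine Finset.measurableSet_biInter _ fun l hl => ?_
      have h1 : MeasurableSet[mE.comap (X l)] (f l) :=
        MeasurableSpace.comap_mono hσ _ (hf l (Finset.mem_of_mem_erase hl))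
      exact (le_iSup₂_of_le (f := fun l (_ : l ∈ ({i}ᶜ : Set ℕ)) => mE.comap (X l)) l
        (Finset.ne_of_mem_erase hl) le_rfl) _ h1
    have hindep : Indep (⨆ l ∈ ({i}ᶜ : Set ℕ), mE.comap (X l)) (mE.comap (X i)) P := by
      have := indep_iSup_of_disjoint (fun l => (hX l).comap_le) hind
        (S := {i}ᶜ) (T := {i}) disjoint_compl_left
      simpa using this
    have hG'm' : MeasurableSet G' :=
      iSup₂_le (fun l _ => (hX l).comap_le) _ hG'm
    have hfin := hindep.setIntegral_eq_smul (f := H.indicator ψ)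
      (iSup₂_le fun l _ => (hX l).comap_le) (hX i).aemeasurable hG'm
      (hψm.indicator (hσ _ hH)).aestronglyMeasurable
    have hz : ∫ ω, H.indicator ψ (X i ω) ∂P = 0 := by
      rw [← integral_map (hX i).aemeasurable (hψm.indicator (hσ _ hH)).aestronglyMeasurable,
        hlaw i, integral_indicator (hσ _ hH)]
      exact hψ H hH
    rw [hEq, ← setIntegral_indicator ((hX i) (hσ _ hH))]
    rw [hz, smul_zero] at hfin
    rw [← hfin]
    rfl
  | compl G hG ih =>
    rw [setIntegral_compl (hle _ hG) hψX, htot, ih, sub_zero]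
  | iUnion f hd hf ih =>
    rw [integral_iUnion (fun l => hle _ (hf l)) hd hψX.integrableOn]
    simp [ih]

end PiSystem

section MaximalInequality

/-- Centred number of the first `n` sample points in `B`. -/
def centredCount {Ω E : Type*} [MeasurableSpace E] (μ : Measure E) (X : ℕ → Ω → E) (n : ℕ)
    (B : Set E) (ω : Ω) : ℝ :=
  ∑ i ∈ Finset.range n, (B.indicator 1 (X i ω) - μ.real B)

variable {Ω E : Type*} [MeasurableSpace Ω] [mE : MeasurableSpace E] {P : Measure Ω}
  {X : ℕ → Ω → E} {μ : Measure E}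

lemma measurable_indicator_comp (hX : ∀ i, Measurable (X i)) {B : Set E} (hB : MeasurableSet B)
    (i : ℕ) : Measurable fun ω => B.indicator (1 : E → ℝ) (X i ω) :=
  (measurable_one.indicator hB).comp (hX i)

lemma measurable_centredCount (hX : ∀ i, Measurable (X i)) {B : Set E} (hB : MeasurableSet B)
    (n : ℕ) : Measurable (centredCount μ X n B) :=
  Finset.measurable_fun_sum _ fun i _ => (measurable_indicator_comp hX hB i).sub_const _

lemma integral_indicator_comp (hX : ∀ i, Measurable (X i)) (hlaw : ∀ i, P.map (X i) = μ)
    {B : Set E} (hB : MeasurableSet B) (i : ℕ) :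
    ∫ ω, B.indicator (1 : E → ℝ) (X i ω) ∂P = μ.real B := by
  rw [← integral_map (hX i).aemeasurable (f := B.indicator (1 : E → ℝ))
    (measurable_one.indicator hB).aestronglyMeasurable, hlaw i, integral_indicator_one hB]

variable [IsProbabilityMeasure P]

lemma memLp_centred_indicator (hX : ∀ i, Measurable (X i)) {B : Set E} (hB : MeasurableSet B)
    (i : ℕ) : MemLp (fun ω => B.indicator (1 : E → ℝ) (X i ω)) 2 P := by
  refine MemLp.of_bound (measurable_indicator_comp hX hB i).aestronglyMeasurable 1
    (ae_of_all _ fun ω => ?_)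
  by_cases h : X i ω ∈ B <;> simp [h]

lemma memLp_centredCount (hX : ∀ i, Measurable (X i)) {B : Set E} (hB : MeasurableSet B) (n : ℕ) :
    MemLp (centredCount μ X n B) 2 P :=
  memLp_finsetSum _ fun i _ => (memLp_centred_indicator hX hB i).sub (memLp_const _)

/-- The second moment is the binomial variance `n p (1 - p)`, at most `n p`. -/
lemma integral_centredCount_sq_le (hX : ∀ i, Measurable (X i)) (hlaw : ∀ i, P.map (X i) = μ)
    (hind : iIndepFun X P) {B : Set E} (hB : MeasurableSet B) (n : ℕ) :
    ∫ ω, centredCount μ X n B ω ^ 2 ∂P ≤ n * μ.real B := by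
  set Y : ℕ → Ω → ℝ := fun i ω => B.indicator 1 (X i ω) - μ.real B with hY
  have hL : ∀ i, MemLp (Y i) 2 P := fun i =>
    (memLp_centred_indicator hX hB i).sub (memLp_const _)
  have hmean : ∀ i, ∫ ω, Y i ω ∂P = 0 := fun i => by
    simp only [hY]
    rw [integral_sub ((memLp_centred_indicator hX hB i).integrable one_le_two)
      (integrable_const _), integral_indicator_comp hX hlaw hB]
    simp
  have hYind : Set.Pairwise (Finset.range n : Set ℕ) fun i j => Y i ⟂ᵢ[P] Y j := by
    intro i _ j _ hij
    exact (hind.indepFun hij).comp (φ := fun x => B.indicator 1 x - μ.real B)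
      (ψ := fun x => B.indicator 1 x - μ.real B)
      ((measurable_one.indicator hB).sub_const _) ((measurable_one.indicator hB).sub_const _)
  have hsum : centredCount μ X n B = ∑ i ∈ Finset.range n, Y i := by
    ext ω; simp [centredCount, hY]
  have hvar : ∀ i, variance (Y i) P ≤ μ.real B := by
    intro i
    rw [variance_of_integral_eq_zero (hL i).aemeasurable (hmean i)]
    have h1 : ∀ ω, Y i ω ^ 2 = (1 - 2 * μ.real B) * B.indicator 1 (X i ω) + μ.real B ^ 2 := by
      intro ω
      simp only [hY]
      by_cases h : X i ω ∈ B <;> simp [h]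
      ring
    simp_rw [h1]
    rw [integral_add (((memLp_centred_indicator hX hB i).integrable one_le_two).const_mul _)
      (integrable_const _), integral_const_mul, integral_indicator_comp hX hlaw hB]
    simp only [integral_const, probReal_univ, smul_eq_mul, one_mul]
    nlinarith [sq_nonneg (μ.real B)]
  have h0 : ∫ ω, centredCount μ X n B ω ∂P = 0 := by
    rw [hsum]
    simp only [Finset.sum_apply]
    rw [integral_finsetSum _ fun i _ => (hL i).integrable one_le_two]
    simp [hmean]
  calc ∫ ω, centredCount μ X n B ω ^ 2 ∂P = variance (centredCount μ X n B) P :=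
        (variance_of_integral_eq_zero (memLp_centredCount hX hB n).aemeasurable h0).symm
    _ = ∑ i ∈ Finset.range n, variance (Y i) P := by
        rw [hsum, IndepFun.variance_sum (fun i _ => hL i) hYind]
    _ ≤ ∑ i ∈ Finset.range n, μ.real B := Finset.sum_le_sum fun i _ => hvar i
    _ = n * μ.real B := by simp

lemma integral_abs_centredCount_le (hX : ∀ i, Measurable (X i)) (hlaw : ∀ i, P.map (X i) = μ)
    (hind : iIndepFun X P) {B : Set E} (hB : MeasurableSet B) (n : ℕ) :
    ∫ ω, |centredCount μ X n B ω| ∂P ≤ √(n * μ.real B) := by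
  have hL := memLp_centredCount (P := P) (μ := μ) hX hB n
  have h1 := variance_nonneg (fun ω => |centredCount μ X n B ω|) P
  have hLa : MemLp (fun ω => |centredCount μ X n B ω|) 2 P := hL.abs
  rw [variance_eq_sub hLa] at h1
  refine Real.le_sqrt_of_sq_le ?_
  have h2 := integral_centredCount_sq_le hX hlaw hind hB n
  simp only [Pi.pow_apply, sq_abs] at h1
  linarith

/-- The σ-algebra of the measurable sets that contain the complement of `C` or are disjoint
from it. -/
@[reducible] def atomSpace (C : Set E) : MeasurableSpace E where
  MeasurableSet' H := MeasurableSet H ∧ (Cᶜ ⊆ H ∨ H ⊆ C)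
  measurableSet_empty := ⟨MeasurableSet.empty, Or.inr (Set.empty_subset _)⟩
  measurableSet_compl H hH := ⟨hH.1.compl, hH.2.symm.imp Set.compl_subset_compl.2
    fun h => Set.compl_subset_comm.1 h⟩
  measurableSet_iUnion f hf := by
    refine ⟨MeasurableSet.iUnion fun i => (hf i).1, ?_⟩
    by_cases h : ∃ i, Cᶜ ⊆ f i
    · obtain ⟨i, hi⟩ := h
      exact Or.inl (hi.trans (Set.subset_iUnion f i))
    · push Not at h
      exact Or.inr (Set.iUnion_subset fun i => (hf i).2.resolve_left (h i))

lemma atomSpace_le (C : Set E) : atomSpace C ≤ mE := fun _ hH => hH.1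

lemma atomSpace_mono {C D : Set E} (h : C ⊆ D) : atomSpace C ≤ atomSpace D := fun _ hH =>
  ⟨hH.1, hH.2.imp (Set.compl_subset_compl.2 h).trans fun h' => h'.trans h⟩

variable [IsProbabilityMeasure μ]

/-- Both normalised indicators equal `1` on `C`, so the difference vanishes there, and its total
integral is zero. Hence the integral vanishes over any `H ⊆ C` and over any `H` whose complement
lies in `C`. -/
lemma setIntegral_normalized_indicator {C D : Set E} (hC : MeasurableSet C) (hD : MeasurableSet D)
    (hCD : C ⊆ D) (hD1 : μ.real D < 1) {H : Set E} (hH : MeasurableSet[atomSpace C] H) :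
    ∫ x in H, ((D.indicator 1 x - μ.real D) / (1 - μ.real D) -
      (C.indicator 1 x - μ.real C) / (1 - μ.real C)) ∂μ = 0 := by
  have hC1 : μ.real C < 1 := (measureReal_mono hCD).trans_lt hD1
  set ψ : E → ℝ := fun x => (D.indicator 1 x - μ.real D) / (1 - μ.real D) -
      (C.indicator 1 x - μ.real C) / (1 - μ.real C) with hψ
  have hint : ∀ A : Set E, MeasurableSet A →
      Integrable (fun x => (A.indicator (1 : E → ℝ) x - μ.real A) / (1 - μ.real A)) μ :=
    fun A hA => (((integrable_const (1 : ℝ)).indicator hA).sub (integrable_const _)).div_const _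
  have hψi : Integrable ψ μ := (hint D hD).sub (hint C hC)
  have htot : ∫ x, ψ x ∂μ = 0 := by
    have h1 : ∀ A : Set E, MeasurableSet A →
        ∫ x, (A.indicator (1 : E → ℝ) x - μ.real A) / (1 - μ.real A) ∂μ = 0 := by
      intro A hA
      have h2 : Integrable (A.indicator (1 : E → ℝ)) μ := (integrable_const (1 : ℝ)).indicator hA
      rw [integral_div, integral_sub h2 (integrable_const _), integral_indicator_one hA]
      simp
    rw [integral_sub (hint D hD) (hint C hC), h1 D hD, h1 C hC, sub_zero]
  have hzero : ∀ A : Set E, MeasurableSet A → A ⊆ C → ∫ x in A, ψ x ∂μ = 0 := by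
    intro A hA hAC
    rw [setIntegral_congr_fun hA (g := fun _ => (0 : ℝ)), integral_zero]
    intro x hx
    have h1 : (1 : ℝ) - μ.real D ≠ 0 := by linarith
    have h2 : (1 : ℝ) - μ.real C ≠ 0 := by linarith
    simp [hψ, hAC hx, hCD (hAC hx), h1, h2]
  rcases hH.2 with h | h
  · have h1 := setIntegral_compl hH.1 hψi
    rw [hzero _ hH.1.compl (Set.compl_subset_comm.1 h), htot] at h1
    linarith
  · exact hzero H hH.1 h

/-- Maximal inequality for the empirical process of an increasing sequence of sets. -/
theorem maximal_inequality_of_monotone (hX : ∀ i, Measurable (X i)) (hlaw : ∀ i, P.map (X i) = μ)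
    (hind : iIndepFun X P) {C : ℕ → Set E} (hC : ∀ j, MeasurableSet (C j)) (hmono : Monotone C)
    (hhalf : ∀ j, μ.real (C j) ≤ 1 / 2) (n N : ℕ) {l : ℝ} (hl : 0 < l) :
    P {ω | ∃ j ≤ N, l ≤ |centredCount μ X n (C j) ω|} ≤
      ENNReal.ofReal (2 * √(n * μ.real (C N)) / l) := by
  -- At time `j` the positions of the points inside `C j` are known; the others are only known to
  -- lie outside. Dividing the centred count by `1 - μ(C j)` turns it into a martingale.
  let F : Filtration ℕ (inferInstance : MeasurableSpace Ω) :=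
    { seq := fun j => ⨆ i, (atomSpace (C j)).comap (X i)
      mono' := fun j j' h => iSup_mono fun i =>
        MeasurableSpace.comap_mono (atomSpace_mono (hmono h))
      le' := fun j => iSup_le fun i =>
        (MeasurableSpace.comap_mono (atomSpace_le _)).trans (hX i).comap_le }
  set M : ℕ → Ω → ℝ := fun j ω => centredCount μ X n (C j) ω / (1 - μ.real (C j)) with hM
  have hMint : ∀ j, Integrable (M j) P := fun j =>
    ((memLp_centredCount hX (hC j) n).integrable one_le_two).div_const _
  have hMsum : ∀ j ω, M j ω = ∑ i ∈ Finset.range n,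
      ((C j).indicator 1 (X i ω) - μ.real (C j)) / (1 - μ.real (C j)) := by
    intro j ω
    simp only [hM, centredCount, Finset.sum_div]
  have hadp : StronglyAdapted F M := by
    intro j
    refine Measurable.stronglyMeasurable ?_
    refine Measurable.div_const ?_ _
    refine Finset.measurable_fun_sum _ fun i _ => Measurable.sub_const ?_ _
    have h1 : Measurable[atomSpace (C j)] ((C j).indicator (1 : E → ℝ)) :=
      @Measurable.indicator _ _ (C j) 1 (atomSpace (C j)) _ _
        (@measurable_one _ _ _ (atomSpace (C j)) _) ⟨hC j, Or.inr subset_rfl⟩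
    have h2 : Measurable[⨆ i, (atomSpace (C j)).comap (X i), atomSpace (C j)] (X i) :=
      measurable_iff_comap_le.2 (le_iSup (fun i => (atomSpace (C j)).comap (X i)) i)
    exact h1.comp h2
  have hmart : Martingale M F P := by
    refine martingale_of_setIntegral_eq_succ hadp hMint fun j s hs => ?_
    have hs' : MeasurableSet s := F.le j _ hs
    rw [eq_comm, ← sub_eq_zero, ← integral_sub (hMint _).integrableOn (hMint _).integrableOn]
    set ψ : E → ℝ := fun x =>
      ((C (j + 1)).indicator 1 x - μ.real (C (j + 1))) / (1 - μ.real (C (j + 1))) -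
        ((C j).indicator 1 x - μ.real (C j)) / (1 - μ.real (C j)) with hψ
    have hψm : Measurable ψ :=
      (((measurable_one.indicator (hC _)).sub_const _).div_const _).sub
        (((measurable_one.indicator (hC _)).sub_const _).div_const _)
    have hψi : Integrable ψ μ :=
      ((((integrable_const (1 : ℝ)).indicator (hC _)).sub (integrable_const _)).div_const _).sub
        ((((integrable_const (1 : ℝ)).indicator (hC _)).sub (integrable_const _)).div_const _)
    have hz : ∀ i, ∫ ω in s, ψ (X i ω) ∂P = 0 := fun i =>
      setIntegral_comp_eq_zero (σ := atomSpace (C j)) hX hlaw hind (atomSpace_le (C j)) hψm hψi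
        (fun H hH => setIntegral_normalized_indicator (hC j) (hC _) (hmono (Nat.le_succ j))
          (by linarith [hhalf (j + 1)]) hH) i hs
    have hexp : ∀ ω, M (j + 1) ω - M j ω = ∑ i ∈ Finset.range n, ψ (X i ω) := by
      intro ω
      rw [hMsum, hMsum, ← Finset.sum_sub_distrib]
    simp_rw [hexp]
    rw [integral_finsetSum]
    · simp [hz]
    · intro i _
      have : Integrable (fun ω => ψ (X i ω)) P := by
        rw [← hlaw i] at hψi
        exact hψi.comp_measurable (hX i)
      exact this.integrableOn
  have hsub : Submartingale (fun j ω => |M j ω|) F P :=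
    hmart.submartingale.sup hmart.neg.submartingale
  lift l to ℝ≥0 using hl.le
  have hl0 : 0 < l := by exact_mod_cast hl
  have hmax := maximal_ineq hsub (fun j ω => abs_nonneg _) (ε := l) N
  have hsubset : {ω | ∃ j ≤ N, (l : ℝ) ≤ |centredCount μ X n (C j) ω|} ⊆
      {ω | (l : ℝ) ≤ (Finset.range (N + 1)).sup' Finset.nonempty_range_add_one
        fun k => |M k ω|} := by
    rintro ω ⟨j, hj, hlj⟩
    refine (Finset.le_sup'_iff _).2 ⟨j, Finset.mem_range.2 (by omega), hlj.trans ?_⟩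
    have h1 := hhalf j
    have h2 : 0 ≤ μ.real (C j) := measureReal_nonneg
    simp only [hM]
    rw [abs_div, abs_of_pos (by linarith : 0 < 1 - μ.real (C j))]
    exact le_div_self (abs_nonneg _) (by linarith) (by linarith)
  have hI : ∫ ω, |M N ω| ∂P ≤ 2 * √(n * μ.real (C N)) := by
    have h1 := hhalf N
    have h2 := integral_abs_centredCount_le hX hlaw hind (hC N) n
    -- The normaliser lies in `[1/2, 1]`: it can only enlarge the process, and at the final time by
    -- at most the factor `2`.
    have h3 : ∀ ω, |M N ω| ≤ 2 * |centredCount μ X n (C N) ω| := by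
      intro ω
      simp only [hM]
      rw [abs_div, abs_of_pos (by linarith : 0 < 1 - μ.real (C N)),
        div_le_iff₀ (by linarith)]
      nlinarith [abs_nonneg (centredCount μ X n (C N) ω)]
    calc ∫ ω, |M N ω| ∂P ≤ ∫ ω, 2 * |centredCount μ X n (C N) ω| ∂P :=
          integral_mono (hMint N).abs
            (((memLp_centredCount hX (hC N) n).integrable one_le_two).abs.const_mul _) h3
      _ ≤ 2 * √(n * μ.real (C N)) := by rw [integral_const_mul]; linarith
  have hfin : (l : ENNReal) * P {ω | ∃ j ≤ N, (l : ℝ) ≤ |centredCount μ X n (C j) ω|} ≤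
      ENNReal.ofReal (2 * √(n * μ.real (C N))) := by
    refine le_trans (by gcongr) (hmax.trans (ENNReal.ofReal_le_ofReal (le_trans ?_ hI)))
    exact setIntegral_le_integral (hMint N).abs (ae_of_all _ fun ω => abs_nonneg _)
  rw [ENNReal.ofReal_div_of_pos hl, ENNReal.le_div_iff_mul_le (Or.inl (by simpa using hl0.ne'))
    (Or.inl (by simp)), mul_comm]
  simpa using hfin

end MaximalInequality

end KLExtremes
end

/-! ### Maximal inequality for a decreasing family with a continuous index. -/

noncomputable section
namespace KLExtremes

/-- Listing finitely many indices downwards, each new maximum going in front, turns a decreasing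
family of sets into the increasing sequence that Doob's inequality needs. -/
lemma exists_antitone_seq {ι : Type*} [LinearOrder ι] (T : Finset ι) (hT : T.Nonempty) :
    ∃ s : ℕ → ι, Antitone s ∧ (∀ j, s j ∈ T) ∧ ∃ N, ∀ t ∈ T, ∃ j ≤ N, s j = t := by
  induction T using Finset.induction_on_max with
  | empty => simp at hT
  | insert a T hlt ih =>
    rcases T.eq_empty_or_nonempty with rfl | hne
    · exact ⟨fun _ => a, fun _ _ _ => le_rfl, by simp, 0, by simp⟩
    · obtain ⟨s, hs, hsT, N, hN⟩ := ih hne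
      refine ⟨fun j => Nat.casesOn j a s, ?_, ?_, N + 1, ?_⟩
      · refine antitone_nat_of_succ_le fun j => ?_
        cases j with
        | zero => exact (hlt _ (hsT 0)).le
        | succ j => exact hs (Nat.le_succ j)
      · intro j
        cases j with
        | zero => exact Finset.mem_insert_self _ _
        | succ j => exact Finset.mem_insert_of_mem (hsT j)
      · intro t ht
        rcases Finset.mem_insert.1 ht with rfl | ht
        · exact ⟨0, by omega, rfl⟩
        · obtain ⟨j, hj, rfl⟩ := hN t ht
          exact ⟨j + 1, by omega, rfl⟩

section Count

variable {Ω E : Type*} {X : ℕ → Ω → E}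

/-- Number of the first `n` sample points in `B`. -/
def sampleCount (X : ℕ → Ω → E) (n : ℕ) (B : Set E) (ω : Ω) : ℝ :=
  ∑ i ∈ Finset.range n, B.indicator 1 (X i ω)

lemma centredCount_eq [MeasurableSpace E] {μ : Measure E} (n : ℕ) (B : Set E) (ω : Ω) :
    centredCount μ X n B ω = sampleCount X n B ω - n * μ.real B := by
  simp [centredCount, sampleCount]

lemma sampleCount_mono {n : ℕ} {A B : Set E} (h : A ⊆ B) (ω : Ω) : sampleCount X n A ω ≤ sampleCount X n B ω :=
  Finset.sum_le_sum fun i _ => Set.indicator_le_indicator_of_subset h (by simp) _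

end Count

section MaximalInequality

variable {Ω E : Type*} [MeasurableSpace Ω] [mE : MeasurableSpace E] {P : Measure Ω}
  {X : ℕ → Ω → E} {μ : Measure E}

variable [IsProbabilityMeasure P] [IsProbabilityMeasure μ] {C : ℝ≥0 → Set E} {D : Set E}

lemma maximal_inequality_finset (hX : ∀ i, Measurable (X i)) (hlaw : ∀ i, P.map (X i) = μ)
    (hind : iIndepFun X P) (hC : ∀ t, MeasurableSet (C t)) (hanti : Antitone C)
    (hCD : ∀ t, C t ⊆ D) (hhalf : μ.real D ≤ 1 / 2) (n : ℕ) {l : ℝ} (hl : 0 < l)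
    (T : Finset ℝ≥0) :
    P {ω | ∃ t ∈ T, l ≤ |centredCount μ X n (C t) ω|} ≤
      ENNReal.ofReal (2 * √(n * μ.real D) / l) := by
  rcases T.eq_empty_or_nonempty with rfl | hne
  · simp
  obtain ⟨s, hs, -, N, hN⟩ := exists_antitone_seq T hne
  have h1 := maximal_inequality_of_monotone hX hlaw hind (C := fun j => C (s j))
    (fun j => hC _) (fun i j hij => hanti (hs hij))
    (fun j => (measureReal_mono (hCD _)).trans hhalf) n N hl
  refine (measure_mono ?_).trans (h1.trans (ENNReal.ofReal_le_ofReal ?_))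
  · rintro ω ⟨t, ht, hlt⟩
    obtain ⟨j, hj, rfl⟩ := hN t ht
    exact ⟨j, hj, hlt⟩
  · have := measureReal_mono (μ := μ) (hCD (s N))
    gcongr

lemma maximal_inequality_countable (hX : ∀ i, Measurable (X i)) (hlaw : ∀ i, P.map (X i) = μ)
    (hind : iIndepFun X P) (hC : ∀ t, MeasurableSet (C t)) (hanti : Antitone C)
    (hCD : ∀ t, C t ⊆ D) (hhalf : μ.real D ≤ 1 / 2) (n : ℕ) {l : ℝ} (hl : 0 < l)
    {T : Set ℝ≥0} (hT : T.Countable) :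
    P {ω | ∃ t ∈ T, l ≤ |centredCount μ X n (C t) ω|} ≤
      ENNReal.ofReal (2 * √(n * μ.real D) / l) := by
  rcases T.eq_empty_or_nonempty with rfl | hne
  · simp
  obtain ⟨f, rfl⟩ := hT.exists_eq_range hne
  set A : ℕ → Set Ω := fun m => {ω | ∃ t ∈ (Finset.range m).image f,
    l ≤ |centredCount μ X n (C t) ω|} with hA
  have hmono : Monotone A := by
    rintro m m' hmm' ω ⟨t, ht, hlt⟩
    exact ⟨t, Finset.image_subset_image (Finset.range_mono hmm') ht, hlt⟩
  have hU : {ω | ∃ t ∈ Set.range f, l ≤ |centredCount μ X n (C t) ω|} = ⋃ m, A m := by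
    ext ω
    simp only [Set.mem_ofPred_eq, Set.mem_iUnion, hA]
    constructor
    · rintro ⟨_, ⟨i, rfl⟩, h⟩
      exact ⟨i + 1, f i, Finset.mem_image_of_mem f (by simp), h⟩
    · rintro ⟨m, t, ht, h⟩
      obtain ⟨i, -, rfl⟩ := Finset.mem_image.1 ht
      exact ⟨f i, ⟨i, rfl⟩, h⟩
  rw [hU, hmono.measure_iUnion]
  exact iSup_le fun m => maximal_inequality_finset hX hlaw hind hC hanti hCD hhalf n hl _

/-- Maximal inequality for the empirical process of a decreasing family of sets indexed by
`[0, ∞)`. -/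
theorem maximal_inequality (hX : ∀ i, Measurable (X i)) (hlaw : ∀ i, P.map (X i) = μ)
    (hind : iIndepFun X P) (hC : ∀ t, MeasurableSet (C t)) (hanti : Antitone C)
    (hCD : ∀ t, C t ⊆ D) (hhalf : μ.real D ≤ 1 / 2) (n : ℕ) {l : ℝ} (hl : 0 < l) :
    P {ω | ∃ t, l < |centredCount μ X n (C t) ω|} ≤
      ENNReal.ofReal (2 * √(n * μ.real D) / l) := by
  set h : ℝ≥0 → ℝ := fun t => μ.real (C t) with hh
  have hhanti : Antitone h := fun s t hst => measureReal_mono (hanti hst)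
  obtain ⟨Q, hQc, hQd⟩ := TopologicalSpace.exists_countable_dense ℝ≥0
  -- A countable index set suffices: a monotone function has countably many discontinuities. The
  -- point `0` is listed separately so that every remaining `t` has indices to its left.
  set T : Set ℝ≥0 := (Q ∪ {0}) ∪ {t | ¬ ContinuousAt h t} with hT
  have hTc : T.Countable :=
    (hQc.union (Set.countable_singleton 0)).union hhanti.countable_not_continuousAt
  refine (measure_mono ?_).trans
    (maximal_inequality_countable hX hlaw hind hC hanti hCD hhalf n hl hTc)
  rintro ω ⟨t, ht⟩
  by_cases htT : t ∈ T
  · exact ⟨t, htT, ht.le⟩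
  have hcont : ContinuousAt h t := by
    by_contra hc
    exact htT (Or.inr hc)
  have ht0 : 0 < t := pos_iff_ne_zero.2 fun h0 => htT (Or.inl (Or.inr h0))
  -- The margin above `l` absorbs a change of `n ε` in the mean. An excess of points persists on the
  -- larger set of a nearby `s ≤ t`, a deficit on the smaller set of a nearby `s ≥ t`.
  set ε : ℝ := (|centredCount μ X n (C t) ω| - l) / (n + 1) with hε
  have hε0 : 0 < ε := div_pos (sub_pos.2 ht) (by positivity)
  have hnε : n * ε ≤ |centredCount μ X n (C t) ω| - l := by
    have h1 : (n + 1) * ε = |centredCount μ X n (C t) ω| - l := by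
      rw [hε]; field_simp
    nlinarith
  have hnhds : {s | |h s - h t| < ε} ∈ 𝓝 t := by
    have := Metric.continuousAt_iff'.1 hcont ε hε0
    simp only [Real.dist_eq] at this
    exact this
  rw [centredCount_eq] at ht hnε
  rcases le_or_gt 0 (sampleCount X n (C t) ω - n * μ.real (C t)) with hs | hs
  · rw [abs_of_nonneg hs] at ht hnε
    obtain ⟨a, ha, hat⟩ := exists_Ioc_subset_of_mem_nhds hnhds ⟨0, ht0⟩
    obtain ⟨s, hsQ, hs1, hs2⟩ := hQd.exists_between ha
    refine ⟨s, Or.inl (Or.inl hsQ), ?_⟩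
    have h1 := (abs_lt.1 (show |h s - h t| < ε from hat ⟨hs1, hs2.le⟩)).2
    have h2 := sampleCount_mono (X := X) (n := n) (hanti hs2.le) ω
    have h3 : n * (h s - h t) ≤ n * ε := by gcongr
    rw [centredCount_eq]
    refine le_trans ?_ (le_abs_self _)
    simp only [hh] at h3
    linarith
  · rw [abs_of_neg hs] at ht hnε
    obtain ⟨b, hb, htb⟩ := exists_Ico_subset_of_mem_nhds hnhds (exists_gt t)
    obtain ⟨s, hsQ, hs1, hs2⟩ := hQd.exists_between hb
    refine ⟨s, Or.inl (Or.inl hsQ), ?_⟩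
    have h1 := (abs_lt.1 (show |h s - h t| < ε from htb ⟨hs1.le, hs2⟩)).1
    have h2 := sampleCount_mono (X := X) (n := n) (hanti hs1.le) ω
    have h3 : n * (h t - h s) ≤ n * ε := by
      gcongr
      linarith
    rw [centredCount_eq]
    refine le_trans ?_ (neg_le_abs _)
    simp only [hh] at h3
    linarith

end MaximalInequality

end KLExtremes
end

/-! ### Central limit theorem for counts in disjoint sets of vanishing probability. -/

noncomputable section
namespace KLExtremes

section CharFun

open Complex (I)

lemma norm_exp_sub_one_le (z : ℂ) : ‖Complex.exp z - 1‖ ≤ ‖z‖ * Real.exp ‖z‖ := by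
  simpa using Complex.norm_exp_sub_sum_le_norm_mul_exp z 1

lemma norm_exp_sub_one_sub_le (z : ℂ) : ‖Complex.exp z - 1 - z‖ ≤ ‖z‖ ^ 2 * Real.exp ‖z‖ := by
  have := Complex.norm_exp_sub_sum_le_norm_mul_exp z 2
  simpa [Finset.sum_range_succ, sub_sub] using this

lemma norm_exp_sub_one_sub_sub_le (z : ℂ) :
    ‖Complex.exp z - 1 - z - z ^ 2 / 2‖ ≤ ‖z‖ ^ 3 * Real.exp ‖z‖ := by
  have := Complex.norm_exp_sub_sum_le_norm_mul_exp z 3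
  simpa [Finset.sum_range_succ, sub_sub, add_assoc] using this

lemma norm_ofReal_mul_I (y : ℝ) : ‖(y : ℂ) * I‖ = |y| := by simp

/-- With the factor written as `(1 + a)(1 + ∑ q_j e_j)`, it suffices that `n` times its deviation
from `1` converges. The first-order terms cancel by centring, the second-order terms of the `e_j`
give the variance, and the cross term vanishes because `√k a → 0` while `√k e_j` and `n q_j / k`
converge. -/
lemma tendsto_charFun_factor_pow {K : ℕ} (t : Fin K → ℝ) (q : ℕ → Fin K → ℝ) {k : ℕ → ℕ}
    (hk : Tendsto k atTop atTop) (hkn : Tendsto (fun n => (k n : ℝ) / (n : ℝ)) atTop (𝓝 0))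
    {p : Fin K → ℝ} (hq : ∀ j, Tendsto (fun n : ℕ => n * q n j / k n) atTop (𝓝 (p j))) :
    Tendsto (fun n => (Complex.exp (((-(∑ j, t j * q n j) / √(k n : ℝ) : ℝ) : ℂ) * I) *
        (1 + ∑ j, (q n j : ℂ) * (Complex.exp (((t j / √(k n : ℝ) : ℝ) : ℂ) * I) - 1))) ^ n) atTop
      (𝓝 (Complex.exp (((-(∑ j, p j * t j ^ 2) / 2 : ℝ) : ℂ)))) := by
  set τ : ℕ → ℝ := fun n => (√(k n : ℝ))⁻¹ with hτ
  set σ : ℕ → ℝ := fun n => ∑ j, t j * q n j with hσ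
  set y : ℕ → ℝ := fun n => -(σ n) / √(k n : ℝ) with hy
  set a : ℕ → ℂ := fun n => Complex.exp ((y n : ℂ) * I) - 1 with ha
  set e : ℕ → Fin K → ℂ := fun n j => Complex.exp (((t j / √(k n : ℝ) : ℝ) : ℂ) * I) - 1 with he
  have hkR : Tendsto (fun n => (k n : ℝ)) atTop atTop := tendsto_natCast_atTop_atTop.comp hk
  have hsq : Tendsto (fun n => √(k n : ℝ)) atTop atTop := Real.tendsto_sqrt_atTop.comp hkR
  have hτ0 : Tendsto τ atTop (𝓝 0) := tendsto_inv_atTop_zero.comp hsq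
  have hev : ∀ᶠ n in atTop, (0 : ℝ) < k n ∧ (0 : ℝ) < n :=
    (hkR.eventually_gt_atTop 0).and
      ((tendsto_natCast_atTop_atTop (R := ℝ)).eventually_gt_atTop 0)
  set s : ℕ → ℝ := fun n => -∑ j, t j * (n * q n j / k n) with hs
  have hslim : Tendsto s atTop (𝓝 (-∑ j, t j * p j)) :=
    (tendsto_finsetSum _ fun j _ => (hq j).const_mul _).neg
  have hysq : ∀ᶠ n in atTop, √(k n : ℝ) * y n = s n * (k n / n) := by
    filter_upwards [hev] with n hn
    have h1 : √(k n : ℝ) ≠ 0 := (Real.sqrt_pos.2 hn.1).ne'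
    have h2 := hn.1.ne'
    have h3 := hn.2.ne'
    simp only [hy, hs, hσ]
    rw [mul_div_cancel₀ _ h1, neg_mul, Finset.sum_mul]
    congr 1
    refine Finset.sum_congr rfl fun j _ => ?_
    field_simp
  have hsqy : Tendsto (fun n => √(k n : ℝ) * y n) atTop (𝓝 0) := by
    have := (hslim.mul hkn).congr' (hysq.mono fun n hn => hn.symm)
    simpa using this
  have hy0 : Tendsto y atTop (𝓝 0) := by
    have h1 := hτ0.mul hsqy
    rw [mul_zero] at h1
    refine h1.congr' ?_
    filter_upwards [hev] with n hn
    have h1 : √(k n : ℝ) ≠ 0 := (Real.sqrt_pos.2 hn.1).ne'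
    simp only [hτ]
    field_simp
  have hny : Tendsto (fun n : ℕ => (n : ℝ) * y n ^ 2) atTop (𝓝 0) := by
    have h1 := (hslim.pow 2).mul hkn
    rw [mul_zero] at h1
    refine h1.congr' ?_
    filter_upwards [hev, hysq] with n hn hyn
    have h2 := hn.1.ne'
    have h3 := hn.2.ne'
    have h4 : (k n : ℝ) * y n ^ 2 = s n ^ 2 * (k n / n) ^ 2 := by
      rw [← mul_pow, ← hyn, mul_pow, Real.sq_sqrt hn.1.le]
    field_simp at h4 ⊢
    linarith
  have hexpy : Tendsto (fun n => Real.exp |y n|) atTop (𝓝 1) := by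
    have := (Real.continuous_exp.tendsto _).comp hy0.abs
    rwa [abs_zero, Real.exp_zero] at this
  have T1 : Tendsto (fun n : ℕ => (n : ℂ) * (a n - (y n : ℂ) * I)) atTop (𝓝 0) := by
    have h1 := hny.mul hexpy
    rw [zero_mul] at h1
    refine squeeze_zero_norm (fun n => ?_) h1
    rw [norm_mul, Complex.norm_natCast, mul_assoc]
    have h2 := norm_exp_sub_one_sub_le ((y n : ℂ) * I)
    rw [norm_ofReal_mul_I, sq_abs] at h2
    gcongr
  have T2 : ∀ j, Tendsto (fun n => (k n : ℂ) * (e n j - ((t j / √(k n : ℝ) : ℝ) : ℂ) * I)) atTop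
      (𝓝 (-(t j : ℂ) ^ 2 / 2)) := by
    intro j
    have h0 : Tendsto (fun n => t j / √(k n : ℝ)) atTop (𝓝 0) := hsq.const_div_atTop _
    have hb : Tendsto (fun n => |t j| ^ 2 * |t j / √(k n : ℝ)| * Real.exp |t j / √(k n : ℝ)|)
        atTop (𝓝 0) := by
      have := (h0.abs.const_mul (|t j| ^ 2)).mul ((Real.continuous_exp.tendsto _).comp h0.abs)
      simpa using this
    have h1 : Tendsto (fun n => (k n : ℂ) * (e n j - ((t j / √(k n : ℝ) : ℝ) : ℂ) * I -
        (((t j / √(k n : ℝ) : ℝ) : ℂ) * I) ^ 2 / 2)) atTop (𝓝 0) := by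
      refine squeeze_zero_norm' ?_ hb
      filter_upwards [hev] with n hn
      rw [norm_mul, Complex.norm_natCast]
      have h2 := norm_exp_sub_one_sub_sub_le (((t j / √(k n : ℝ) : ℝ) : ℂ) * I)
      rw [norm_ofReal_mul_I] at h2
      have h3 : (k n : ℝ) * |t j / √(k n : ℝ)| ^ 2 = |t j| ^ 2 := by
        rw [sq_abs, sq_abs, div_pow, Real.sq_sqrt hn.1.le]
        field_simp [hn.1.ne']
      calc _ ≤ (k n : ℝ) * (|t j / √(k n : ℝ)| ^ 3 * Real.exp |t j / √(k n : ℝ)|) := by gcongr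
        _ = _ := by rw [← h3]; ring
    have h2 := h1.add_const (-(t j : ℂ) ^ 2 / 2)
    rw [zero_add] at h2
    refine h2.congr' ?_
    filter_upwards [hev] with n hn
    have h3 : (k n : ℂ) * ((((t j / √(k n : ℝ) : ℝ) : ℂ) * I) ^ 2 / 2) = -(t j : ℂ) ^ 2 / 2 := by
      have h4 : (k n : ℝ) * (t j / √(k n : ℝ)) ^ 2 = t j ^ 2 := by
        rw [div_pow, Real.sq_sqrt hn.1.le]
        field_simp [hn.1.ne']
      rw [mul_pow, Complex.I_sq, mul_neg_one, neg_div, mul_neg, neg_div, ← mul_div_assoc]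
      congr 2
      exact_mod_cast h4
    rw [mul_sub, h3]
    ring
  have T3 : Tendsto (fun n => (√(k n : ℝ) : ℂ) * a n) atTop (𝓝 0) := by
    have h1 := hsqy.abs.mul hexpy
    rw [abs_zero, zero_mul] at h1
    refine squeeze_zero_norm (fun n => ?_) h1
    rw [norm_mul, Complex.norm_real, Real.norm_eq_abs, abs_mul, mul_assoc]
    have h2 := norm_exp_sub_one_le ((y n : ℂ) * I)
    rw [norm_ofReal_mul_I] at h2
    gcongr
  have T4 : ∀ j, Tendsto (fun n => (√(k n : ℝ) : ℂ) * e n j) atTop (𝓝 ((t j : ℂ) * I)) := by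
    intro j
    have hτC : Tendsto (fun n => (τ n : ℂ)) atTop (𝓝 0) := by
      exact_mod_cast (Complex.continuous_ofReal.tendsto _).comp hτ0
    have h1 := (hτC.mul (T2 j)).add_const ((t j : ℂ) * I)
    rw [zero_mul, zero_add] at h1
    refine h1.congr' ?_
    filter_upwards [hev] with n hn
    have h2 : ((√(k n : ℝ) : ℝ) : ℂ) ≠ 0 := by
      exact_mod_cast (Real.sqrt_pos.2 hn.1).ne'
    have h3 : ((k n : ℕ) : ℂ) = ((√(k n : ℝ) : ℝ) : ℂ) * ((√(k n : ℝ) : ℝ) : ℂ) := by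
      exact_mod_cast (Real.mul_self_sqrt hn.1.le).symm
    simp only [hτ]
    push_cast
    rw [h3]
    field_simp
    ring
  have hqC : ∀ j, Tendsto (fun n => ((n * q n j / k n : ℝ) : ℂ)) atTop (𝓝 (p j : ℂ)) := fun j =>
    (Complex.continuous_ofReal.tendsto _).comp (hq j)
  have main : Tendsto (fun n : ℕ => (n : ℂ) * (a n - (y n : ℂ) * I) +
      ∑ j, ((n * q n j / k n : ℝ) : ℂ) *
        ((k n : ℂ) * (e n j - ((t j / √(k n : ℝ) : ℝ) : ℂ) * I)) +
      ∑ j, ((n * q n j / k n : ℝ) : ℂ) *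
        (((√(k n : ℝ) : ℂ) * a n) * ((√(k n : ℝ) : ℂ) * e n j))) atTop
      (𝓝 (((-(∑ j, p j * t j ^ 2) / 2 : ℝ) : ℂ))) := by
    have := (T1.add (tendsto_finsetSum Finset.univ fun j _ => (hqC j).mul (T2 j))).add
      (tendsto_finsetSum Finset.univ fun j _ => (hqC j).mul (T3.mul (T4 j)))
    convert this using 2
    simp only [zero_mul, mul_zero, Finset.sum_const_zero, add_zero, zero_add]
    push_cast
    rw [neg_div, Finset.sum_div, ← Finset.sum_neg_distrib]
    refine Finset.sum_congr rfl fun j _ => ?_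
    ring
  have hfin := Complex.tendsto_one_add_pow_exp_of_tendsto
    (g := fun n => (1 + a n) * (1 + ∑ j, (q n j : ℂ) * e n j) - 1)
    (t := ((-(∑ j, p j * t j ^ 2) / 2 : ℝ) : ℂ)) (main.congr' ?_)
  · refine hfin.congr fun n => ?_
    congr 1
    simp only [ha, he, hy, hσ]
    ring
  · filter_upwards [hev] with n hn
    have h2 : ((√(k n : ℝ) : ℝ) : ℂ) ≠ 0 := by
      exact_mod_cast (Real.sqrt_pos.2 hn.1).ne'
    have h3 : ((k n : ℕ) : ℂ) = ((√(k n : ℝ) : ℝ) : ℂ) * ((√(k n : ℝ) : ℝ) : ℂ) := by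
      exact_mod_cast (Real.mul_self_sqrt hn.1.le).symm
    have e1 : ∑ j, ((n * q n j / k n : ℝ) : ℂ) *
        ((k n : ℂ) * (e n j - ((t j / √(k n : ℝ) : ℝ) : ℂ) * I)) =
        n * ∑ j, (q n j : ℂ) * e n j + n * ((y n : ℂ) * I) := by
      have : (y n : ℂ) * I = -∑ j, (q n j : ℂ) * (((t j / √(k n : ℝ) : ℝ) : ℂ) * I) := by
        simp only [hy, hσ]
        push_cast
        rw [neg_div, neg_mul, Finset.sum_div, Finset.sum_mul]
        congr 1
        refine Finset.sum_congr rfl fun j _ => ?_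
        ring
      rw [this, ← mul_add, ← sub_eq_add_neg, ← Finset.sum_sub_distrib, Finset.mul_sum]
      refine Finset.sum_congr rfl fun j _ => ?_
      push_cast
      rw [h3]
      field_simp
    have e2 : ∑ j, ((n * q n j / k n : ℝ) : ℂ) *
        (((√(k n : ℝ) : ℂ) * a n) * ((√(k n : ℝ) : ℂ) * e n j)) =
        n * (a n * ∑ j, (q n j : ℂ) * e n j) := by
      rw [Finset.mul_sum, Finset.mul_sum]
      refine Finset.sum_congr rfl fun j _ => ?_
      push_cast
      rw [h3]
      field_simp
    rw [e1, e2]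
    ring

lemma exp_sum_indicator_of_disjoint {E : Type*} {K : ℕ}
    {B : Fin K → Set E} (hB : Pairwise fun i j => Disjoint (B i) (B j)) (θ : Fin K → ℝ) (x : E) :
    Complex.exp (((∑ j, θ j * (B j).indicator 1 x : ℝ) : ℂ) * I) =
      1 + ∑ j, (((B j).indicator 1 x : ℝ) : ℂ) * (Complex.exp ((θ j : ℂ) * I) - 1) := by
  by_cases h : ∃ j, x ∈ B j
  · obtain ⟨j, hj⟩ := h
    have hz : ∀ i, i ≠ j → (B i).indicator (1 : E → ℝ) x = 0 := fun i hi =>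
      Set.indicator_of_notMem (fun hxi => Set.disjoint_left.1 (hB hi) hxi hj) _
    rw [Finset.sum_eq_single j (fun i _ hi => by rw [hz i hi, mul_zero]) (by simp),
      Finset.sum_eq_single j (fun i _ hi => by rw [hz i hi]; simp) (by simp),
      Set.indicator_of_mem hj]
    simp
  · push Not at h
    simp [Set.indicator_of_notMem (h _)]

end CharFun

section CentralLimit

variable {Ω Ω' E : Type*} [MeasurableSpace Ω] [MeasurableSpace Ω'] [MeasurableSpace E]
  {P : Measure Ω} {P' : Measure Ω'}
  {X : ℕ → Ω → E} {μ : Measure E} [IsProbabilityMeasure μ] {K : ℕ}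

open Complex (I)

lemma charFun_centredCount (hX : ∀ i, Measurable (X i)) (hlaw : ∀ i, P.map (X i) = μ)
    (hind : iIndepFun X P) {B : Fin K → Set E} (hBm : ∀ j, MeasurableSet (B j))
    (hB : Pairwise fun i j => Disjoint (B i) (B j)) (n : ℕ) (c : ℝ)
    (t : EuclideanSpace ℝ (Fin K)) :
    charFun (P.map fun ω => WithLp.toLp 2 fun j => centredCount μ X n (B j) ω / c) t =
      (Complex.exp (((-(∑ j, t j * μ.real (B j)) / c : ℝ) : ℂ) * I) *
        (1 + ∑ j, (μ.real (B j) : ℂ) * (Complex.exp (((t j / c : ℝ) : ℂ) * I) - 1))) ^ n := by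
  have hm : Measurable fun ω => WithLp.toLp 2 fun j => centredCount μ X n (B j) ω / c :=
    (WithLp.measurable_toLp 2 _).comp
      (measurable_pi_lambda _ fun j => (measurable_centredCount hX (hBm j) n).div_const c)
  set f : E → ℂ := fun x => Complex.exp (((-(∑ j, t j * μ.real (B j)) / c : ℝ) : ℂ) * I) *
    Complex.exp (((∑ j, t j / c * (B j).indicator 1 x : ℝ) : ℂ) * I) with hf
  have hfm : Measurable f := by
    refine measurable_const.mul (Complex.measurable_exp.comp (Measurable.mul_const ?_ _))
    refine Complex.measurable_ofReal.comp (Finset.measurable_fun_sum _ fun j _ => ?_)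
    exact (measurable_one.indicator (hBm j)).const_mul _
  have hfint : ∫ x, f x ∂μ = Complex.exp (((-(∑ j, t j * μ.real (B j)) / c : ℝ) : ℂ) * I) *
      (1 + ∑ j, (μ.real (B j) : ℂ) * (Complex.exp (((t j / c : ℝ) : ℂ) * I) - 1)) := by
    simp only [hf]
    rw [integral_const_mul]
    congr 1
    simp_rw [exp_sum_indicator_of_disjoint hB]
    have hi : ∀ j, Integrable (fun x => (((B j).indicator 1 x : ℝ) : ℂ)) μ := fun j =>
      ((integrable_const (1 : ℝ)).indicator (hBm j)).ofReal
    rw [integral_add (integrable_const _) (integrable_finsetSum _ fun j _ => (hi j).mul_const _),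
      integral_finsetSum _ fun j _ => (hi j).mul_const _]
    congr 1
    · simp
    · refine Finset.sum_congr rfl fun j _ => ?_
      rw [integral_mul_const, integral_complex_ofReal, integral_indicator_one (hBm j)]
  rw [charFun_apply, integral_map hm.aemeasurable (by fun_prop), ← hfint]
  have hprod : ∀ ω, Complex.exp ((inner ℝ (WithLp.toLp 2 fun j => centredCount μ X n (B j) ω / c)
      t : ℝ) * I) = ∏ i : Fin n, f (X i ω) := by
    intro ω
    simp only [hf]
    simp_rw [← Complex.exp_add]
    rw [← Complex.exp_sum]
    congr 1
    simp_rw [← add_mul]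
    rw [← Finset.sum_mul]
    congr 1
    simp_rw [← Complex.ofReal_add]
    rw [← Complex.ofReal_sum]
    congr 1
    rw [PiLp.inner_apply]
    simp only [centredCount, RCLike.inner_apply, conj_trivial]
    rw [Fin.sum_univ_eq_sum_range (fun i => -(∑ j, t j * μ.real (B j)) / c +
      ∑ j, t j / c * (B j).indicator 1 (X i ω)) n]
    simp_rw [Finset.sum_div, Finset.mul_sum]
    rw [Finset.sum_comm]
    refine Finset.sum_congr rfl fun i _ => ?_
    rw [← Finset.sum_neg_distrib, Finset.sum_div, ← Finset.sum_add_distrib]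
    refine Finset.sum_congr rfl fun j _ => ?_
    ring
  simp_rw [hprod]
  have hindn : iIndepFun (fun i : Fin n => X i) P := hind.precomp Fin.val_injective
  rw [hindn.integral_fun_prod_comp (f := fun _ => f) (fun i => (hX i).aemeasurable)
    (fun i => hfm.aestronglyMeasurable)]
  have : ∀ i : Fin n, ∫ ω, f (X i ω) ∂P = ∫ x, f x ∂μ := fun i => by
    rw [← hlaw i, integral_map (hX i).aemeasurable hfm.aestronglyMeasurable]
  simp [this]

variable [IsProbabilityMeasure P] [IsProbabilityMeasure P']

/-- Central limit theorem for the numbers of sample points in disjoint sets of vanishing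
probability. -/
theorem tendstoInDistribution_centredCount (hX : ∀ i, Measurable (X i))
    (hlaw : ∀ i, P.map (X i) = μ) (hind : iIndepFun X P) {B : ℕ → Fin K → Set E}
    (hBm : ∀ n j, MeasurableSet (B n j))
    (hB : ∀ n, Pairwise fun i j => Disjoint (B n i) (B n j)) {k : ℕ → ℕ}
    (hk : Tendsto k atTop atTop) (hkn : Tendsto (fun n => (k n : ℝ) / (n : ℝ)) atTop (𝓝 0))
    {p : Fin K → ℝ} (hp0 : ∀ j, 0 ≤ p j)
    (hp : ∀ j, Tendsto (fun n : ℕ => n * μ.real (B n j) / k n) atTop (𝓝 (p j)))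
    {N : Fin K → Ω' → ℝ} (hN : iIndepFun N P')
    (hNlaw : ∀ j, HasLaw (N j) (gaussianReal 0 (p j).toNNReal) P') :
    TendstoInDistribution (fun n ω j => centredCount μ X n (B n j) ω / √(k n : ℝ)) atTop
      (fun ω' j => N j ω') (fun _ => P) P' := by
  have hmeas : ∀ n, Measurable fun ω => WithLp.toLp 2
      fun j => centredCount μ X n (B n j) ω / √(k n : ℝ) := fun n =>
    (WithLp.measurable_toLp 2 _).comp
      (measurable_pi_lambda _ fun j => (measurable_centredCount hX (hBm n j) n).div_const _)
  have hNm : AEMeasurable (fun ω' => WithLp.toLp 2 fun j => N j ω') P' :=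
    (WithLp.measurable_toLp 2 _).comp_aemeasurable
      (aemeasurable_pi_lambda _ fun j => (hNlaw j).aemeasurable)
  have h : TendstoInDistribution
      (fun n ω => WithLp.toLp 2 fun j => centredCount μ X n (B n j) ω / √(k n : ℝ)) atTop
      (fun ω' => WithLp.toLp 2 fun j => N j ω') (fun _ => P) P' := by
    refine ⟨fun n => (hmeas n).aemeasurable, hNm, ?_⟩
    refine ProbabilityMeasure.tendsto_iff_tendsto_charFun.2 fun t => ?_
    simp only [ProbabilityMeasure.coe_mk]
    rw [(iIndepFun_iff_charFun_pi fun j => (hNlaw j).aemeasurable).1 hN t]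
    simp_rw [fun j => (hNlaw j).map_eq, charFun_gaussianReal]
    have h1 := tendsto_charFun_factor_pow (fun j => t j) (fun n j => μ.real (B n j)) hk hkn hp
    rw [← Complex.exp_sum]
    convert h1 using 2
    · exact charFun_centredCount hX hlaw hind (hBm _) (hB _) _ _ t
    · congr 1
      push_cast
      rw [neg_div, Finset.sum_div, ← Finset.sum_neg_distrib]
      refine Finset.sum_congr rfl fun j _ => ?_
      simp [hp0 j]
  exact h.continuous_comp (g := fun x : EuclideanSpace ℝ (Fin K) => x.ofLp)
    (PiLp.continuous_ofLp 2 _)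

end CentralLimit

end KLExtremes
end

noncomputable section
namespace KLExtremes

/-! ### Order statistics expressed through counts. -/

section OrderStatistic

/-- At least `n - k` values are `≤ w` exactly when at most `k` exceed `w`; `k < n` keeps the default
value `0` out of play. Ties need no separate treatment. -/
lemma orderStat_le_iff {n k : ℕ} (hk : k < n) (v : Fin n → ℝ≥0) (w : ℝ≥0) :
    orderStat v (n - k) ≤ w ↔ (Finset.univ.filter fun i => w < v i).card ≤ k := by
  have h : 1 ≤ n - k ∧ n - k ≤ n := by omega
  rw [orderStat, dif_pos h]
  have h1 := Tuple.lt_card_le_iff_apply_le_of_monotone (f := v ∘ Tuple.sort v) (a := w)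
    (j := ⟨n - k - 1, by omega⟩) (Tuple.monotone_sort v)
  have h2 : (Finset.univ.filter fun i => (v ∘ Tuple.sort v) i ≤ w).card =
      (Finset.univ.filter fun i => v i ≤ w).card :=
    Finset.card_bijective (Tuple.sort v) (Tuple.sort v).bijective (by simp)
  have h3 := Finset.card_filter_add_card_filter_not (s := (Finset.univ : Finset (Fin n)))
    (fun i => v i ≤ w)
  simp only [not_le, Finset.card_univ, Fintype.card_fin] at h3
  rw [h2] at h1
  simp only [Function.comp_apply] at h1
  rw [← h1]
  omega

variable {Ω : Type*} {d : ℕ} {X : ℕ → Ω → Orthant d} {r : Orthant d → ℝ≥0}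

lemma sampleCount_eq_card (n : ℕ) (w : ℝ≥0) (ω : Ω) :
    sampleCount X n {x | w < r x} ω =
      ((Finset.univ.filter fun i : Fin n => w < r (X i ω)).card : ℝ) := by
  rw [sampleCount, ← Fin.sum_univ_eq_sum_range
    (fun i => Set.indicator {x | w < r x} (1 : Orthant d → ℝ) (X i ω)), Finset.card_filter]
  push_cast
  refine Finset.sum_congr rfl fun i _ => ?_
  simp [Set.indicator_apply]

/-- The order statistic `R_{n-k,n}` of `r(X_1), …, r(X_n)`. -/
def threshold (r : Orthant d → ℝ≥0) (X : ℕ → Ω → Orthant d) (n k : ℕ) (ω : Ω) : ℝ≥0 :=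
  orderStat (fun i : Fin n => r (X i ω)) (n - k)

lemma threshold_le_iff {n k : ℕ} (hk : k < n) (w : ℝ≥0) (ω : Ω) :
    threshold r X n k ω ≤ w ↔ sampleCount X n {x | w < r x} ω ≤ k := by
  rw [threshold, orderStat_le_iff hk, sampleCount_eq_card]
  norm_cast

lemma empiricalProb_eq (A : Set (Orthant d)) (n k : ℕ) (ω : Ω) :
    empiricalProb r A k (fun i : Fin n => X i ω) =
      sampleCount X n (threshold r X n k ω • A) ω / k := by
  rw [empiricalProb, sampleCount, ← Fin.sum_univ_eq_sum_range
    (fun i => Set.indicator (threshold r X n k ω • A) (1 : Orthant d → ℝ) (X i ω)),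
    one_div, div_eq_inv_mul]
  congr 1

variable [MeasurableSpace Ω]

lemma measurable_threshold (hX : ∀ i, Measurable (X i)) (hr : Measurable r) (n k : ℕ) :
    Measurable (threshold r X n k) := by
  by_cases hk : k < n
  · refine measurable_of_Iic fun w => ?_
    have h : threshold r X n k ⁻¹' Set.Iic w = {ω | sampleCount X n {x | w < r x} ω ≤ k} := by
      ext ω
      exact threshold_le_iff hk w ω
    rw [h]
    refine measurableSet_le (Finset.measurable_fun_sum _ fun i _ => ?_) measurable_const
    exact measurable_indicator_comp hX (measurableSet_lt measurable_const hr) i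
  · have : threshold r X n k = fun _ => 0 := by
      ext ω
      simp only [threshold, orderStat]
      rw [dif_neg (by omega)]
    rw [this]
    exact measurable_const

/-- Where the factor is nonzero, membership is a condition on `s⁻¹ • Y`; where it is zero, the
dilated set has at most one point. -/
lemma measurable_smul_indicator {A : Set (Orthant d)} (hA : MeasurableSet A) {s : Ω → ℝ≥0}
    (hs : Measurable s) {Y : Ω → Orthant d} (hY : Measurable Y) :
    Measurable fun ω => (s ω • A).indicator (1 : Orthant d → ℝ) (Y ω) := by
  have hset : MeasurableSet {ω | Y ω ∈ s ω • A} := by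
    have h : {ω | Y ω ∈ s ω • A} = ({ω | s ω ≠ 0} ∩ (fun ω => (s ω)⁻¹ • Y ω) ⁻¹' A) ∪
        ({ω | s ω = 0} ∩ Y ⁻¹' ((0 : ℝ≥0) • A)) := by
      ext ω
      by_cases h0 : s ω = 0
      · simp [h0]
      · simp [h0, mem_smul_set_iff h0]
    have h0 : ((0 : ℝ≥0) • A).Subsingleton := (Set.subsingleton_zero_smul_set A)
    rw [h]
    refine ((hs (measurableSet_singleton 0).compl).inter ?_).union
      ((hs (measurableSet_singleton 0)).inter (hY h0.measurableSet))
    refine (measurable_pi_lambda _ fun j => ?_) hA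
    exact hs.inv.mul ((measurable_pi_apply j).comp hY)
  have : (fun ω => (s ω • A).indicator (1 : Orthant d → ℝ) (Y ω)) =
      {ω | Y ω ∈ s ω • A}.indicator 1 := by
    ext ω
    by_cases h : Y ω ∈ s ω • A <;> simp [h]
  rw [this]
  exact measurable_one.indicator hset

lemma measurable_empiricalProb (hX : ∀ i, Measurable (X i)) (hr : Measurable r)
    {A : Set (Orthant d)} (hA : MeasurableSet A) (n k : ℕ) :
    Measurable fun ω => empiricalProb r A k (fun i : Fin n => X i ω) := by
  simp_rw [empiricalProb_eq]
  refine Measurable.div_const (Finset.measurable_fun_sum _ fun i _ => ?_) _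
  exact measurable_smul_indicator hA (measurable_threshold hX hr n k) (hX i)

end OrderStatistic

/-! ### Sets stable under dilation and the algebra they generate. -/

section StableSets

variable {d : ℕ} {r : Orthant d → ℝ≥0}

lemma IsRiskFunctional.exceedanceSet_mem_stableSets (hr : IsRiskFunctional r) :
    exceedanceSet r ∈ stableSets r := by
  refine ⟨measurableSet_lt measurable_const hr.measurable, subset_rfl, fun t ht => ?_⟩
  rintro _ ⟨x, hx, rfl⟩
  have hx' : 1 < r x := hx
  simp only [exceedanceSet, Set.mem_ofPred_eq]
  rw [hr.homogeneous t (zero_lt_one.trans ht)]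
  exact one_lt_mul ht.le hx'

lemma IsRiskFunctional.smul_exceedanceSet (hr : IsRiskFunctional r) {w : ℝ≥0} (hw : w ≠ 0) :
    w • exceedanceSet r = {x | w < r x} := by
  ext x
  rw [mem_smul_set_iff hw, exceedanceSet, Set.mem_ofPred_eq,
    hr.homogeneous _ (pos_iff_ne_zero.2 (inv_ne_zero hw)), Set.mem_ofPred_eq,
    lt_inv_mul_iff₀ (pos_iff_ne_zero.2 hw), mul_one]

lemma inter_mem_stableSets {B C : Set (Orthant d)} (hB : B ∈ stableSets r)
    (hC : C ∈ stableSets r) : B ∩ C ∈ stableSets r :=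
  ⟨hB.1.inter hC.1, Set.inter_subset_left.trans hB.2.1, fun t ht =>
    (Set.smul_set_inter_subset).trans (Set.inter_subset_inter (hB.2.2 t ht) (hC.2.2 t ht))⟩

lemma smul_subset_smul_of_mem_stableSets {B : Set (Orthant d)} (hB : B ∈ stableSets r) {s t : ℝ≥0}
    (hs : s ≠ 0) (hst : s ≤ t) : t • B ⊆ s • B := by
  rcases hst.eq_or_lt with rfl | h
  · rfl
  have h1 : 1 < s⁻¹ * t := by rwa [lt_inv_mul_iff₀ (pos_iff_ne_zero.2 hs), mul_one]
  have h2 := Set.smul_set_mono (a := s) (hB.2.2 _ h1)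
  rwa [smul_smul, mul_inv_cancel_left₀ hs] at h2

lemma measurableSet_of_mem_generateSetAlgebra {S : Set (Orthant d)}
    (hS : S ∈ generateSetAlgebra (stableSets r)) : MeasurableSet S := by
  induction hS with
  | base s hs => exact hs.1
  | empty => exact MeasurableSet.empty
  | compl s _ ih => exact ih.compl
  | union s t _ _ ihs iht => exact ihs.union iht

/-- The indicator function of a member of the algebra generated by the stable sets is, on `Ω_r`, a
linear combination of indicator functions of stable sets. -/
lemma indicator_inter_mem_span (hr : IsRiskFunctional r) {S : Set (Orthant d)}
    (hS : S ∈ generateSetAlgebra (stableSets r)) :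
    (S ∩ exceedanceSet r).indicator (1 : Orthant d → ℝ) ∈
      Submodule.span ℝ ((fun B => B.indicator (1 : Orthant d → ℝ)) '' stableSets r) := by
  set T := (fun B => B.indicator (1 : Orthant d → ℝ)) '' stableSets r with hT
  -- Stable sets are closed under intersection, so the span is closed under products; complements in
  -- `Ω_r` and unions are then algebraic identities.
  have hmul : ∀ f g, f ∈ Submodule.span ℝ T → g ∈ Submodule.span ℝ T →
      f * g ∈ Submodule.span ℝ T := by
    intro f g hf hg
    have h1 := Submodule.mul_mem_mul hf hg
    rw [Submodule.span_mul_span] at h1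
    refine Submodule.span_mono ?_ h1
    rintro _ ⟨_, ⟨B, hB, rfl⟩, _, ⟨C, hC, rfl⟩, rfl⟩
    exact ⟨B ∩ C, inter_mem_stableSets hB hC, Set.inter_indicator_one⟩
  have hΩ : (exceedanceSet r).indicator (1 : Orthant d → ℝ) ∈ Submodule.span ℝ T :=
    Submodule.subset_span ⟨_, hr.exceedanceSet_mem_stableSets, rfl⟩
  induction hS with
  | base s hs =>
    rw [Set.inter_eq_self_of_subset_left hs.2.1]
    exact Submodule.subset_span ⟨s, hs, rfl⟩
  | empty =>
    rw [Set.empty_inter, Set.indicator_empty']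
    exact Submodule.zero_mem _
  | compl s _ ih =>
    have : (sᶜ ∩ exceedanceSet r).indicator (1 : Orthant d → ℝ) =
        (exceedanceSet r).indicator 1 - (s ∩ exceedanceSet r).indicator 1 := by
      ext x
      by_cases h1 : x ∈ s <;> by_cases h2 : x ∈ exceedanceSet r <;> simp [h1, h2]
    rw [this]
    exact Submodule.sub_mem _ hΩ ih
  | union s t _ _ ihs iht =>
    have : ((s ∪ t) ∩ exceedanceSet r).indicator (1 : Orthant d → ℝ) =
        (s ∩ exceedanceSet r).indicator 1 + (t ∩ exceedanceSet r).indicator 1 -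
        (s ∩ exceedanceSet r).indicator 1 * (t ∩ exceedanceSet r).indicator 1 := by
      ext x
      by_cases h1 : x ∈ s <;> by_cases h2 : x ∈ t <;> by_cases h3 : x ∈ exceedanceSet r <;>
        simp [h1, h2, h3]
    rw [this]
    exact Submodule.sub_mem _ (Submodule.add_mem _ ihs iht) (hmul _ _ ihs iht)

lemma exists_indicator_eq_sum (hr : IsRiskFunctional r) {S : Set (Orthant d)}
    (hS : S ∈ generateSetAlgebra (stableSets r)) (hSr : S ⊆ exceedanceSet r) :
    ∃ (m : ℕ) (c : Fin m → ℝ) (B : Fin m → Set (Orthant d)), (∀ i, B i ∈ stableSets r) ∧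
      ∀ x, S.indicator (1 : Orthant d → ℝ) x = ∑ i, c i * (B i).indicator 1 x := by
  have h := indicator_inter_mem_span hr hS
  rw [Set.inter_eq_self_of_subset_left hSr] at h
  obtain ⟨m, c, g, hg⟩ := Submodule.mem_span_set'.1 h
  choose B hB hBg using fun i => (g i).2
  refine ⟨m, c, B, hB, fun x => ?_⟩
  rw [← hg]
  simp [← hBg]

end StableSets

/-! ### Dilations move a set only near its boundary. -/

section Neighbourhood

variable {d : ℕ}

lemma inter_frontier_nonempty {E : Type*} [TopologicalSpace E] {I A : Set E}
    (hI : IsPreconnected I) {x y : E} (hx : x ∈ I) (hxA : x ∈ A) (hy : y ∈ I) (hyA : y ∉ A) :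
    (I ∩ frontier A).Nonempty := by
  by_contra h
  have hz : ∀ z ∈ I, z ∉ frontier A := fun z hz hzf => h ⟨z, hz, hzf⟩
  have h1 : x ∈ interior A := by
    by_contra h1
    exact hz x hx ⟨subset_closure hxA, h1⟩
  have h2 : y ∈ (closure A)ᶜ := fun h2 => hz y hy ⟨h2, fun h3 => hyA (interior_subset h3)⟩
  obtain ⟨z, -, hz1, hz2⟩ := hI _ _ isOpen_interior isClosed_closure.isOpen_compl
    (fun z hzI => by
      by_cases hc : z ∈ closure A
      · exact Or.inl (by_contra fun hi => hz z hzI ⟨hc, hi⟩)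
      · exact Or.inr hc) ⟨x, hx, h1⟩ ⟨y, hy, h2⟩
  exact hz2 (interior_subset_closure hz1)

/-- Exactly one of `x` and `t⁻¹ • x` lies in `A`, so the segment joining them crosses `∂A`. -/
lemma infDist_frontier_le {A : Set (Orthant d)} {t : ℝ≥0} (ht : t ≠ 0) {x : Orthant d}
    (hx : ¬ (x ∈ t • A ↔ x ∈ A)) :
    (frontier A).Nonempty ∧ Metric.infDist x (frontier A) ≤ |(t : ℝ)⁻¹ - 1| * supNorm x := by
  set I : Set (Orthant d) := (fun s : ℝ≥0 => s • x) '' Set.uIcc 1 t⁻¹ with hI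
  have hconn : IsPreconnected I := isPreconnected_uIcc.image _ (by fun_prop)
  have h1 : x ∈ I := ⟨1, Set.left_mem_uIcc, one_smul _ _⟩
  have h2 : t⁻¹ • x ∈ I := ⟨t⁻¹, Set.right_mem_uIcc, rfl⟩
  rw [mem_smul_set_iff ht] at hx
  have hfr : (I ∩ frontier A).Nonempty := by
    by_cases hxA : x ∈ A
    · exact inter_frontier_nonempty hconn h1 hxA h2 fun h => hx ⟨fun _ => hxA, fun _ => h⟩
    · refine inter_frontier_nonempty hconn h2 ?_ h1 hxA
      by_contra h
      exact hx ⟨fun h' => absurd h' h, fun h' => absurd h' hxA⟩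
  obtain ⟨_, ⟨s, hs, rfl⟩, hz⟩ := hfr
  refine ⟨⟨_, hz⟩, (Metric.infDist_le_dist_of_mem hz).trans ?_⟩
  have h3 := dist_smul_left 1 s x
  rw [one_smul] at h3
  refine h3.trans (mul_le_mul_of_nonneg_right ?_ (by positivity))
  have h4 : ((s : ℝ)) ∈ Set.uIcc (1 : ℝ) (t : ℝ)⁻¹ := by
    rw [Set.mem_uIcc] at hs ⊢
    rcases hs with ⟨a, b⟩ | ⟨a, b⟩
    · exact Or.inl ⟨by exact_mod_cast a, by exact_mod_cast b⟩
    · exact Or.inr ⟨by exact_mod_cast a, by exact_mod_cast b⟩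
  rw [dist_comm, NNReal.dist_eq, NNReal.coe_one]
  exact Set.abs_sub_left_of_mem_uIcc h4

/-- A continuous function vanishing only on the boundary of `A` that controls the symmetric
difference of `A` and its dilations. -/
lemma exists_gauge {A : Set (Orthant d)} {ε : ℝ≥0} (hε : 0 < ε) (hA : A ⊆ {x | ε ≤ supNorm x}) :
    ∃ g : Orthant d → ℝ, Continuous g ∧ (∀ x, 0 ≤ g x) ∧ {x | g x = 0} ⊆ frontier A ∧
      (∃ δ₀ > 0, {x | g x ≤ δ₀} ⊆ {x | ε / 2 ≤ supNorm x}) ∧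
      ∀ t : ℝ≥0, t ≠ 0 → ∀ x, ¬ (x ∈ t • A ↔ x ∈ A) → g x ≤ |(t : ℝ)⁻¹ - 1| := by
  rcases (frontier A).eq_empty_or_nonempty with hZ | hZ
  · refine ⟨fun _ => 1, continuous_const, fun _ => zero_le_one, by simp, ⟨1 / 2, by norm_num, ?_⟩,
      fun t ht x hx => ?_⟩
    · intro x hx
      norm_num at hx
    · exact absurd (infDist_frontier_le ht hx).1 (by simp [hZ])
  have hfr : ∀ z ∈ frontier A, ε ≤ supNorm z := by
    intro z hz
    have : IsClosed {x : Orthant d | ε ≤ supNorm x} :=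
      isClosed_le continuous_const continuous_supNorm
    exact this.closure_subset_iff.2 hA hz.1
  have hpos : ∀ x : Orthant d, (0 : ℝ) < 1 + supNorm x := fun x => by positivity
  -- A dilation moves `x` by an amount proportional to `‖x‖_∞`; the denominator makes the bound
  -- uniform over an unbounded set.
  refine ⟨fun x => Metric.infDist x (frontier A) / (1 + supNorm x), ?_, fun x => ?_, ?_, ?_, ?_⟩
  · refine (Metric.continuous_infDist_pt _).div ?_ fun x => (hpos x).ne'
    exact continuous_const.add (NNReal.continuous_coe.comp continuous_supNorm)
  · exact div_nonneg Metric.infDist_nonneg (hpos x).le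
  · intro x hx
    have h1 : Metric.infDist x (frontier A) = 0 := by
      have h2 : Metric.infDist x (frontier A) / (1 + supNorm x) = 0 := hx
      exact (div_eq_zero_iff.1 h2).resolve_right (hpos x).ne'
    exact (isClosed_frontier.mem_iff_infDist_zero hZ).2 h1
  · have hε' : (0 : ℝ) < ε := hε
    -- If `‖x‖_∞ < ε / 2`, then `x` is farther than `ε / 2` from `∂A`, while this `δ₀` would allow a
    -- distance below `ε / 2`.
    refine ⟨(ε / 2) / (1 + ε / 2), by positivity, fun x hx => ?_⟩
    have h1 : Metric.infDist x (frontier A) ≤ (ε / 2) / (1 + ε / 2) * (1 + supNorm x) :=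
      (div_le_iff₀ (hpos x)).1 hx
    have h2 : (ε : ℝ) - supNorm x ≤ Metric.infDist x (frontier A) := by
      refine (Metric.le_infDist hZ).2 fun z hz => ?_
      have h3 := supNorm_le_add_dist z x
      have h4 : (ε : ℝ) ≤ supNorm z := by exact_mod_cast hfr z hz
      rw [dist_comm] at h3
      linarith
    by_contra hlt
    have hlt' : (supNorm x : ℝ) < ε / 2 := by
      have : supNorm x < ε / 2 := not_le.1 hlt
      exact_mod_cast this
    have h5 : (ε / 2 : ℝ) / (1 + ε / 2) * (1 + supNorm x) < (ε / 2) / (1 + ε / 2) * (1 + ε / 2) := by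
      gcongr
    rw [div_mul_cancel₀ _ (by positivity)] at h5
    linarith
  · intro t ht x hx
    rw [div_le_iff₀ (hpos x)]
    refine (infDist_frontier_le ht hx).2.trans ?_
    gcongr
    linarith

end Neighbourhood

end KLExtremes
end

/-! ### The deterministic half: bias uniform over dilations. -/

noncomputable section
namespace KLExtremes

variable {d : ℕ}

lemma abs_inv_sub_one_le {t : ℝ} (ht : 1 / 2 ≤ t) {δ : ℝ} (h : |t - 1| ≤ δ / 2) :
    |t⁻¹ - 1| ≤ δ := by
  have h0 : 0 < t := by linarith
  have : t⁻¹ - 1 = -(t - 1) / t := by field_simp; ring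
  rw [this, abs_div, abs_neg, abs_of_pos h0, div_le_iff₀ h0]
  nlinarith [abs_nonneg (t - 1)]

/-- `Λ` approximates the rescaled law `(n / k) P(X ∈ v_n ·)` on `{c ≤ ‖x‖_∞}` at a rate faster than
`√k`, and is homogeneous of order `-1` there. -/
structure TailApproximation (μ : Measure (Orthant d)) (k : ℕ → ℕ) (v : ℕ → ℝ≥0)
    (Λ : Measure (Orthant d)) (c : ℝ≥0) : Prop where
  k_atTop : Tendsto k atTop atTop
  k_div : Tendsto (fun n => (k n : ℝ) / (n : ℝ)) atTop (𝓝 0)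
  ne_zero : ∀ n, v n ≠ 0
  rate : ∀ B, MeasurableSet B → B ⊆ {x | c ≤ supNorm x} → Λ (frontier B) = 0 →
    Tendsto (fun n : ℕ => √(k n : ℝ) * (n / k n * μ.real (v n • B) - Λ.real B)) atTop (𝓝 0)
  smul : ∀ t : ℝ≥0, t ≠ 0 → ∀ B, MeasurableSet B → B ⊆ {x | c ≤ supNorm x} →
    t • B ⊆ {x | c ≤ supNorm x} → Λ.real (t • B) = Λ.real B / t

namespace TailApproximation

variable {μ Λ : Measure (Orthant d)} {k : ℕ → ℕ} {v : ℕ → ℝ≥0} {c : ℝ≥0}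

lemma tendsto_sqrt (h : TailApproximation μ k v Λ c) :
    Tendsto (fun n => √(k n : ℝ)) atTop atTop :=
  Real.tendsto_sqrt_atTop.comp (tendsto_natCast_atTop_atTop.comp h.k_atTop)

lemma tendsto (h : TailApproximation μ k v Λ c) {B : Set (Orthant d)} (hB : MeasurableSet B)
    (hBc : B ⊆ {x | c ≤ supNorm x}) (hBf : Λ (frontier B) = 0) :
    Tendsto (fun n : ℕ => n / k n * μ.real (v n • B)) atTop (𝓝 (Λ.real B)) := by
  have h1 := (h.rate B hB hBc hBf).mul (tendsto_inv_atTop_zero.comp h.tendsto_sqrt)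
  rw [mul_zero] at h1
  have h2 := h1.add_const (Λ.real B)
  rw [zero_add] at h2
  refine h2.congr' ?_
  filter_upwards [h.tendsto_sqrt.eventually_gt_atTop 0] with n hn
  simp only [Function.comp_apply]
  field_simp
  ring

lemma subset_of_subset {A : Set (Orthant d)}
    (hA : A ⊆ {x | 2 * c ≤ supNorm x}) : A ⊆ {x | c ≤ supNorm x} := fun x hx =>
  le_trans (le_mul_of_one_le_left zero_le one_le_two) (show 2 * c ≤ supNorm x from hA hx)

lemma subset_of_half_le {t : ℝ≥0} (ht : 1 / 2 ≤ t) {A : Set (Orthant d)}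
    (hA : A ⊆ {x | 2 * c ≤ supNorm x}) : t • A ⊆ {x | c ≤ supNorm x} := by
  rintro _ ⟨x, hx, rfl⟩
  simp only [Set.mem_ofPred_eq, supNorm_smul]
  calc c = 1 / 2 * (2 * c) := by rw [← mul_assoc]; norm_num
    _ ≤ t * supNorm x := mul_le_mul' ht (hA hx)

lemma measure_frontier_smul [IsFiniteMeasure Λ] (h : TailApproximation μ k v Λ c) {t : ℝ≥0}
    (ht : 1 / 2 ≤ t) {A : Set (Orthant d)} (hA : A ⊆ {x | 2 * c ≤ supNorm x})
    (hAf : Λ (frontier A) = 0) : Λ (frontier (t • A)) = 0 := by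
  have ht0 : t ≠ 0 := by rintro rfl; norm_num at ht
  have hcl : IsClosed {x : Orthant d | 2 * c ≤ supNorm x} :=
    isClosed_le continuous_const continuous_supNorm
  have hfr : frontier A ⊆ {x | 2 * c ≤ supNorm x} :=
    frontier_subset_closure.trans (closure_minimal hA hcl)
  have h1 := h.smul t ht0 (frontier A) isClosed_frontier.measurableSet
    (subset_of_subset hfr)
    (subset_of_half_le ht hfr)
  rw [frontier_smul_set ht0, ← measureReal_eq_zero_iff, h1, measureReal_def, hAf]
  simp

/-- The deviation of the rescaled law from `Λ` is `o(1 / √k)` uniformly over dilations of a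
continuity set by factors close to `1`. -/
theorem uniform_deviation_smul [IsFiniteMeasure μ] [IsFiniteMeasure Λ]
    (h : TailApproximation μ k v Λ c) (hc : 0 < c)
    {A : Set (Orthant d)} (hAm : MeasurableSet A) (hA : A ⊆ {x | 2 * c ≤ supNorm x})
    (hAf : Λ (frontier A) = 0) {η : ℝ} (hη : 0 < η) :
    ∃ δ > 0, ∀ᶠ n : ℕ in atTop, ∀ t : ℝ≥0, |(t : ℝ) - 1| ≤ δ →
      |√(k n : ℝ) * (n / k n * μ.real (v n • t • A) - Λ.real A / t)| ≤ η := by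
  obtain ⟨g, hg, hg0, hgz, ⟨δ₀, hδ₀, hW⟩, hgt⟩ := exists_gauge (mul_pos two_pos hc) hA
  rw [mul_div_cancel_left₀ c two_ne_zero] at hW
  have hAc : A ⊆ {x | c ≤ supNorm x} := subset_of_subset hA
  set κ : ℕ → Measure (Orthant d) := fun n =>
    ((n : ℝ≥0) / (k n : ℝ≥0)) • μ.map fun x => (v n)⁻¹ • x with hκ
  have hκr : ∀ n B, MeasurableSet B → (κ n).real B = n / k n * μ.real (v n • B) := by
    intro n B hB
    rw [hκ, measureReal_def, Measure.smul_apply, map_inv_smul_apply μ (h.ne_zero n) hB,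
      ENNReal.smul_def, smul_eq_mul, ENNReal.toReal_mul, ENNReal.coe_toReal, ← measureReal_def]
    push_cast
    rfl
  obtain ⟨δ₁, hδ₁, hdev⟩ := uniform_deviation_near_null κ Λ (fun n => √(k n : ℝ))
    (fun n => Real.sqrt_nonneg _) {x | c ≤ supNorm x}
    (fun B hB hBc hBf => by simpa only [hκr _ B hB] using h.rate B hB hBc hBf)
    hg hg0 hδ₀ hW (measure_mono_null hgz hAf) (div_pos hη three_pos)
  -- The bound `1 / 2` keeps `t • A` inside `{c ≤ ‖x‖_∞}`; the bound `δ₁ / 2` gives `|t⁻¹ - 1| ≤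
  -- δ₁`.
  refine ⟨min (1 / 2) (δ₁ / 2), by positivity, ?_⟩
  have hA3 := (h.rate A hAm hAc hAf).eventually (Metric.closedBall_mem_nhds 0 (div_pos hη three_pos))
  filter_upwards [hdev, hA3] with n hn hnA t ht
  rw [Real.dist_0_eq_abs] at hnA
  have ht1 := (abs_le.1 (ht.trans (min_le_left _ _))).1
  have ht2 := ht.trans (min_le_right _ _)
  have hth : (1 / 2 : ℝ≥0) ≤ t := by
    rw [← NNReal.coe_le_coe]; push_cast; linarith
  have ht0 : t ≠ 0 := by rintro rfl; norm_num at hth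
  have htinv := abs_inv_sub_one_le (by linarith) ht2
  have htm := measurableSet_smul hAm ht0
  have htc : t • A ⊆ {x | c ≤ supNorm x} := subset_of_half_le hth hA
  have htf := h.measure_frontier_smul hth hA hAf
  have hd1 := hn (t • A \ A) (htm.diff hAm)
    (fun x hx => (hgt t ht0 x fun hiff => hx.2 (hiff.1 hx.1)).trans htinv)
    (measure_frontier_diff_null htf hAf)
  have hd2 := hn (A \ t • A) (hAm.diff htm)
    (fun x hx => (hgt t ht0 x fun hiff => hx.2 (hiff.2 hx.1)).trans htinv)
    (measure_frontier_diff_null hAf htf)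
  rw [← hκr n A hAm] at hnA
  rw [← hκr n _ htm, ← h.smul t ht0 A hAm hAc htc]
  have e1 := measureReal_sdiff_add_inter (μ := κ n) (s := t • A) hAm
  have e2 := measureReal_sdiff_add_inter (μ := κ n) (s := A) htm
  have e3 := measureReal_sdiff_add_inter (μ := Λ) (s := t • A) hAm
  have e4 := measureReal_sdiff_add_inter (μ := Λ) (s := A) htm
  rw [Set.inter_comm] at e2 e4
  -- The deviation of `t • A` is that of `A` corrected by two difference sets near `∂A`; each of the
  -- three terms is at most `η / 3`.
  have key : √(k n : ℝ) * ((κ n).real (t • A) - Λ.real (t • A)) =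
      √(k n : ℝ) * ((κ n).real A - Λ.real A) +
      √(k n : ℝ) * ((κ n).real (t • A \ A) - Λ.real (t • A \ A)) -
      √(k n : ℝ) * ((κ n).real (A \ t • A) - Λ.real (A \ t • A)) := by
    rw [← e1, ← e3, ← e2, ← e4]; ring
  rw [key]
  rw [abs_le] at *
  constructor <;> linarith [hd1.1, hd1.2, hd2.1, hd2.2, hnA.1, hnA.2]

end TailApproximation

end KLExtremes
end

/-! ### The random half: asymptotic equicontinuity. -/

noncomputable section
namespace KLExtremes

section Linear

variable {Ω E : Type*} [MeasurableSpace E] {X : ℕ → Ω → E} {μ : Measure E}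

lemma centredCount_sub_eq_sum [IsFiniteMeasure μ] {m : ℕ} {S T : Set E} {U V : Fin m → Set E}
    {c : Fin m → ℝ} (hS : MeasurableSet S) (hT : MeasurableSet T) (hU : ∀ i, MeasurableSet (U i))
    (hV : ∀ i, MeasurableSet (V i))
    (h : ∀ x, S.indicator (1 : E → ℝ) x - T.indicator 1 x =
      ∑ i, c i * ((U i).indicator 1 x - (V i).indicator 1 x)) (n : ℕ) (ω : Ω) :
    centredCount μ X n S ω - centredCount μ X n T ω =
      ∑ i, c i * (centredCount μ X n (U i) ω - centredCount μ X n (V i) ω) := by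
  have hint : ∀ {B : Set E}, MeasurableSet B → Integrable (B.indicator (1 : E → ℝ)) μ :=
    fun hB => (integrable_const 1).indicator hB
  have hμ : μ.real S - μ.real T = ∑ i, c i * (μ.real (U i) - μ.real (V i)) := by
    have h1 : ∫ x, (S.indicator (1 : E → ℝ) x - T.indicator 1 x) ∂μ =
        ∫ x, ∑ i, c i * ((U i).indicator 1 x - (V i).indicator 1 x) ∂μ :=
      integral_congr_ae (ae_of_all _ h)
    have h2 : ∀ i ∈ Finset.univ,
        Integrable (fun x => c i * ((U i).indicator (1 : E → ℝ) x - (V i).indicator 1 x)) μ :=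
      fun i _ => ((hint (hU i)).sub (hint (hV i))).const_mul (c i)
    rw [integral_sub (hint hS) (hint hT), integral_indicator_one hS, integral_indicator_one hT,
      integral_finsetSum _ h2] at h1
    rw [h1]
    refine Finset.sum_congr rfl fun i _ => ?_
    rw [integral_const_mul, integral_sub (hint (hU i)) (hint (hV i)),
      integral_indicator_one (hU i), integral_indicator_one (hV i)]
  simp only [centredCount, ← Finset.sum_sub_distrib, Finset.mul_sum]
  rw [Finset.sum_comm]
  refine Finset.sum_congr rfl fun l _ => ?_
  have h2 := h (X l ω)
  calc _ = (S.indicator (1 : E → ℝ) (X l ω) - T.indicator 1 (X l ω)) -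
        (μ.real S - μ.real T) := by ring
    _ = _ := by
      rw [h2, hμ, ← Finset.sum_sub_distrib]
      exact Finset.sum_congr rfl fun i _ => by ring

end Linear

variable {d : ℕ} {Ω : Type*} [MeasurableSpace Ω] {P : Measure Ω} [IsProbabilityMeasure P]
  {X : ℕ → Ω → Orthant d} {μ Λ : Measure (Orthant d)} [IsProbabilityMeasure μ]
  {k : ℕ → ℕ} {v : ℕ → ℝ≥0} {c : ℝ≥0} {r : Orthant d → ℝ≥0}

/-- The traces on `V` of the dilations of a stable set form a chain. Truncating the factor at `1 /
2` extends the chain monotonically to all indices in `[0, ∞)`. -/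
lemma maximal_inequality_smul (hX : ∀ i, Measurable (X i)) (hlaw : ∀ i, P.map (X i) = μ)
    (hind : iIndepFun X P) {B V : Set (Orthant d)} (hB : B ∈ stableSets r) (hV : MeasurableSet V)
    {w : ℝ≥0} (hw : w ≠ 0) (hhalf : μ.real (w • V) ≤ 1 / 2) (n : ℕ) {l : ℝ} (hl : 0 < l) :
    P {ω | ∃ t : ℝ≥0, 1 / 2 ≤ t ∧ l < |centredCount μ X n (w • (t • B ∩ V)) ω|} ≤
      ENNReal.ofReal (2 * √(n * μ.real (w • V)) / l) := by
  set C : ℝ≥0 → Set (Orthant d) := fun t => w • (max t (1 / 2) • B ∩ V) with hC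
  have hpos : ∀ t : ℝ≥0, max t (1 / 2) ≠ 0 := fun t =>
    (lt_max_of_lt_right (by norm_num : (0 : ℝ≥0) < 1 / 2)).ne'
  refine (measure_mono ?_).trans (maximal_inequality (C := C) (D := w • V) hX hlaw hind
    (fun t => measurableSet_smul ((measurableSet_smul hB.1 (hpos t)).inter hV) hw)
    (fun s t hst => Set.smul_set_mono (Set.inter_subset_inter_left _
      (smul_subset_smul_of_mem_stableSets hB (hpos s) (max_le_max_right _ hst))))
    (fun t => Set.smul_set_mono Set.inter_subset_right) hhalf n hl)
  rintro ω ⟨t, ht, hlt⟩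
  refine ⟨t, ?_⟩
  simp only [hC]
  rwa [max_eq_left ht]

namespace TailApproximation

/-- Asymptotic equicontinuity, under dilations, of the empirical process of the exceedances. -/
theorem equicontinuous [IsFiniteMeasure Λ] (h : TailApproximation μ k v Λ c) (hc : 0 < c)
    (hX : ∀ i, Measurable (X i)) (hlaw : ∀ i, P.map (X i) = μ) (hind : iIndepFun X P)
    (hr : IsRiskFunctional r) {A : Set (Orthant d)}
    (hAalg : A ∈ generateSetAlgebra (stableSets r)) (hAr : A ⊆ exceedanceSet r)
    (hA : A ⊆ {x | 2 * c ≤ supNorm x}) (hAf : Λ (frontier A) = 0) {η : ℝ} (hη : 0 < η) :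
    ∃ δ > 0, ∀ᶠ n : ℕ in atTop, P {ω | ∃ t : ℝ≥0, |(t : ℝ) - 1| ≤ δ ∧
      η * √(k n : ℝ) < |centredCount μ X n (v n • t • A) ω - centredCount μ X n (v n • A) ω|} ≤
      ENNReal.ofReal η := by
  obtain ⟨g, hg, hg0, hgz, ⟨δ₀, hδ₀, hW⟩, hgt⟩ := exists_gauge (mul_pos two_pos hc) hA
  rw [mul_div_cancel_left₀ c two_ne_zero] at hW
  have hAm := measurableSet_of_mem_generateSetAlgebra hAalg
  obtain ⟨m, a, B, hB, hAB⟩ := exists_indicator_eq_sum hr hAalg hAr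
  set S : ℝ := ∑ i, |a i| + 1 with hS
  have hSpos : 0 < S := by positivity
  -- Chosen so that each maximal inequality, with `√(n μ(v_n V)) ≤ τ √k` and level `l` below, gives
  -- `2 τ √k / l = η / (m + 1)`.
  set τ : ℝ := η ^ 2 / (4 * S * (m + 1)) with hτ
  have hτpos : 0 < τ := by positivity
  obtain ⟨δ', hδ', hδ'0, hVs, hVf⟩ := exists_small_null_level Λ Λ hg.measurable hδ₀
    (show 0 < τ ^ 2 by positivity)
  set V : Set (Orthant d) := {x | g x ≤ δ'} with hV
  have hVm : MeasurableSet V := measurableSet_le hg.measurable measurable_const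
  have hVW : V ⊆ {x | c ≤ supNorm x} := fun x hx => hW (le_trans hx hδ'0.le)
  have hVfr : Λ (frontier V) = 0 :=
    measure_mono_null (frontier_le_subset_eq hg continuous_const) hVf
  have hVΛ : Λ.real V < τ ^ 2 := by
    have : V = {x | g x = 0} ∪ {x | 0 < g x ∧ g x ≤ δ'} := by
      ext x
      simp only [hV, Set.mem_ofPred_eq, Set.mem_union]
      constructor
      · intro hx
        exact (hg0 x).eq_or_lt.imp Eq.symm fun h0 => ⟨h0, hx⟩
      · rintro (hx | hx)
        · rw [hx]; exact hδ'.le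
        · exact hx.2
    rw [this, measureReal_def, measure_null_union (measure_mono_null hgz hAf)]
    exact hVs
  refine ⟨min (1 / 2) (δ' / 2), by positivity, ?_⟩
  have hV1 := (h.tendsto hVm hVW hVfr).eventually_lt_const hVΛ
  have hV2 : Tendsto (fun n => τ ^ 2 * ((k n : ℝ) / n)) atTop (𝓝 0) := by
    simpa using h.k_div.const_mul (τ ^ 2)
  filter_upwards [hV1, hV2.eventually_lt_const (show (0 : ℝ) < 1 / 2 by norm_num),
    h.k_atTop.eventually_gt_atTop 0, eventually_gt_atTop 0] with n hn1 hn2 hkn hn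
  have hk0 : (0 : ℝ) < k n := by exact_mod_cast hkn
  have hn0 : (0 : ℝ) < n := by exact_mod_cast hn
  have hVn : n * μ.real (v n • V) ≤ τ ^ 2 * k n := by
    have := mul_le_mul_of_nonneg_right hn1.le hk0.le
    calc _ = n / k n * μ.real (v n • V) * k n := by field_simp
      _ ≤ _ := this
  have hhalf : μ.real (v n • V) ≤ 1 / 2 := by
    refine le_trans ?_ hn2.le
    rw [← mul_div_assoc, le_div_iff₀ hn0]
    linarith
  have hsk : 0 < √(k n : ℝ) := Real.sqrt_pos.2 hk0
  -- Each index contributes `|a i|` times a difference of two centred counts of size at most `l`,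
  -- and `S * (2 * l) = η √k`.
  set l : ℝ := η * √(k n : ℝ) / (2 * S) with hl
  have hlpos : 0 < l := by positivity
  have hbd : ∀ i, P {ω | ∃ t : ℝ≥0, 1 / 2 ≤ t ∧
      l < |centredCount μ X n (v n • (t • B i ∩ V)) ω|} ≤ ENNReal.ofReal (η / (m + 1)) := by
    intro i
    refine (maximal_inequality_smul hX hlaw hind (hB i) hVm (h.ne_zero n) hhalf n hlpos).trans
      (ENNReal.ofReal_le_ofReal ?_)
    have h1 : √(n * μ.real (v n • V)) ≤ τ * √(k n : ℝ) := by
      refine (Real.sqrt_le_sqrt hVn).trans_eq ?_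
      rw [Real.sqrt_mul (by positivity), Real.sqrt_sq hτpos.le]
    rw [div_le_iff₀ hlpos]
    refine (mul_le_mul_of_nonneg_left h1 two_pos.le).trans_eq ?_
    rw [hl, hτ]
    field_simp
    norm_num
  have hsub : {ω | ∃ t : ℝ≥0, |(t : ℝ) - 1| ≤ min (1 / 2) (δ' / 2) ∧ η * √(k n : ℝ) <
      |centredCount μ X n (v n • t • A) ω - centredCount μ X n (v n • A) ω|} ⊆
      ⋃ i, {ω | ∃ t : ℝ≥0, 1 / 2 ≤ t ∧ l < |centredCount μ X n (v n • (t • B i ∩ V)) ω|} := by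
    rintro ω ⟨t, ht, hlt⟩
    by_contra hcon
    simp only [Set.mem_iUnion, Set.mem_ofPred_eq, not_exists, not_and, not_lt] at hcon
    have hth' : (1 / 2 : ℝ) ≤ t := by
      have := (abs_le.1 (ht.trans (min_le_left _ _))).1
      linarith
    have hth : (1 / 2 : ℝ≥0) ≤ t := by rw [← NNReal.coe_le_coe]; push_cast; exact hth'
    have ht0 : t ≠ 0 := by rintro rfl; norm_num at hth
    have htinv := abs_inv_sub_one_le hth' (ht.trans (min_le_right _ _))
    have hsm : ∀ {D : Set (Orthant d)}, MeasurableSet D → MeasurableSet (v n • D) := fun hD =>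
      measurableSet_smul hD (h.ne_zero n)
    have hindv : ∀ (w : ℝ≥0) (hw : w ≠ 0) (D : Set (Orthant d)) (x : Orthant d),
        (w • D).indicator (1 : Orthant d → ℝ) x = D.indicator 1 (w⁻¹ • x) := by
      intro w hw D x
      by_cases hx : w⁻¹ • x ∈ D <;> simp [hx, mem_smul_set_iff hw]
    -- Off the neighbourhood `V` of `∂A` both sides vanish. Cutting the stable sets down to `V` thus
    -- loses nothing and makes the masses in the maximal inequality small.
    have hpt : ∀ x, (v n • t • A).indicator (1 : Orthant d → ℝ) x -
        (v n • A).indicator 1 x = ∑ i, a i * ((v n • (t • B i ∩ V)).indicator 1 x -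
          (v n • ((1 : ℝ≥0) • B i ∩ V)).indicator 1 x) := by
      intro x
      simp only [hindv _ (h.ne_zero n), one_smul]
      generalize (v n)⁻¹ • x = y
      by_cases hy : y ∈ V
      · have h1 : ∀ D : Set (Orthant d), (D ∩ V).indicator (1 : Orthant d → ℝ) y =
            D.indicator 1 y := fun D => by by_cases hD : y ∈ D <;> simp [hD, hy]
        simp only [h1, hindv t ht0, hAB, mul_sub, Finset.sum_sub_distrib]
      · have h1 : ∀ D : Set (Orthant d), (D ∩ V).indicator (1 : Orthant d → ℝ) y = 0 :=
          fun D => by simp [hy]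
        have h2 : y ∈ t • A ↔ y ∈ A := by
          by_contra hiff
          exact hy ((hgt t ht0 y hiff).trans htinv)
        by_cases hyA : y ∈ A <;> simp [h1, h2, hyA]
    rw [centredCount_sub_eq_sum (hsm (measurableSet_smul hAm ht0)) (hsm hAm)
      (fun i => hsm ((measurableSet_smul (hB i).1 ht0).inter hVm))
      (fun i => hsm ((measurableSet_smul (hB i).1 one_ne_zero).inter hVm)) hpt] at hlt
    refine hlt.not_ge ((Finset.abs_sum_le_sum_abs _ _).trans ?_)
    calc _ ≤ ∑ i, |a i| * (2 * l) := by
          refine Finset.sum_le_sum fun i _ => ?_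
          rw [abs_mul]
          refine mul_le_mul_of_nonneg_left ((abs_sub _ _).trans ?_) (abs_nonneg _)
          have h1 := hcon i t hth
          have h2 := hcon i 1 (by norm_num)
          linarith
      _ = (∑ i, |a i|) * (2 * l) := (Finset.sum_mul _ _ _).symm
      _ ≤ S * (2 * l) := by gcongr; linarith
      _ = _ := by rw [hl]; field_simp
  refine (measure_mono hsub).trans ((measure_iUnion_le _).trans ?_)
  rw [tsum_fintype]
  refine (Finset.sum_le_sum fun i _ => hbd i).trans ?_
  rw [← ENNReal.ofReal_sum_of_nonneg fun i _ => by positivity]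
  refine ENNReal.ofReal_le_ofReal ?_
  rw [Finset.sum_const, Finset.card_univ, Fintype.card_fin, nsmul_eq_mul, ← mul_div_assoc,
    div_le_iff₀ (by positivity)]
  nlinarith

end TailApproximation

end KLExtremes
end

/-! ### The tail quantile and the approximation on its scale. -/

noncomputable section
namespace KLExtremes

section Quantile

variable {d : ℕ} {μ ν : Measure (Orthant d)} {a : ℝ≥0 → ℝ}

lemma IsExceedanceDistribution.nonempty (h : IsExceedanceDistribution μ ν) : Nonempty (Fin d) := by
  obtain ⟨x, hx⟩ := h.exists_supNorm_eq 1
  by_contra hd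
  rw [not_nonempty_iff] at hd
  simp [supNorm] at hx

lemma lt_supNorm_iff {u : ℝ≥0} {x : Orthant d} : u < supNorm x ↔ ∃ j, u < x j := by
  simp [supNorm, Finset.lt_sup_iff]

lemma HasParetoMargins.one_div_le [IsFiniteMeasure μ] (h : HasParetoMargins μ) (j : Fin d)
    {u : ℝ≥0} (hu : 1 ≤ u) : 1 / (u : ℝ) ≤ μ.real {x | u < supNorm x} := by
  rw [← h j u hu]
  exact measureReal_mono fun x hx => lt_supNorm_iff.2 ⟨j, hx⟩

lemma HasParetoMargins.le_div [IsFiniteMeasure μ] (h : HasParetoMargins μ) {u : ℝ≥0}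
    (hu : 1 ≤ u) : μ.real {x | u < supNorm x} ≤ d / u := by
  have h1 : {x : Orthant d | u < supNorm x} = ⋃ j, {x | u < x j} := by
    ext x; simp [lt_supNorm_iff]
  rw [h1]
  refine (measureReal_iUnion_fintype_le _).trans_eq ?_
  simp [h _ u hu, div_eq_mul_inv]

/-- If the norm lies in `(s, u]`, then so does some coordinate; a union bound transfers continuity
from the margins to the norm. -/
lemma HasParetoMargins.sub_le [IsFiniteMeasure μ] (h : HasParetoMargins μ) {s u : ℝ≥0}
    (hs : 1 ≤ s) (hsu : s ≤ u) :
    μ.real {x | s < supNorm x} - μ.real {x | u < supNorm x} ≤ d * (1 / (s : ℝ) - 1 / u) := by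
  have h1 : {x : Orthant d | s < supNorm x} \ {x | u < supNorm x} ⊆
      ⋃ j, {x | s < x j} \ {x | u < x j} := by
    rintro x ⟨hx1, hx2⟩
    obtain ⟨j, hj⟩ := lt_supNorm_iff.1 hx1
    exact Set.mem_iUnion.2 ⟨j, hj, fun hx => hx2 (lt_supNorm_iff.2 ⟨j, hx⟩)⟩
  have h0 : {x : Orthant d | u < supNorm x} ⊆ {x | s < supNorm x} := fun x hx => hsu.trans_lt hx
  rw [← measureReal_sdiff h0 (measurableSet_lt measurable_const measurable_supNorm)]
  refine (measureReal_mono h1).trans ((measureReal_iUnion_fintype_le _).trans_eq ?_)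
  have h2 : ∀ j : Fin d, μ.real ({x | s < x j} \ {x | u < x j}) = 1 / (s : ℝ) - 1 / u := by
    intro j
    have h3 : {x : Orthant d | u < x j} ⊆ {x | s < x j} := fun x hx => hsu.trans_lt hx
    rw [measureReal_sdiff h3
      (measurableSet_lt measurable_const (measurable_pi_apply j)), h j s hs, h j u (hs.trans hsu)]
  simp [h2, mul_sub]

lemma HasParetoMargins.continuous [IsFiniteMeasure μ] (h : HasParetoMargins μ) :
    Continuous fun u : ℝ≥0 => μ.real {x : Orthant d | max u 1 < supNorm x} := by
  have hle : ∀ s u : ℝ≥0, dist (μ.real {x : Orthant d | max s 1 < supNorm x})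
      (μ.real {x : Orthant d | max u 1 < supNorm x}) ≤
      d * |1 / ((max s 1 : ℝ≥0) : ℝ) - 1 / ((max u 1 : ℝ≥0) : ℝ)| := by
    have key : ∀ s u : ℝ≥0, s ≤ u → dist (μ.real {x : Orthant d | max s 1 < supNorm x})
      (μ.real {x : Orthant d | max u 1 < supNorm x}) ≤
      d * |1 / ((max s 1 : ℝ≥0) : ℝ) - 1 / ((max u 1 : ℝ≥0) : ℝ)| := by
      intro s u hsu
      have hm : max s 1 ≤ max u 1 := max_le_max_right _ hsu
      have h1 := h.sub_le (le_max_right s 1) hm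
      have h0 : {x : Orthant d | max u 1 < supNorm x} ⊆ {x | max s 1 < supNorm x} :=
        fun x hx => hm.trans_lt hx
      rw [Real.dist_eq, abs_of_nonneg (sub_nonneg.2 (measureReal_mono h0))]
      exact h1.trans (mul_le_mul_of_nonneg_left (le_abs_self _) (by positivity))
    intro s u
    rcases le_total s u with hsu | hsu
    · exact key s u hsu
    · rw [dist_comm, abs_sub_comm]
      exact key u s hsu
  refine continuous_iff_continuousAt.2 fun u => ?_
  refine tendsto_iff_dist_tendsto_zero.2 (squeeze_zero (fun _ => dist_nonneg) (fun s => hle s u) ?_)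
  have h1 : Continuous fun s : ℝ≥0 =>
      d * |1 / ((max s 1 : ℝ≥0) : ℝ) - 1 / ((max u 1 : ℝ≥0) : ℝ)| := by
    refine continuous_const.mul ((Continuous.sub (Continuous.div continuous_const (by fun_prop)
      fun s => ?_) continuous_const).abs)
    have : 0 < max s 1 := lt_max_of_lt_right one_pos
    positivity
  simpa using h1.tendsto u

/-- Continuity of the tail gives attainment by the intermediate value theorem, so `n / k` is exactly
the reciprocal of the exceedance probability at the quantile. The lower bound from one margin sends
the quantile to infinity. -/
lemma HasParetoMargins.tailQuantile_spec [IsProbabilityMeasure μ] (h : HasParetoMargins μ)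
    (j : Fin d) {t : ℝ} (ht : 1 < t) :
    μ.real {x | tailQuantile μ t < supNorm x} = 1 / t ∧ t ≤ tailQuantile μ t := by
  have ht0 : 0 < t := by linarith
  set S : Set ℝ≥0 := {u | μ.real {x | u < supNorm x} ≤ 1 / t} with hS
  have hone : μ.real {x : Orthant d | 1 < supNorm x} = 1 :=
    le_antisymm measureReal_le_one (by simpa using h.one_div_le j le_rfl)
  have hSge : ∀ u ∈ S, 1 ≤ u := by
    intro u hu
    by_contra hlt
    have h1 : μ.real {x : Orthant d | 1 < supNorm x} ≤ μ.real {x | u < supNorm x} :=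
      measureReal_mono fun x hx => (not_le.1 hlt).trans hx
    have h2 : 1 / t < 1 := (div_lt_one ht0).2 ht
    have h3 : μ.real {x | u < supNorm x} ≤ 1 / t := hu
    linarith
  obtain ⟨u₀, hu₀⟩ : ∃ u₀ : ℝ≥0, μ.real {x : Orthant d | max u₀ 1 < supNorm x} = 1 / t := by
    refine mem_range_of_exists_le_of_exists_ge h.continuous ?_ ⟨1, ?_⟩
    · obtain ⟨b, hb⟩ : ∃ b : ℝ≥0, (b : ℝ) = (d + 1) * t :=
        ⟨_, Real.coe_toNNReal _ (by positivity)⟩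
      refine ⟨b, (h.le_div (le_max_right _ _)).trans ?_⟩
      have h1 : (d + 1) * t ≤ (max b 1 : ℝ≥0) := by
        rw [← hb]; exact NNReal.coe_le_coe.2 (le_max_left _ _)
      rw [div_le_div_iff₀ (lt_of_lt_of_le (by positivity) h1) ht0]
      nlinarith
    · rw [max_self, hone]
      exact ((div_lt_one ht0).2 ht).le
  have hSeq : S = {u | 1 ≤ u} ∩ {u | μ.real {x : Orthant d | max u 1 < supNorm x} ≤ 1 / t} := by
    ext u
    constructor
    · intro hu
      refine ⟨hSge u hu, ?_⟩
      rw [Set.mem_ofPred_eq, max_eq_left (hSge u hu)]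
      exact hu
    · rintro ⟨hu1, hu⟩
      rw [Set.mem_ofPred_eq, max_eq_left hu1] at hu
      exact hu
  have hScl : IsClosed S := by
    rw [hSeq]
    exact (isClosed_le continuous_const continuous_id).inter
      (isClosed_le h.continuous continuous_const)
  have hmem : max u₀ 1 ∈ S := hu₀.le
  have hU : tailQuantile μ t ∈ S := hScl.csInf_mem ⟨_, hmem⟩ (OrderBot.bddBelow _)
  have hUle : tailQuantile μ t ≤ max u₀ 1 := csInf_le (OrderBot.bddBelow _) hmem
  have heq : μ.real {x | tailQuantile μ t < supNorm x} = 1 / t := by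
    refine le_antisymm hU ?_
    rw [← hu₀]
    exact measureReal_mono fun x hx => hUle.trans_lt hx
  refine ⟨heq, ?_⟩
  have h1 := h.one_div_le j (hSge _ hU)
  rw [heq] at h1
  have h2 : (0 : ℝ) < tailQuantile μ t := zero_lt_one.trans_le (hSge _ hU)
  exact (one_div_le_one_div h2 ht0).1 h1

/-- The tail approximation provided by the second-order condition. -/
theorem SecondOrderCondition.tailApproximation [IsProbabilityMeasure μ]
    (hsec : SecondOrderCondition μ ν a) (hmrv : IsExceedanceDistribution μ ν)
    (hp : HasParetoMargins μ) {k : ℕ → ℕ} (hk : Tendsto k atTop atTop)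
    (hkn : Tendsto (fun n => (k n : ℝ) / (n : ℝ)) atTop (𝓝 0))
    (hka : Tendsto (fun n => √(k n : ℝ) * a (tailQuantile μ ((n : ℝ) / (k n : ℝ)))) atTop (𝓝 0))
    {b c : ℝ≥0} (hb : 0 < b) (hc : 0 < c) :
    TailApproximation μ k (fun n => max (tailQuantile μ ((n : ℝ) / (k n : ℝ))) 1 * b)
      (b⁻¹ • tailMeasure ν c) c := by
  have := hmrv.prob
  obtain ⟨j⟩ := hmrv.nonempty
  -- Enlarging the level by `b` divides the exponent measure by `b`; taking `b` as the mass of `Ω_r`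
  -- will give that set limit mass one.
  have hΛ : ∀ B, MeasurableSet B → B ⊆ {x | c ≤ supNorm x} →
      (b⁻¹ • tailMeasure ν c).real B = exponentMeasure ν (b • B) := by
    intro B hB hBc
    rw [exponentMeasure_smul ν hb.ne', exponentMeasure_eq_tailMeasure hmrv hsec hc hB hBc,
      measureReal_nnreal_smul_apply]
    simp [div_eq_inv_mul]
  have hnk : Tendsto (fun n : ℕ => (n : ℝ) / (k n : ℝ)) atTop atTop := by
    have h1 : Tendsto (fun n : ℕ => (k n : ℝ) / (n : ℝ)) atTop (𝓝[>] 0) := by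
      refine tendsto_nhdsWithin_iff.2 ⟨hkn, ?_⟩
      filter_upwards [hk.eventually_gt_atTop 0, eventually_gt_atTop 0] with n h1 h2
      have h3 : (0 : ℝ) < k n := Nat.cast_pos.2 h1
      have h4 : (0 : ℝ) < n := Nat.cast_pos.2 h2
      exact div_pos h3 h4
    refine (tendsto_inv_nhdsGT_zero.comp h1).congr fun n => ?_
    simp
  have hspec : ∀ᶠ n : ℕ in atTop,
      μ.real {x | tailQuantile μ ((n : ℝ) / k n) < supNorm x} = 1 / ((n : ℝ) / k n) ∧
        (n : ℝ) / k n ≤ tailQuantile μ ((n : ℝ) / k n) := by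
    filter_upwards [hnk.eventually_gt_atTop 1] with n hn using hp.tailQuantile_spec j hn
  have hU : Tendsto (fun n : ℕ => tailQuantile μ ((n : ℝ) / k n)) atTop atTop := by
    rw [← NNReal.tendsto_coe_atTop]
    exact tendsto_atTop_mono' _ (hspec.mono fun n hn => hn.2) hnk
  -- The maximum with `1` keeps the level nonzero for every `n` and is eventually inactive.
  refine ⟨hk, hkn, fun n => (mul_pos (lt_max_of_lt_right one_pos) hb).ne', ?_, ?_⟩
  · intro B hB hBc hBf
    have hcl : IsClosed {x : Orthant d | c ≤ supNorm x} :=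
      isClosed_le continuous_const continuous_supNorm
    have hfr : frontier B ⊆ {x | c ≤ supNorm x} :=
      frontier_subset_closure.trans (closure_minimal hBc hcl)
    have h1 := hsec.rate (b • B) (measurableSet_smul hB hb.ne') ⟨b * c, by positivity, ?_⟩ ?_
    · have h2 := (isBigO_refl (fun n : ℕ => √(k n : ℝ)) atTop).mul (h1.comp_tendsto hU)
      refine (h2.trans_tendsto hka).congr' ?_
      filter_upwards [hspec, hU.eventually_ge_atTop 1] with n hn hn1
      simp only [Function.comp_apply]
      rw [max_eq_left hn1, mul_smul, hn.1, hΛ B hB hBc, div_div_eq_mul_div, div_one, mul_comm (_ / _)]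
    · rintro _ ⟨x, hx, rfl⟩
      simp only [supNorm_smul]
      exact mul_le_mul_right (hBc hx) _
    · rw [frontier_smul_set hb.ne', ← hΛ _ isClosed_frontier.measurableSet hfr, measureReal_def, hBf]
      simp
  · intro t ht B hB hBc htB
    rw [measureReal_nnreal_smul_apply, measureReal_nnreal_smul_apply,
      tailMeasure_real_smul hmrv hsec hc ht hB hBc htB, mul_div_assoc]

/-- Limits of conditional probabilities given an exceedance of the risk functional. -/
theorem SecondOrderCondition.tendsto_condProb [IsFiniteMeasure μ]
    (hsec : SecondOrderCondition μ ν a) {r : Orthant d → ℝ≥0} (hr : IsRiskFunctional r)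
    (hpos : 0 < exponentMeasure ν (exceedanceSet r))
    (hf : exponentMeasure ν (frontier (exceedanceSet r)) = 0) {A : Set (Orthant d)}
    (hA : MeasurableSet A) (hAr : A ⊆ exceedanceSet r)
    (hAf : exponentMeasure ν (frontier A) = 0) :
    Tendsto (condProb μ r A) atTop
      (𝓝 (exponentMeasure ν A / exponentMeasure ν (exceedanceSet r))) := by
  obtain ⟨ε, hε, hΩ⟩ := hr.away
  have hΩm : MeasurableSet (exceedanceSet r) := measurableSet_lt measurable_const hr.measurable
  have h1 := hsec.tendsto_ratio hA ⟨ε, hε, fun x hx => hΩ x (hAr hx)⟩ hAf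
  have h2 := hsec.tendsto_ratio hΩm ⟨ε, hε, hΩ⟩ hf
  refine (h1.div h2 hpos.ne').congr' ?_
  filter_upwards [eventually_gt_atTop 0, h2.eventually_const_lt hpos] with u hu hu2
  have h3 : μ.real {x | u < supNorm x} ≠ 0 := by
    intro h3
    simp [h3] at hu2
  rw [condProb, ← hr.smul_exceedanceSet hu.ne', measureReal_def,
    cond_apply (measurableSet_smul hΩm hu.ne'),
    Set.inter_eq_self_of_subset_right (Set.smul_set_mono hAr), Pi.div_apply,
    div_div_div_cancel_right₀ h3, ENNReal.toReal_mul, ENNReal.toReal_inv, div_eq_inv_mul]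
  rfl

end Quantile

end KLExtremes
end

/-! ### Expansion at the random threshold. -/

noncomputable section
namespace KLExtremes

/-- If a count `M` and a count `L` are close to `k / t` and `k p / t` with offsets `z` and `y` on the
scale `√k`, then at the random level `T` determined by `M T ≈ k` the centred count `L T` has offset
`y - p z`. -/
lemma abs_offset_at_threshold_le {k δ η z y p : ℝ} {M L : ℝ≥0 → ℝ} {T : ℝ≥0}
    (hδ : 0 < δ) (hδ1 : δ ≤ 1 / 2) (hk : 0 < k)
    (hM : ∀ t : ℝ≥0, |(t : ℝ) - 1| ≤ δ → |√k * (M t / k - 1 / t) - z| ≤ 2 * η)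
    (hL : ∀ t : ℝ≥0, |(t : ℝ) - 1| ≤ δ → |√k * (L t / k - p / t) - y| ≤ 2 * η)
    (hT : ∀ t : ℝ≥0, t ≠ 0 → (T ≤ t ↔ M t ≤ k))
    (hz : |z| ≤ δ / 8 * √k) (hη : 2 * η ≤ δ / 8 * √k) (hkη : 4 / √k ≤ η) (hkδ : 2 / k ≤ δ)
    (hp : 0 ≤ p) (hp1 : p ≤ 1) :
    |√k * (L T / k - p) - (y - p * z)| ≤ 5 * η := by
  set s := √k with hs
  have hs0 : 0 < s := Real.sqrt_pos.2 hk
  have hss : s * s = k := Real.mul_self_sqrt hk.le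
  have hzl := abs_le.1 hz
  have hη0 : 0 < η := lt_of_lt_of_le (by positivity) hkη
  -- Localisation of `T`: at `1 ± δ / 2` the drift of `1 / t` dominates the offset `z` and the
  -- error, so `M` is on the expected side of `k`.
  have hup : (T : ℝ) ≤ 1 + δ / 2 := by
    obtain ⟨b, hb⟩ : ∃ b : ℝ≥0, (b : ℝ) = 1 + δ / 2 :=
      ⟨_, Real.coe_toNNReal _ (by positivity)⟩
    have hb0 : b ≠ 0 := by
      rw [← NNReal.coe_ne_zero, hb]; positivity
    rw [← hb, NNReal.coe_le_coe, hT _ hb0, ← div_le_one hk]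
    have h1 := (abs_le.1 (hM b (by rw [hb, abs_le]; constructor <;> linarith))).2
    have h2 : (1 : ℝ) / b ≤ 1 - δ / 4 := by
      rw [hb, div_le_iff₀ (by positivity)]; nlinarith
    by_contra hcon
    push Not at hcon
    nlinarith
  have hlow : 1 - δ / 2 < (T : ℝ) := by
    obtain ⟨b, hb⟩ : ∃ b : ℝ≥0, (b : ℝ) = 1 - δ / 2 :=
      ⟨_, Real.coe_toNNReal _ (by linarith)⟩
    have hb0 : b ≠ 0 := by
      rw [← NNReal.coe_ne_zero, hb]; linarith
    rw [← hb, NNReal.coe_lt_coe, ← not_le, hT _ hb0, not_le, ← one_lt_div hk]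
    have h1 := (abs_le.1 (hM b (by rw [hb, abs_le]; constructor <;> linarith))).1
    have h2 : 1 + δ / 2 ≤ (1 : ℝ) / b := by
      rw [hb, le_div_iff₀ (by linarith)]; nlinarith
    by_contra hcon
    push Not at hcon
    nlinarith
  have hT0 : (0 : ℝ) < T := by linarith
  have hTne : T ≠ 0 := NNReal.coe_ne_zero.1 hT0.ne'
  have hTδ : |(T : ℝ) - 1| ≤ δ := by rw [abs_le]; constructor <;> linarith
  have hk4 : 4 ≤ k := by
    have := (div_le_iff₀ hk).1 hkδ
    nlinarith
  have hinvk : 1 / k ≤ δ / 2 := by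
    have : 2 / k = 2 * (1 / k) := by ring
    linarith
  have hinvk0 : 0 < 1 / k := by positivity
  have hMT : M T / k ≤ 1 := (div_le_one hk).2 ((hT T hTne).1 le_rfl)
  have hge : z - 2 * η ≤ s * (1 - 1 / T) := by
    have h1 := (abs_le.1 (hM T hTδ)).1
    have h2 : s * (M T / k - 1 / T) ≤ s * (1 - 1 / T) := by gcongr
    linarith
  -- `M T` may fall short of `k`, so the reverse bound is read off at `w = T (1 - 1/k)`, just below
  -- `T`, where `M w > k`. The shift costs at most `4 / √k ≤ η`.
  have hle : s * (1 - 1 / T) ≤ z + 3 * η := by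
    obtain ⟨w, hwr⟩ : ∃ w : ℝ≥0, (w : ℝ) = T * (1 - 1 / k) :=
      ⟨_, Real.coe_toNNReal _ (mul_nonneg hT0.le (by linarith))⟩
    have hw0 : (0 : ℝ) < w := by rw [hwr]; exact mul_pos hT0 (by linarith)
    have hwT : w < T := by rw [← NNReal.coe_lt_coe, hwr]; nlinarith
    have hMw : 1 < M w / k := by
      rw [one_lt_div hk, ← not_le, ← hT w (NNReal.coe_ne_zero.1 hw0.ne'), not_le]
      exact hwT
    have h1 := (abs_le.1 (hM w (by rw [hwr, abs_le]; constructor <;> nlinarith))).2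
    have h2 : s * (1 - 1 / w) ≤ s * (M w / k - 1 / w) := by gcongr
    have h3 : s * (1 / w - 1 / T) ≤ 4 / s := by
      have h4 : (1 : ℝ) / w - 1 / T = 1 / (T * (k - 1)) := by
        have : k - 1 ≠ 0 := by linarith
        have : T * (1 - 1 / k) = T * (k - 1) / k := by field_simp
        rw [hwr, this]
        field_simp
        ring
      have hpos : 0 < T * (k - 1) := mul_pos hT0 (by linarith)
      rw [h4, mul_one_div, div_le_div_iff₀ hpos hs0, hss]
      nlinarith
    have h5 : s * (1 - 1 / T) = s * (1 - 1 / w) + s * (1 / w - 1 / T) := by ring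
    linarith
  have hLT := abs_le.1 (hL T hTδ)
  -- The first term is `y` up to `2 * η`, and `s (1 - 1/T)` is `z` up to `3 * η`.
  have hid : s * (L T / k - p) = s * (L T / k - p / T) - p * (s * (1 - 1 / T)) := by ring
  rw [hid, abs_le]
  constructor <;> nlinarith

variable {d : ℕ} {Ω : Type*} [MeasurableSpace Ω] {P : Measure Ω} [IsProbabilityMeasure P]
  {X : ℕ → Ω → Orthant d} {μ Λ : Measure (Orthant d)}
  {k : ℕ → ℕ} {v : ℕ → ℝ≥0} {c : ℝ≥0} {r : Orthant d → ℝ≥0}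

namespace TailApproximation

/-- Markov's inequality: the mean absolute deviation is of order `√k`, negligible against `k`. It
keeps the offset `z` small relative to `√k` when the threshold is localised. -/
lemma tendsto_measure_abs_centredCount (h : TailApproximation μ k v Λ c)
    (hX : ∀ i, Measurable (X i)) (hlaw : ∀ i, P.map (X i) = μ) (hind : iIndepFun X P)
    {B : Set (Orthant d)} (hB : MeasurableSet B) (hBc : B ⊆ {x | c ≤ supNorm x})
    (hBf : Λ (frontier B) = 0) {ρ : ℝ} (hρ : 0 < ρ) :
    Tendsto (fun n : ℕ => P {ω | ρ * k n ≤ |centredCount μ X n (v n • B) ω|}) atTop (𝓝 0) := by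
  have h1 : Tendsto (fun n : ℕ => √(n / k n * μ.real (v n • B)) / (ρ * √(k n : ℝ))) atTop (𝓝 0) :=
    ((h.tendsto hB hBc hBf).sqrt).div_atTop (h.tendsto_sqrt.const_mul_atTop hρ)
  have h2 := ENNReal.tendsto_ofReal h1
  rw [ENNReal.ofReal_zero] at h2
  refine tendsto_of_tendsto_of_tendsto_of_le_of_le' tendsto_const_nhds h2
    (Eventually.of_forall fun _ => zero_le) ?_
  filter_upwards [h.k_atTop.eventually_gt_atTop 0] with n hkn
  have hk0 : (0 : ℝ) < k n := Nat.cast_pos.2 hkn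
  have hs : 0 < √(k n : ℝ) := Real.sqrt_pos.2 hk0
  have hss : √(k n : ℝ) * √(k n : ℝ) = k n := Real.mul_self_sqrt hk0.le
  have hm := measurableSet_smul hB (h.ne_zero n)
  have h3 := mul_meas_ge_le_integral_of_nonneg (μ := P)
    (f := fun ω => |centredCount μ X n (v n • B) ω|) (ae_of_all _ fun ω => abs_nonneg _)
    ((memLp_centredCount hX hm n).integrable one_le_two).abs (ρ * k n)
  have h4 := h3.trans (integral_abs_centredCount_le hX hlaw hind hm n)
  rw [← ENNReal.ofReal_toReal (measure_ne_top P _)]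
  refine ENNReal.ofReal_le_ofReal ?_
  rw [← measureReal_def, le_div_iff₀ (by positivity)]
  have h5 : √(n * μ.real (v n • B)) = √(n / k n * μ.real (v n • B)) * √(k n : ℝ) := by
    rw [← Real.sqrt_mul (by positivity)]
    congr 1
    field_simp
  rw [h5] at h4
  generalize P.real {ω | ρ * k n ≤ |centredCount μ X n (v n • B) ω|} = q at h4 ⊢
  refine le_of_mul_le_mul_right (le_of_eq_of_le ?_ h4) hs
  calc q * (ρ * √(k n : ℝ)) * √(k n : ℝ) = ρ * (√(k n : ℝ) * √(k n : ℝ)) * q := by ring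
    _ = ρ * k n * q := by rw [hss]

variable [IsProbabilityMeasure μ]

/-- Uniform expansion, over dilations by factors close to `1`, of the numbers of sample points in
the rescaled copies of `A`. -/
theorem uniform_expansion [IsFiniteMeasure Λ] (h : TailApproximation μ k v Λ c) (hc : 0 < c)
    (hX : ∀ i, Measurable (X i)) (hlaw : ∀ i, P.map (X i) = μ) (hind : iIndepFun X P)
    (hr : IsRiskFunctional r) {A : Set (Orthant d)}
    (hAalg : A ∈ generateSetAlgebra (stableSets r)) (hAr : A ⊆ exceedanceSet r)
    (hA : A ⊆ {x | 2 * c ≤ supNorm x}) (hAf : Λ (frontier A) = 0) {η : ℝ} (hη : 0 < η) :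
    ∀ᶠ δ in 𝓝[>] (0 : ℝ), ∀ᶠ n : ℕ in atTop, P {ω | ∃ t : ℝ≥0, |(t : ℝ) - 1| ≤ δ ∧
      2 * η < |√(k n : ℝ) * (sampleCount X n (v n • t • A) ω / k n - Λ.real A / t) -
        centredCount μ X n (v n • A) ω / √(k n : ℝ)|} ≤ ENNReal.ofReal η := by
  obtain ⟨δ₁, hδ₁, h1⟩ := h.uniform_deviation_smul hc
    (measurableSet_of_mem_generateSetAlgebra hAalg) hA hAf hη
  obtain ⟨δ₂, hδ₂, h2⟩ := h.equicontinuous hc hX hlaw hind hr hAalg hAr hA hAf hη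
  filter_upwards [Ioo_mem_nhdsGT (lt_min hδ₁ hδ₂)] with δ hδ
  filter_upwards [h1, h2, h.k_atTop.eventually_gt_atTop 0] with n hn1 hn2 hkn
  refine (measure_mono ?_).trans hn2
  rintro ω ⟨t, ht, hlt⟩
  refine ⟨t, ht.trans (hδ.2.le.trans (min_le_right _ _)), ?_⟩
  have hk0 : (0 : ℝ) < k n := Nat.cast_pos.2 hkn
  have hs : 0 < √(k n : ℝ) := Real.sqrt_pos.2 hk0
  have hss : √(k n : ℝ) * √(k n : ℝ) = k n := Real.mul_self_sqrt hk0.le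
  have h3 := hn1 t (ht.trans (hδ.2.le.trans (min_le_left _ _)))
  -- Splits the remainder into the bias of `t • A` and the increment of the empirical process from
  -- `A` to `t • A`.
  have hid : √(k n : ℝ) * (sampleCount X n (v n • t • A) ω / k n - Λ.real A / t) -
        centredCount μ X n (v n • A) ω / √(k n : ℝ) =
      √(k n : ℝ) * (n / k n * μ.real (v n • t • A) - Λ.real A / t) +
      (centredCount μ X n (v n • t • A) ω - centredCount μ X n (v n • A) ω) / √(k n : ℝ) := by
    rw [centredCount_eq n (v n • t • A)]
    generalize Λ.real A / t = q
    generalize √(k n : ℝ) = s at hs hss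
    rw [← hss]
    field_simp
    ring
  rw [hid] at hlt
  have habs : ∀ x : ℝ, |x / √(k n : ℝ)| = |x| / √(k n : ℝ) := fun x => by
    rw [abs_div, abs_of_pos hs]
  rw [← lt_div_iff₀ hs, ← habs]
  have h4 := hlt.trans_le (abs_add_le _ _)
  linarith

end TailApproximation

end KLExtremes
end

/-! ### Asymptotic normality of the empirical probabilities. -/

noncomputable section
namespace KLExtremes

variable {d K : ℕ} {r : Orthant d → ℝ≥0} {A : Fin K → Set (Orthant d)}

lemma IsAdmissiblePartition.subset (hA : IsAdmissiblePartition r A) (j : Fin K) :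
    A j ⊆ exceedanceSet r := by
  rw [← hA.cover]
  exact Set.subset_iUnion A j

lemma disjoint_smul_set {w : ℝ≥0} (hw : w ≠ 0) {S T : Set (Orthant d)} (h : Disjoint S T) :
    Disjoint (w • S) (w • T) :=
  Set.disjoint_left.2 fun _ hS hT =>
    Set.disjoint_left.1 h ((mem_smul_set_iff hw).1 hS) ((mem_smul_set_iff hw).1 hT)

lemma frontier_iUnion_subset {ι E : Type*} [Finite ι] [TopologicalSpace E] (S : ι → Set E) :
    frontier (⋃ i, S i) ⊆ ⋃ i, frontier (S i) := by
  rintro x ⟨hx, hx'⟩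
  rw [closure_iUnion_of_finite] at hx
  obtain ⟨i, hi⟩ := Set.mem_iUnion.1 hx
  exact Set.mem_iUnion.2 ⟨i, hi, fun h => hx' (interior_mono (Set.subset_iUnion S i) h)⟩

lemma IsAdmissiblePartition.measure_frontier (hA : IsAdmissiblePartition r A)
    {κ : Measure (Orthant d)} (h : ∀ j, κ (frontier (A j)) = 0) :
    κ (frontier (exceedanceSet r)) = 0 := by
  rw [← hA.cover]
  exact measure_mono_null (frontier_iUnion_subset A) (measure_iUnion_null h)

section

variable {Ω E : Type*} [MeasurableSpace E] {X : ℕ → Ω → E} {μ : Measure E} [IsFiniteMeasure μ]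

lemma centredCount_iUnion {S : Fin K → Set E} (hS : ∀ j, MeasurableSet (S j))
    (hd : Pairwise fun i j => Disjoint (S i) (S j)) (n : ℕ) (ω : Ω) :
    centredCount μ X n (⋃ j, S j) ω = ∑ j, centredCount μ X n (S j) ω := by
  have h := centredCount_sub_eq_sum (X := X) (μ := μ) (S := ⋃ j, S j) (T := ∅) (U := S)
    (V := fun _ => ∅) (c := fun _ => 1) (MeasurableSet.iUnion hS) MeasurableSet.empty hS
    (fun _ => MeasurableSet.empty) (fun x => ?_) n ω
  · have h0 : centredCount μ X n ∅ ω = 0 := by simp [centredCount]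
    simpa [h0] using h
  · simp only [Set.indicator_empty, sub_zero, one_mul]
    by_cases hx : ∃ j, x ∈ S j
    · obtain ⟨j, hj⟩ := hx
      rw [Finset.sum_eq_single j (fun i _ hij => Set.indicator_of_notMem
        (fun hi => Set.disjoint_left.1 (hd hij) hi hj) _) (by simp),
        Set.indicator_of_mem (Set.mem_iUnion.2 ⟨j, hj⟩), Set.indicator_of_mem hj]
    · have hx' : ∀ j, x ∉ S j := fun j hj => hx ⟨j, hj⟩
      simp [hx']

end

variable {Ω Ω' : Type*} [MeasurableSpace Ω] [MeasurableSpace Ω'] {P : Measure Ω}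
  [IsProbabilityMeasure P] {X : ℕ → Ω → Orthant d} {μ Λ : Measure (Orthant d)}
  [IsProbabilityMeasure μ] {k : ℕ → ℕ} {v : ℕ → ℝ≥0} {c : ℝ≥0}

namespace TailApproximation

/-- The empirical probabilities are, up to `o(1 / √k)`, linear in the centred counts above the
deterministic level `v_n`. -/
theorem tendstoInMeasure_empiricalProb [IsFiniteMeasure Λ] (h : TailApproximation μ k v Λ c)
    (hc : 0 < c) (hX : ∀ i, Measurable (X i)) (hlaw : ∀ i, P.map (X i) = μ) (hind : iIndepFun X P)
    (hr : IsRiskFunctional r) (hA : IsAdmissiblePartition r A)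
    (hrc : exceedanceSet r ⊆ {x | 2 * c ≤ supNorm x}) (hAf : ∀ j, Λ (frontier (A j)) = 0)
    (hΛ : Λ.real (exceedanceSet r) = 1) :
    TendstoInMeasure P (fun n ω j => √(k n : ℝ) *
        (empiricalProb r (A j) (k n) (fun i : Fin n => X i ω) - Λ.real (A j)) -
        (centredCount μ X n (v n • A j) ω / √(k n : ℝ) -
          Λ.real (A j) * ∑ i, centredCount μ X n (v n • A i) ω / √(k n : ℝ)))
      atTop (fun _ => (0 : Fin K → ℝ)) := by
  rw [tendstoInMeasure_iff_norm]
  intro ε hε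
  rw [ENNReal.tendsto_nhds_zero]
  intro ε' hε'
  have hΩf := hA.measure_frontier hAf
  have hΩm : MeasurableSet (exceedanceSet r) := measurableSet_lt measurable_const hr.measurable
  have hΩc := subset_of_subset hrc
  -- choose the precision
  have hη1 : Tendsto (fun η : ℝ => ENNReal.ofReal ((K + 2) * η)) (𝓝[>] 0) (𝓝 0) := by
    have h1 : Tendsto (fun η : ℝ => (K + 2) * η) (𝓝[>] 0) (𝓝 0) := by
      have : Continuous fun η : ℝ => (K + 2) * η := by fun_prop
      simpa using (this.tendsto 0).mono_left nhdsWithin_le_nhds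
    simpa using ENNReal.tendsto_ofReal h1
  obtain ⟨η, hηε', hη⟩ := ((ENNReal.tendsto_nhds_zero.1 hη1 ε' hε').and
    (Ioo_mem_nhdsGT (show 0 < ε / 5 by positivity))).exists
  have hη0 : 0 < η := hη.1
  -- choose the range of dilations
  have hexpA := eventually_all.2 fun j => h.uniform_expansion hc hX hlaw hind hr (hA.algebra j)
    (hA.subset j) ((hA.subset j).trans hrc) (hAf j) hη0
  have hexpΩ := h.uniform_expansion hc hX hlaw hind hr
    (generateSetAlgebra.base _ hr.exceedanceSet_mem_stableSets) subset_rfl hrc hΩf hη0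
  obtain ⟨δ, ⟨hδA, hδΩ⟩, hδ⟩ := ((hexpA.and hexpΩ).and
    (Ioo_mem_nhdsGT (show (0 : ℝ) < 1 / 2 by norm_num))).exists
  have hδ0 : 0 < δ := hδ.1
  have hδ8 : 0 < δ / 8 := by positivity
  have htight := ENNReal.tendsto_nhds_zero.1
    (h.tendsto_measure_abs_centredCount hX hlaw hind hΩm hΩc hΩf hδ8) (ENNReal.ofReal η)
    (ENNReal.ofReal_pos.2 hη0)
  have hkn : ∀ᶠ n in atTop, k n < n := by
    filter_upwards [h.k_div.eventually_lt_const one_pos, eventually_gt_atTop 0] with n hn hn0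
    rw [div_lt_one (Nat.cast_pos.2 hn0)] at hn
    exact_mod_cast hn
  have hk' : Tendsto (fun n => (k n : ℝ)) atTop atTop :=
    tendsto_natCast_atTop_atTop.comp h.k_atTop
  have h4 : Tendsto (fun n => 4 / √(k n : ℝ)) atTop (𝓝 0) :=
    tendsto_const_nhds.div_atTop h.tendsto_sqrt
  have h2 : Tendsto (fun n => 2 / (k n : ℝ)) atTop (𝓝 0) := tendsto_const_nhds.div_atTop hk'
  filter_upwards [eventually_all.2 hδA, hδΩ, htight, hkn, h.k_atTop.eventually_gt_atTop 0,
    (h.tendsto_sqrt.const_mul_atTop hδ8).eventually_ge_atTop (2 * η),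
    h4.eventually_le_const hη0, h2.eventually_le_const hδ0]
    with n hnA hnΩ hnT hkn hk0 hs1 hs2 hs3
  have hk0' : (0 : ℝ) < k n := Nat.cast_pos.2 hk0
  have hs : 0 < √(k n : ℝ) := Real.sqrt_pos.2 hk0'
  have hss : √(k n : ℝ) * √(k n : ℝ) = k n := Real.mul_self_sqrt hk0'.le
  set GA : Fin K → Set Ω := fun j => {ω | ∃ t : ℝ≥0, |(t : ℝ) - 1| ≤ δ ∧
      2 * η < |√(k n : ℝ) * (sampleCount X n (v n • t • A j) ω / k n - Λ.real (A j) / t) -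
        centredCount μ X n (v n • A j) ω / √(k n : ℝ)|} with hGA
  set GΩ : Set Ω := {ω | ∃ t : ℝ≥0, |(t : ℝ) - 1| ≤ δ ∧
      2 * η < |√(k n : ℝ) * (sampleCount X n (v n • t • exceedanceSet r) ω / k n -
        Λ.real (exceedanceSet r) / t) -
        centredCount μ X n (v n • exceedanceSet r) ω / √(k n : ℝ)|} with hGΩ
  set GT : Set Ω := {ω | δ / 8 * k n ≤ |centredCount μ X n (v n • exceedanceSet r) ω|} with hGT
  -- Off these `K + 2` exceptional events the comparison is deterministic, with `T` the order
  -- statistic divided by `v n`.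
  refine (measure_mono (t := (⋃ j, GA j) ∪ (GΩ ∪ GT)) ?_).trans ?_
  · intro ω hω
    by_contra hcon
    simp only [Set.mem_union, Set.mem_iUnion, not_or, not_exists] at hcon
    obtain ⟨hcA, hcΩ, hcT⟩ := hcon
    simp only [hGA, hGΩ, hGT, Set.mem_ofPred_eq, not_exists, not_and, not_lt, not_le, hΛ]
      at hcA hcΩ hcT
    have hsum : centredCount μ X n (v n • exceedanceSet r) ω / √(k n : ℝ) =
        ∑ i, centredCount μ X n (v n • A i) ω / √(k n : ℝ) := by
      rw [← Finset.sum_div, ← hA.cover, Set.smul_set_iUnion, centredCount_iUnion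
        (fun j => measurableSet_smul (measurableSet_of_mem_generateSetAlgebra (hA.algebra j))
          (h.ne_zero n)) fun i j hij => disjoint_smul_set (h.ne_zero n) (hA.disjoint hij)]
    refine (not_le.2 ?_) (show ε ≤ _ from hω)
    rw [sub_zero]
    refine lt_of_le_of_lt ((pi_norm_le_iff_of_nonneg (by positivity : 0 ≤ 5 * η)).2 fun j => ?_)
      (by linarith [hη.2])
    rw [Real.norm_eq_abs, ← hsum, empiricalProb_eq]
    have hp1 : Λ.real (A j) ≤ 1 := hΛ ▸ measureReal_mono (hA.subset j)
    have hT : v n * (threshold r X n (k n) ω / v n) = threshold r X n (k n) ω :=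
      mul_div_cancel₀ _ (h.ne_zero n)
    have key := abs_offset_at_threshold_le (k := (k n : ℝ)) (δ := δ) (η := η)
      (z := centredCount μ X n (v n • exceedanceSet r) ω / √(k n : ℝ))
      (y := centredCount μ X n (v n • A j) ω / √(k n : ℝ)) (p := Λ.real (A j))
      (M := fun t => sampleCount X n (v n • t • exceedanceSet r) ω)
      (L := fun t => sampleCount X n (v n • t • A j) ω)
      (T := threshold r X n (k n) ω / v n) hδ0 hδ.2.le hk0' hcΩ (hcA j) ?_ ?_ hs1 hs2 hs3
      measureReal_nonneg hp1
    · rwa [smul_smul, hT] at key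
    · intro t ht
      rw [smul_smul, hr.smul_exceedanceSet (mul_ne_zero (h.ne_zero n) ht), ← threshold_le_iff hkn,
        div_le_iff₀ (pos_iff_ne_zero.2 (h.ne_zero n)), mul_comm t]
    · rw [abs_div, abs_of_pos hs, div_le_iff₀ hs, mul_assoc, hss]
      exact hcT.le
  · calc P ((⋃ j, GA j) ∪ (GΩ ∪ GT)) ≤ ∑ _j : Fin K, ENNReal.ofReal η +
          (ENNReal.ofReal η + ENNReal.ofReal η) := by
          refine (measure_union_le _ _).trans (add_le_add ?_ ((measure_union_le _ _).trans
            (add_le_add hnΩ hnT)))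
          refine (measure_iUnion_le _).trans ?_
          rw [tsum_fintype]
          exact Finset.sum_le_sum fun j _ => hnA j
      _ = ENNReal.ofReal ((K + 2) * η) := by
          rw [Finset.sum_const, Finset.card_univ, Fintype.card_fin, nsmul_eq_mul, ← two_mul,
            ← add_mul, ENNReal.ofReal_mul (by positivity), ENNReal.ofReal_add (by positivity)
            (by positivity)]
          simp
      _ ≤ ε' := hηε'

/-- Asymptotic normality of the empirical probabilities for a measurable sample. -/
theorem tendstoInDistribution_empiricalProb [IsFiniteMeasure Λ] {P' : Measure Ω'}
    [IsProbabilityMeasure P'] (h : TailApproximation μ k v Λ c)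
    (hc : 0 < c) (hX : ∀ i, Measurable (X i)) (hlaw : ∀ i, P.map (X i) = μ) (hind : iIndepFun X P)
    (hr : IsRiskFunctional r) (hA : IsAdmissiblePartition r A)
    (hrc : exceedanceSet r ⊆ {x | 2 * c ≤ supNorm x}) (hAf : ∀ j, Λ (frontier (A j)) = 0)
    (hΛ : Λ.real (exceedanceSet r) = 1) {N : Fin K → Ω' → ℝ} (hN : iIndepFun N P')
    (hNlaw : ∀ j, HasLaw (N j) (gaussianReal 0 (Λ.real (A j)).toNNReal) P') :
    TendstoInDistribution
      (fun n ω j => √(k n : ℝ) *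
        (empiricalProb r (A j) (k n) (fun i : Fin n => X i ω) - Λ.real (A j)))
      atTop (fun ω' j => N j ω' - Λ.real (A j) * ∑ i, N i ω') (fun _ => P) P' := by
  have hAm : ∀ j, MeasurableSet (A j) := fun j =>
    measurableSet_of_mem_generateSetAlgebra (hA.algebra j)
  have hcc := tendstoInDistribution_centredCount hX hlaw hind (B := fun n j => v n • A j)
    (fun n j => measurableSet_smul (hAm j) (h.ne_zero n))
    (fun n i j hij => disjoint_smul_set (h.ne_zero n) (hA.disjoint hij))
    h.k_atTop h.k_div (fun j => measureReal_nonneg (μ := Λ) (s := A j)) (fun j => ?_) hN hNlaw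
  · have hg : Continuous fun (z : Fin K → ℝ) (j : Fin K) => z j - Λ.real (A j) * ∑ i, z i := by
      fun_prop
    refine tendstoInDistribution_of_tendstoInMeasure_sub _ _ (hcc.continuous_comp hg)
      (h.tendstoInMeasure_empiricalProb hc hX hlaw hind hr hA hrc hAf hΛ) fun n => ?_
    refine Measurable.aemeasurable (measurable_pi_lambda _ fun j => ?_)
    exact ((measurable_empiricalProb hX hr.measurable (hAm j) n (k n)).sub_const _).const_mul _
  · refine (h.tendsto (hAm j) ((hA.subset j).trans (subset_of_subset hrc)) (hAf j)).congr fun n => ?_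
    ring

end TailApproximation

end KLExtremes
end

/-! ### The theorem. -/

theorem mainTheorem4 {d K : ℕ}
    {Ω : Type*} [MeasurableSpace Ω] (P : Measure Ω) [IsProbabilityMeasure P]
    -- the i.i.d. sample, with common law `μ`
    (X : ℕ → Ω → KLExtremes.Orthant d) (μ : Measure (KLExtremes.Orthant d))
    (hlaw : ∀ i, HasLaw (X i) μ P) (hindep : iIndepFun X P)
    (hpareto : KLExtremes.HasParetoMargins μ)
    -- multivariate regular variation and the second-order condition
    (ν : Measure (KLExtremes.Orthant d)) (hmrv : KLExtremes.IsExceedanceDistribution μ ν)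
    (a : ℝ≥0 → ℝ) (hsecond : KLExtremes.SecondOrderCondition μ ν a)
    -- the risk functional and the partition
    (r : KLExtremes.Orthant d → ℝ≥0) (hr : KLExtremes.IsRiskFunctional r)
    (hpos : 0 < KLExtremes.exponentMeasure ν (KLExtremes.exceedanceSet r))
    (A : Fin K → Set (KLExtremes.Orthant d)) (hA : KLExtremes.IsAdmissiblePartition r A)
    (hbdry : ∀ j, KLExtremes.exponentMeasure ν (frontier (A j)) = 0)
    -- the intermediate sequence
    (k : ℕ → ℕ) (hk : Tendsto k atTop atTop)
    (hkn : Tendsto (fun n => (k n : ℝ) / (n : ℝ)) atTop (𝓝 0))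
    (hka : Tendsto
      (fun n => √(k n : ℝ) * a (KLExtremes.tailQuantile μ ((n : ℝ) / (k n : ℝ)))) atTop (𝓝 0))
    -- the independent normal variables of the limit
    {Ω' : Type*} [MeasurableSpace Ω'] (P' : Measure Ω') [IsProbabilityMeasure P']
    (N : Fin K → Ω' → ℝ) (hNindep : iIndepFun N P')
    (hNlaw : ∀ j,
      HasLaw (N j) (gaussianReal 0 (KLExtremes.limitProb μ r (A j)).toNNReal) P') :
    (∀ j, Tendsto (KLExtremes.condProb μ r (A j)) atTop
      (𝓝 (KLExtremes.limitProb μ r (A j)))) ∧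
    TendstoInDistribution
      (fun (n : ℕ) (ω : Ω) (j : Fin K) =>
        √(k n : ℝ) * (KLExtremes.empiricalProb r (A j) (k n) (fun i : Fin n => X i ω)
          - KLExtremes.limitProb μ r (A j)))
      atTop
      (fun (ω' : Ω') (j : Fin K) =>
        N j ω' - KLExtremes.limitProb μ r (A j) * ∑ i, N i ω')
      (fun _ => P) P' := by
  have := hmrv.prob
  have hμ : IsProbabilityMeasure μ := by
    rw [← (hlaw 0).map_eq]
    exact Measure.isProbabilityMeasure_map (hlaw 0).aemeasurable
  obtain ⟨ε, hε, hrε⟩ := hr.away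
  have hc : 0 < ε / 2 := half_pos hε
  have hrc : KLExtremes.exceedanceSet r ⊆ {x | 2 * (ε / 2) ≤ KLExtremes.supNorm x} := by
    rw [mul_div_cancel₀ ε two_ne_zero]
    exact hrε
  have hrc' := KLExtremes.TailApproximation.subset_of_subset hrc
  have hΩm : MeasurableSet (KLExtremes.exceedanceSet r) :=
    measurableSet_lt measurable_const hr.measurable
  have hAm : ∀ j, MeasurableSet (A j) := fun j =>
    KLExtremes.measurableSet_of_mem_generateSetAlgebra (hA.algebra j)
  have hcl : IsClosed {x : KLExtremes.Orthant d | ε / 2 ≤ KLExtremes.supNorm x} :=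
    isClosed_le continuous_const KLExtremes.continuous_supNorm
  have hexp : ∀ {B : Set (KLExtremes.Orthant d)}, MeasurableSet B →
      B ⊆ {x | ε / 2 ≤ KLExtremes.supNorm x} →
      KLExtremes.exponentMeasure ν B = (KLExtremes.tailMeasure ν (ε / 2)).real B := fun hB hBc =>
    KLExtremes.exponentMeasure_eq_tailMeasure hmrv hsecond hc hB hBc
  have hfr : ∀ {B : Set (KLExtremes.Orthant d)}, B ⊆ KLExtremes.exceedanceSet r →
      KLExtremes.exponentMeasure ν (frontier B) =
        (KLExtremes.tailMeasure ν (ε / 2)).real (frontier B) := fun hB =>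
    hexp isClosed_frontier.measurableSet
      (frontier_subset_closure.trans (closure_minimal (hB.trans hrc') hcl))
  have hAf : ∀ j, KLExtremes.tailMeasure ν (ε / 2) (frontier (A j)) = 0 := fun j => by
    rw [← measureReal_eq_zero_iff, ← hfr (hA.subset j), hbdry j]
  have hΩf : KLExtremes.exponentMeasure ν (frontier (KLExtremes.exceedanceSet r)) = 0 := by
    rw [hfr subset_rfl, measureReal_eq_zero_iff]
    exact hA.measure_frontier hAf
  have hlim := fun j => hsecond.tendsto_condProb hr hpos hΩf (hAm j) (hA.subset j) (hbdry j)
  -- Normalising by the mass of `Ω_r` makes the limit measure of `A j` equal to `p_j`.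
  obtain ⟨b, hb⟩ : ∃ b : ℝ≥0, (b : ℝ) = KLExtremes.exponentMeasure ν (KLExtremes.exceedanceSet r) :=
    ⟨_, Real.coe_toNNReal _ hpos.le⟩
  have hb0 : 0 < b := by rw [← NNReal.coe_pos, hb]; exact hpos
  have hΛ : ∀ {B : Set (KLExtremes.Orthant d)}, MeasurableSet B →
      B ⊆ KLExtremes.exceedanceSet r → (b⁻¹ • KLExtremes.tailMeasure ν (ε / 2)).real B =
        KLExtremes.exponentMeasure ν B /
          KLExtremes.exponentMeasure ν (KLExtremes.exceedanceSet r) := by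
    intro B hB hBr
    rw [measureReal_nnreal_smul_apply, ← hexp hB (hBr.trans hrc'), ← hb, NNReal.coe_inv,
      div_eq_inv_mul]
  have hp : ∀ j, KLExtremes.limitProb μ r (A j) =
      (b⁻¹ • KLExtremes.tailMeasure ν (ε / 2)).real (A j) := fun j => by
    rw [hΛ (hAm j) (hA.subset j)]
    exact (hlim j).limUnder_eq
  refine ⟨fun j => ?_, ?_⟩
  · rw [hp j, hΛ (hAm j) (hA.subset j)]
    exact hlim j
  have htail := hsecond.tailApproximation hmrv hpareto hk hkn hka hb0 hc
  -- The sample is only a.e. measurable; measurable modifications keep the laws, the independence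
  -- and, almost surely, the estimators.
  have hX : ∀ i, X i =ᵐ[P] (hlaw i).aemeasurable.mk (X i) := fun i =>
    (hlaw i).aemeasurable.ae_eq_mk
  simp only [hp] at hNlaw ⊢
  have hmain := htail.tendstoInDistribution_empiricalProb hc
    (fun i => (hlaw i).aemeasurable.measurable_mk)
    (fun i => (Measure.map_congr (hX i)).symm.trans (hlaw i).map_eq)
    (hindep.congr hX) hr hA hrc
    (fun j => by rw [Measure.smul_apply, hAf j, smul_zero])
    (by rw [hΛ hΩm subset_rfl, div_self hpos.ne']) hNindep hNlaw
  refine hmain.congr (fun n => ?_) (ae_eq_refl _)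
  filter_upwards [ae_all_iff.2 hX] with ω hω
  simp only [hω]
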